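/- **Theorem ($(2+\epsilon)$-ANN for time series).** A *curve* is a continuous function $[0,1]\to\mathbb R$, and $\langle x_1,\dots,x_m\rangle$ denotes the curve obtained by linearly interpolating the reals $x_1,\dots,x_m$. A *time series of complexity at most $m$* is such a curve, given by the sequence $x_1,\dots,x_m$ (any sequence of $m$ reals is allowed). The *(continuous) Fréchet distance* of two curves is $$\mathrm d_F(\pi,\tau)=\inf_{f,g}\ \max_{\alpha\in[0,1]}|\pi(f(\alpha))-\tau(g(\alpha))|,$$ where $f,g:[0,1]\to[0,1]$ range over the continuous non-decreasing functions with $f(0)=g(0)=0$ and $f(1)=g(1)=1$. Let $c>1$ and $r>0$. A *$c$-ANN data structure* with distance threshold $r$ for curves $\pi_1,\dots,\pi_n$ answers each query curve $\tau$ as follows: (i) if $\mathrm d_F(\pi_i,\tau)\le r$ for some $i$, it reports an index $j$ with $\mathrm d_F(\pi_j,\tau)\le cr$; (ii) if $\mathrm d_F(\pi_i,\tau)\ge cr$ for all $i$, it returns "no"; (iii) otherwise it either reports an index $j$ with $\mathrm d_F(\pi_j,\tau)\le cr$ or returns "no". The model of computation is the real RAM: memory cells hold real numbers, and $+,-,\times,\div$,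 the comparison $\le$, the floor function, indirect memory access and drawing a uniform random number from $[0,1]$ (independent of the earlier ones) take unit time; the only numerical constants in programs are integers. The space of a data structure is the number of memory cells that it occupies after preprocessing, and a query has access to these cells and to the query curve only. There are a randomized preprocessing algorithm, a query algorithm and a constant $C>0$ such that the following holds for all integers $n\ge 1$ and $1\le k\le m$, all $\epsilon\in(0,1]$ and $r>0$, and all time series $\pi_1,\dots,\pi_n$ of complexity at most $m$. Given $n,m,k,\epsilon,r$ and $\pi_1,\dots,\pi_n$, the preprocessing algorithm has expected running time at most $$C\,nm\left(\frac{C\,m}{k\epsilon}\right)^{k},$$ and whenever it halts it has built a $(2+\epsilon)$-ANN data structure with distance threshold $r$ for $\pi_1,\dots,\pi_n$ and all query time series of complexity at most $k$ (each given by $k$ reals), which uses space at most $$n\left(\frac{C\,m}{k\epsilon}\right)^{k}.$$ The query algorithm answers every query correctly, in worst-case time at most $C\,k\,2^{k}$. -/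

import Mathlib

/-! ### Time series and the continuous Fréchet distance -/

/-- The time series `⟨x₀, …, x_{m-1}⟩`: the curve `[0,1] → ℝ` that interpolates the values `x i`
linearly between the equidistant parameters `i / (m - 1)`. It is written in the basis of hat
functions: `max 0 (1 - |t (m - 1) - i|)` is `1` at the `i`-th parameter, `0` at all the others, and
linear in between. The sequence `x` is arbitrary: consecutive values may coincide and interior
points need not be local extrema, so the curves `polyline x` with `x : Fin m → ℝ` are all the
time series with at most `m` vertices (up to reparametrization). -/
noncomputable def polyline {m : ℕ} (x : Fin m → ℝ) : C(unitInterval, ℝ) where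
  toFun t := ∑ i : Fin m, x i * max 0 (1 - |(t : ℝ) * ((m : ℝ) - 1) - ((i : ℕ) : ℝ)|)
  continuous_toFun := by fun_prop

/-- The reparametrizations: continuous non-decreasing maps of `[0,1]` to itself that fix `0`
and `1`. -/
def Reparam : Type :=
  {f : C(unitInterval, unitInterval) // Monotone f ∧ f 0 = 0 ∧ f 1 = 1}

/-- The continuous Fréchet distance of two curves `[0,1] → ℝ`. -/
noncomputable def frechetDist (π τ : C(unitInterval, ℝ)) : ℝ :=
  ⨅ φ : Reparam × Reparam, ⨆ α : unitInterval, |π (φ.1.1 α) - τ (φ.2.1 α)|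

/-- The answers that a `c`-approximate near neighbour data structure with distance threshold `r`
for the curves `P 0, …, P (n-1)` may give to the query `τ`; `none` is the answer "no", and `some j`
reports the curve `P j`. -/
def IsANNAnswer {n : ℕ} (c r : ℝ) (P : Fin n → C(unitInterval, ℝ)) (τ : C(unitInterval, ℝ))
    (a : Option (Fin n)) : Prop :=
  ((∃ i, frechetDist (P i) τ ≤ r) → ∃ j, a = some j ∧ frechetDist (P j) τ ≤ c * r) ∧
  ((∀ i, c * r ≤ frechetDist (P i) τ) → a = none) ∧
  (a = none ∨ ∃ j, a = some j ∧ frechetDist (P j) τ ≤ c * r)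

/-! ### The real RAM with floor function and random numbers

The machine has real registers and unbounded arrays of real memory cells, of which a given program
names only finitely many. It performs `+, -, *, /`, floor, the comparison `≤`, and indirect array
access at unit cost, and it may draw independent random numbers that are uniform in `[0,1]`. The
only numerical constants in a program are integers. -/

namespace RealRAM

/-- A configuration: the contents of the registers, the contents of the arrays, and the random
numbers that have not been drawn yet. -/
structure State where
  reg : ℕ → ℝ
  arr : ℕ → ℕ → ℝ
  tape : ℕ → unitInterval

/-- Arithmetic expressions. `load a e` reads the cell of array `a` whose index is the value
of `e`. -/
inductive Expr where
  | const (z : ℤ)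
  | reg (x : ℕ)
  | load (a : ℕ) (e : Expr)
  | add (e₁ e₂ : Expr)
  | sub (e₁ e₂ : Expr)
  | mul (e₁ e₂ : Expr)
  | div (e₁ e₂ : Expr)
  | floor (e : Expr)

/-- The value of an expression; an array index is rounded down to a natural number, and division
by `0` gives `0`. -/
noncomputable def Expr.eval (s : State) : Expr → ℝ
  | const z => (z : ℝ)
  | reg x => s.reg x
  | load a e => s.arr a ⌊e.eval s⌋₊
  | add e₁ e₂ => e₁.eval s + e₂.eval s
  | sub e₁ e₂ => e₁.eval s - e₂.eval s
  | mul e₁ e₂ => e₁.eval s * e₂.eval s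
  | div e₁ e₂ => e₁.eval s / e₂.eval s
  | floor e => ((⌊e.eval s⌋ : ℤ) : ℝ)

/-- The number of elementary operations in the evaluation of an expression. -/
def Expr.cost : Expr → ℕ
  | const _ => 1
  | reg _ => 1
  | load _ e => e.cost + 1
  | add e₁ e₂ => e₁.cost + e₂.cost + 1
  | sub e₁ e₂ => e₁.cost + e₂.cost + 1
  | mul e₁ e₂ => e₁.cost + e₂.cost + 1
  | div e₁ e₂ => e₁.cost + e₂.cost + 1
  | floor e => e.cost + 1

/-- Boolean combinations of comparisons. -/
inductive Test where
  | le (e₁ e₂ : Expr)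
  | not (b : Test)
  | and (b₁ b₂ : Test)

def Test.holds (s : State) : Test → Prop
  | le e₁ e₂ => e₁.eval s ≤ e₂.eval s
  | not b => ¬ b.holds s
  | and b₁ b₂ => b₁.holds s ∧ b₂.holds s

def Test.cost : Test → ℕ
  | le e₁ e₂ => e₁.cost + e₂.cost + 1
  | not b => b.cost + 1
  | and b₁ b₂ => b₁.cost + b₂.cost + 1

/-- Programs. `store a i e` writes the value of `e` to the cell of array `a` whose index is the
value of `i`, and `rand x` draws a fresh random number into register `x`. -/
inductive Prog where
  | skip
  | assign (x : ℕ) (e : Expr)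
  | store (a : ℕ) (i e : Expr)
  | rand (x : ℕ)
  | seq (c₁ c₂ : Prog)
  | ite (b : Test) (c₁ c₂ : Prog)
  | while (b : Test) (c : Prog)

noncomputable def State.setReg (s : State) (x : ℕ) (v : ℝ) : State :=
  { s with reg := Function.update s.reg x v }

noncomputable def State.setCell (s : State) (a i : ℕ) (v : ℝ) : State :=
  { s with arr := Function.update s.arr a (Function.update (s.arr a) i v) }

noncomputable def State.draw (s : State) (x : ℕ) : State :=
  { reg := Function.update s.reg x (s.tape 0 : ℝ)
    arr := s.arr
    tape := fun i => s.tape (i + 1) }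

/-- `Exec c s t s'`: started in configuration `s`, the program `c` halts after `t` elementary
operations in configuration `s'`. -/
inductive Exec : Prog → State → ℕ → State → Prop
  | skip (s : State) : Exec .skip s 1 s
  | assign (s : State) (x : ℕ) (e : Expr) :
      Exec (.assign x e) s (e.cost + 1) (s.setReg x (e.eval s))
  | store (s : State) (a : ℕ) (i e : Expr) :
      Exec (.store a i e) s (i.cost + e.cost + 1) (s.setCell a ⌊i.eval s⌋₊ (e.eval s))
  | rand (s : State) (x : ℕ) : Exec (.rand x) s 1 (s.draw x)
  | seq {c₁ c₂ : Prog} {s s₁ s₂ : State} {t₁ t₂ : ℕ} :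
      Exec c₁ s t₁ s₁ → Exec c₂ s₁ t₂ s₂ → Exec (.seq c₁ c₂) s (t₁ + t₂) s₂
  | iteTrue {b : Test} {c₁ c₂ : Prog} {s s₁ : State} {t : ℕ} :
      b.holds s → Exec c₁ s t s₁ → Exec (.ite b c₁ c₂) s (b.cost + t) s₁
  | iteFalse {b : Test} {c₁ c₂ : Prog} {s s₁ : State} {t : ℕ} :
      ¬ b.holds s → Exec c₂ s t s₁ → Exec (.ite b c₁ c₂) s (b.cost + t) s₁
  | whileTrue {b : Test} {c : Prog} {s s₁ s₂ : State} {t₁ t₂ : ℕ} :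
      b.holds s → Exec c s t₁ s₁ → Exec (.while b c) s₁ t₂ s₂ →
      Exec (.while b c) s (b.cost + t₁ + t₂) s₂
  | whileFalse {b : Test} {c : Prog} {s : State} :
      ¬ b.holds s → Exec (.while b c) s b.cost s

/-- The running time of `c` from configuration `s`, which is `∞` if `c` does not halt. (The random
numbers are part of `s`, and `Exec` is deterministic.) -/
noncomputable def runTime (c : Prog) (s : State) : ENNReal :=
  ⨅ (t : ℕ) (s' : State) (_ : Exec c s t s'), (t : ENNReal)

/-- The distribution of the random numbers: independent and uniform in `[0,1]`. -/
noncomputable def tapeMeasure : MeasureTheory.Measure (ℕ → unitInterval) :=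
  MeasureTheory.Measure.infinitePi fun _ => MeasureTheory.volume

/-- The expected running time of `c`, where `init ω` is the initial configuration with the random
numbers `ω`. -/
noncomputable def expectedTime (c : Prog) (init : (ℕ → unitInterval) → State) : ENNReal :=
  ∫⁻ ω, runTime c (init ω) ∂tapeMeasure

end RealRAM

/-! ### Data structures for near neighbour queries on the real RAM -/

open RealRAM in
/-- The input of the preprocessing: `n, m, k, ε, r` are in the registers `0, …, 4`, and the `j`-th
value of the `i`-th time series is in cell `i * m + j` of array `0`. Everything else is `0`. -/
noncomputable def preprocessInput {n m : ℕ} (k : ℕ) (ε r : ℝ) (P : Fin n → Fin m → ℝ)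
    (ω : ℕ → unitInterval) : State where
  reg x := match x with
    | 0 => n
    | 1 => m
    | 2 => k
    | 3 => ε
    | 4 => r
    | _ => 0
  arr a l := if h : a = 0 ∧ l < n * m then
      P ⟨l / m, Nat.div_lt_of_lt_mul (by rw [Nat.mul_comm]; exact h.2)⟩
        ⟨l % m, Nat.mod_lt _ (Nat.pos_of_ne_zero fun hm => by simp [hm] at h)⟩
    else 0
  tape := ω

open RealRAM in
/-- The number of cells of the data structure that the preprocessing has built when it halts
in `s`: it announces it in register `0`, and the data structure itself consists of that many
initial cells of array `0`. -/
noncomputable def structureSize (s : State) : ℕ := ⌊s.reg 0⌋₊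

open RealRAM in
/-- The input of a query: array `0` holds the data structure that the preprocessing has left
in `s`, array `1` holds the values of the query time series, and register `0` holds their number.
Everything else is `0`; in particular nothing but the data structure survives from the
preprocessing. -/
noncomputable def queryInput (s : State) {k : ℕ} (q : Fin k → ℝ) (ω : ℕ → unitInterval) :
    State where
  reg x := if x = 0 then k else 0
  arr a l :=
    if a = 0 then (if l < structureSize s then s.arr 0 l else 0)
    else if a = 1 then (if h : l < k then q ⟨l, h⟩ else 0)
    else 0
  tape := ω

open RealRAM in
/-- The query has halted in `s` with the answer `a`: register `0` holds `0` for "no", and `j + 1`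
for a report of the `j`-th time series (counted from `0`). -/
def Reports {n : ℕ} (s : State) (a : Option (Fin n)) : Prop :=
  s.reg 0 = match a with
    | none => 0
    | some j => ((j : ℕ) : ℝ) + 1

/-!
The idea is to reduce every query to finitely many exact matches in a dictionary, and to pay for
this with the factor `2 + ε`. Everything is measured in units of `g = ε r / 16`, so that the
threshold `r` becomes `16 / ε`. With `ρ = 16 / ε + 2`, the error budget is `(2 ρ + 1) g < (2 + ε)
r`: one `ρ` for simplifying the query curve, one for matching it to a time series, and `1` for
rounding.

*Simplification.* Given a query with vertices `Q`, the query algorithm runs through the sets of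
vertices that contain the first and the last one, given by `2 ^ k` bit masks. It discards those
whose segments are not close to the parts of the query that they replace (`GapsOK`), rounds the
remaining vertices down to integers, and looks the resulting integer sequence up. The dictionary
holds the integer sequences of length at most `k` that have a matching within `ρ` with some time
series and whose vertices lie near vertices of that series; each one is stored along with the index
of a series.

*Matchings.* Closeness of two curves on the line has a combinatorial certificate, `VReach`: each
vertex of one curve is assigned to a point of an edge of the other, and between consecutive points
the other curve stays within `ρ` of the segment and never goes back by more than `2 ρ`. Greedy
choice of the points loses nothing. A certificate bounds the Fréchet distance
(`VReach.frechetDist_le`), which together with the triangle inequality shows that everything that is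
reported is close enough (`frechetDist_le_of_vreach_floor`).

*Why some simplification is found.* If a series `X` is close to the query, a good pair of
reparametrizations puts the vertices of the query on edges of `X` (`exists_align`). A vertex of the
query in the middle of an edge, far from both of its ends, is dropped; between consecutive vertices
that survive, the query is nearly monotone, so that neither the query nor `X` is far from the new
segment (`Align.exists_simplification`). All the vertices that survive are near vertices of `X`, so
that `O(1 / ε)` integers are candidates for each of them, and the rounded curve is in the dictionary
(`exists_vreach_of_frechetDist_lt`).

*Preprocessing.* A breadth-first search builds all the matchings, each step being either "move on to
the next edge" or "assign the next vertex to this edge". A `SearchState` records what the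
certificate needs from the past: maximum, minimum, largest drop and largest rise since the last
vertex. With `G = O(1 / ε)` candidates there are at most `(G + 1) ^ k * (m - 1 + k).choose k`
complete matchings for a series, since a matching amounts to a lattice path with labelled steps; the
potentials `leafBound` and `workBound` express this as a recursion of Pascal type.

*Dictionary.* An integer sequence, read as the digits of a number, is a single integer key, and an
entry is a key together with the index of a series. To look up a key in constant time and linear
space, a table with `L * L` places, `L = 4 (N + 1)` for `N` entries, is stored as one number `W` in
a base that exceeds all the entries. The place of a key `x` is read off the fractional part of `a x`
for a random `a` in `[0, 1]`. With probability at least `1 / 2` there is no collision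
(`volume_badSet_le`), and otherwise a new `a` is drawn, so that the expected number of attempts is
at most two. The powers of the base are tabulated, separately for the rows and the columns, which
takes only `2 L` cells.

*Programs.* `Runs c s T P` says that `c` started in `s` halts within time `T` in a state with `P`,
and each program comes with a lemma of this form, up to `preprocess_spec` and `query_runs`.
-/

/-! ### Curves and parameters -/

/-- The time series with the `m` values `X 0, …, X (m - 1)`. -/
noncomputable def curve (m : ℕ) (X : ℕ → ℝ) : C(unitInterval, ℝ) :=
  polyline fun p : Fin m => X p

theorem curve_eq_sum (m : ℕ) (X : ℕ → ℝ) (t : unitInterval) :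
    curve m X t = ∑ i ∈ Finset.range m, X i * max 0 (1 - |(t : ℝ) * ((m : ℝ) - 1) - (i : ℝ)|) :=
  Fin.sum_univ_eq_sum_range
    (fun i => X i * max 0 (1 - |(t : ℝ) * ((m : ℝ) - 1) - (i : ℝ)|)) m

theorem curve_eq_of_mem_edge {m : ℕ} (X : ℕ → ℝ) {t : unitInterval} {p : ℕ} (hp : p + 1 < m)
    (h1 : (p : ℝ) ≤ t * ((m : ℝ) - 1)) (h2 : t * ((m : ℝ) - 1) ≤ p + 1) :
    curve m X t = X p + (t * ((m : ℝ) - 1) - p) * (X (p + 1) - X p) := by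
  rw [curve_eq_sum]
  set u : ℝ := t * ((m : ℝ) - 1) with hu
  have hsub : ({p, p + 1} : Finset ℕ) ⊆ Finset.range m := by
    intro i hi
    simp only [Finset.mem_insert, Finset.mem_singleton] at hi
    simp only [Finset.mem_range]; omega
  rw [← Finset.sum_subset hsub, Finset.sum_pair (by omega)]
  · have e1 : |u - p| = u - p := abs_of_nonneg (by linarith)
    have e2 : |u - ((p + 1 : ℕ) : ℝ)| = p + 1 - u := by
      rw [abs_of_nonpos (by push_cast; linarith)]; push_cast; ring
    rw [e1, e2, max_eq_right (by linarith), max_eq_right (by linarith)]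
    ring
  · intro i _ hi
    simp only [Finset.mem_insert, Finset.mem_singleton, not_or] at hi
    have : 1 - |u - (i : ℝ)| ≤ 0 := by
      rcases lt_or_gt_of_ne hi.1 with h | h
      · have : (i : ℝ) + 1 ≤ p := by exact_mod_cast h
        have := le_abs_self (u - (i : ℝ))
        linarith
      · have h' : p + 2 ≤ i := by omega
        have : (p : ℝ) + 2 ≤ i := by exact_mod_cast h'
        have := neg_abs_le (u - (i : ℝ))
        linarith
    rw [max_eq_left this, mul_zero]

theorem curve_eq_of_eq_natCast {m : ℕ} (X : ℕ → ℝ) {t : unitInterval} {p : ℕ} (hp : p < m)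
    (h : t * ((m : ℝ) - 1) = p) : curve m X t = X p := by
  rw [curve_eq_sum, Finset.sum_eq_single p]
  · rw [h]; simp
  · intro i _ hi
    rw [h, max_eq_left, mul_zero]
    rcases lt_or_gt_of_ne hi with h | h
    · have : (i : ℝ) + 1 ≤ p := by exact_mod_cast h
      have := le_abs_self ((p : ℝ) - (i : ℝ))
      linarith
    · have : (p : ℝ) + 1 ≤ i := by exact_mod_cast h
      have := neg_abs_le ((p : ℝ) - (i : ℝ))
      linarith
  · intro h'; simp at h'; omega

/-- A parameter at which `curve m X` takes the value `X p`. All `p ≥ m - 1` get the parameter `1`,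
so that the curve also has a degenerate edge behind its last vertex. -/
noncomputable def node (m p : ℕ) : unitInterval :=
  if h : m - 1 ≤ p then 1 else
    ⟨p / ((m : ℝ) - 1), by
      have h1 : p + 1 < m := by omega
      have h2 : (p : ℝ) + 1 < m := by exact_mod_cast h1
      constructor
      · apply div_nonneg <;> [positivity; linarith]
      · rw [div_le_one (by linarith)]; linarith⟩

theorem node_of_le {m p : ℕ} (h : m - 1 ≤ p) : node m p = 1 := dif_pos h

theorem node_mul {m p : ℕ} (h : p < m) : (node m p : ℝ) * ((m : ℝ) - 1) = p := by
  unfold node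
  split_ifs with h'
  · have : m = p + 1 := by omega
    subst this; simp
  · have h1 : p + 1 < m := by omega
    have h2 : (p : ℝ) + 1 < m := by exact_mod_cast h1
    have : (m : ℝ) - 1 ≠ 0 := by linarith
    simp only
    field_simp

theorem node_mono (m : ℕ) : Monotone (node m) := by
  intro p q hpq
  by_cases hq : m - 1 ≤ q
  · rw [node_of_le hq]; exact unitInterval.le_one _
  · have hp : ¬ m - 1 ≤ p := by omega
    rw [node, node, dif_neg hp, dif_neg hq, ← Subtype.coe_le_coe]
    have h1 : q + 1 < m := by omega
    have h2 : (q : ℝ) + 1 < m := by exact_mod_cast h1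
    have : (p : ℝ) ≤ q := by exact_mod_cast hpq
    have : (0 : ℝ) ≤ q := by positivity
    simp only
    apply div_le_div_of_nonneg_right <;> linarith

theorem curve_node {m p : ℕ} (X : ℕ → ℝ) (h : p < m) : curve m X (node m p) = X p :=
  curve_eq_of_eq_natCast X h (node_mul h)

theorem curve_node_of_clip {m p : ℕ} {X : ℕ → ℝ} (hm : 0 < m) (hX : X m = X (m - 1))
    (h : p ≤ m) : curve m X (node m p) = X p := by
  rcases Nat.lt_or_ge p m with h' | h'
  · exact curve_node X h'
  · have : p = m := by omega
    subst this
    rw [node_of_le (by omega), hX, ← curve_node X (show p - 1 < p by omega),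
      node_of_le (le_refl _)]

/-- The curve `π` is affine on the parameter interval `[a, b]`. -/
def AffineOn (π : C(unitInterval, ℝ)) (a b : unitInterval) : Prop :=
  ∃ α β : ℝ, ∀ s : unitInterval, a ≤ s → s ≤ b → π s = α + β * s

theorem AffineOn.mono {π : C(unitInterval, ℝ)} {a b c d : unitInterval} (h : AffineOn π a b)
    (hac : a ≤ c) (hdb : d ≤ b) : AffineOn π c d := by
  obtain ⟨α, β, h⟩ := h
  exact ⟨α, β, fun s h1 h2 => h s (hac.trans h1) (h2.trans hdb)⟩

theorem affineOn_edge {m : ℕ} (hm : 0 < m) (X : ℕ → ℝ) (p : ℕ) :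
    AffineOn (curve m X) (node m p) (node m (p + 1)) := by
  by_cases hp : p + 1 < m
  · refine ⟨X p - p * (X (p + 1) - X p), ((m : ℝ) - 1) * (X (p + 1) - X p), fun s h1 h2 => ?_⟩
    have hm1 : (0 : ℝ) ≤ (m : ℝ) - 1 := by
      have : (1 : ℝ) ≤ m := by exact_mod_cast hm
      linarith
    have e1 := mul_le_mul_of_nonneg_right (Subtype.coe_le_coe.2 h1) hm1
    have e2 := mul_le_mul_of_nonneg_right (Subtype.coe_le_coe.2 h2) hm1
    rw [node_mul (by omega)] at e1
    rw [node_mul hp] at e2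
    push_cast at e2
    rw [curve_eq_of_mem_edge X hp e1 e2]
    ring
  · refine ⟨curve m X 1, 0, fun s h1 _ => ?_⟩
    rw [node_of_le (by omega)] at h1
    have hs : s = 1 := le_antisymm (unitInterval.le_one s) h1
    subst hs
    ring

theorem affineOn_zero_node {m : ℕ} (hm : 0 < m) (X : ℕ → ℝ) :
    AffineOn (curve m X) 0 (node m 0) := by
  rcases Nat.lt_or_ge 1 m with h | h
  · have : node m 0 = 0 := by
      rw [node, dif_neg (by omega), ← Subtype.coe_inj]; simp
    rw [this]
    exact ⟨curve m X 0, 0, fun s _ h2 => by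
      rw [le_antisymm h2 (unitInterval.nonneg s)]; simp⟩
  · have hm1 : m = 1 := by omega
    subst hm1
    exact ⟨X 0, 0, fun s _ _ => by
      rw [curve_eq_of_eq_natCast (p := 0) X (by omega) (by simp)]; simp⟩

theorem curve_zero {m : ℕ} (hm : 0 < m) (X : ℕ → ℝ) : curve m X 0 = X 0 :=
  curve_eq_of_eq_natCast X hm (by simp)

theorem exists_param_eq (π : C(unitInterval, ℝ)) {s b : unitInterval} (hsb : s ≤ b) {z : ℝ}
    (hz : (π s ≤ z ∧ z ≤ π b) ∨ (π b ≤ z ∧ z ≤ π s)) :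
    ∃ s', s ≤ s' ∧ s' ≤ b ∧ π s' = z := by
  have hc : ContinuousOn π (Set.Icc s b) := π.continuous.continuousOn
  rcases hz with hy | hy
  · obtain ⟨s, hs, e⟩ := intermediate_value_Icc hsb hc hy
    exact ⟨s, hs.1, hs.2, e⟩
  · obtain ⟨s, hs, e⟩ := intermediate_value_Icc' hsb hc hy
    exact ⟨s, hs.1, hs.2, e⟩

/-! ### Upper bounds for the Fréchet distance from chains of matched parameters -/

theorem frechetDist_le_of_reparam {π τ : C(unitInterval, ℝ)} {ρ : ℝ} (f g : Reparam)
    (h : ∀ α, |π (f.1 α) - τ (g.1 α)| ≤ ρ) : frechetDist π τ ≤ ρ := by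
  refine (ciInf_le ⟨0, ?_⟩ (f, g)).trans (ciSup_le h)
  rintro _ ⟨φ, rfl⟩
  exact Real.iSup_nonneg fun α => abs_nonneg _

theorem exists_reparam_of_frechetDist_lt {π τ : C(unitInterval, ℝ)} {ρ : ℝ}
    (h : frechetDist π τ < ρ) :
    ∃ f g : Reparam, ∀ α, |π (f.1 α) - τ (g.1 α)| ≤ ρ := by
  have : Nonempty Reparam :=
    ⟨⟨ContinuousMap.id _, monotone_id, rfl, rfl⟩⟩
  obtain ⟨φ, hφ⟩ := exists_lt_of_ciInf_lt h
  refine ⟨φ.1, φ.2, fun α => le_trans ?_ hφ.le⟩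
  refine le_ciSup (f := fun α => |π (φ.1.1 α) - τ (φ.2.1 α)|) ?_ α
  have hc : Continuous fun α => |π (φ.1.1 α) - τ (φ.2.1 α)| := by fun_prop
  exact (isCompact_range hc).bddAbove

theorem monotone_curve {m : ℕ} (hm : 0 < m) {X : ℕ → ℝ} (hX : Monotone X) :
    Monotone (curve m X) := by
  have hm1 : (0 : ℝ) ≤ (m : ℝ) - 1 := by
    have : (1 : ℝ) ≤ m := by exact_mod_cast hm
    linarith
  intro a b hab
  have hab' : (a : ℝ) * ((m : ℝ) - 1) ≤ b * ((m : ℝ) - 1) :=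
    mul_le_mul_of_nonneg_right (Subtype.coe_le_coe.2 hab) hm1
  have hb1 : (b : ℝ) * ((m : ℝ) - 1) ≤ (m : ℝ) - 1 := by
    have := mul_le_mul_of_nonneg_right b.2.2 hm1
    linarith
  have ha0 : 0 ≤ (a : ℝ) * ((m : ℝ) - 1) := mul_nonneg a.2.1 hm1
  set u := (a : ℝ) * ((m : ℝ) - 1) with hu
  set v := (b : ℝ) * ((m : ℝ) - 1) with hv
  have hcast : ((m - 1 : ℕ) : ℝ) = (m : ℝ) - 1 := by rw [Nat.cast_sub hm]; simp
  -- a point with floor `p` lies on edge `p`, or it is the last vertex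
  have key : ∀ t : unitInterval, t * ((m : ℝ) - 1) < (m : ℝ) - 1 →
      (⌊(t : ℝ) * ((m : ℝ) - 1)⌋₊ + 1 < m) ∧ curve m X t = X ⌊(t : ℝ) * ((m : ℝ) - 1)⌋₊ +
        (t * ((m : ℝ) - 1) - ⌊(t : ℝ) * ((m : ℝ) - 1)⌋₊) *
        (X (⌊(t : ℝ) * ((m : ℝ) - 1)⌋₊ + 1) - X ⌊(t : ℝ) * ((m : ℝ) - 1)⌋₊) := by
    intro t ht
    have h0 : 0 ≤ (t : ℝ) * ((m : ℝ) - 1) := mul_nonneg t.2.1 hm1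
    have h1 : ⌊(t : ℝ) * ((m : ℝ) - 1)⌋₊ < m - 1 := by
      rw [Nat.floor_lt h0, hcast]; exact ht
    exact ⟨by omega, curve_eq_of_mem_edge X (by omega) (Nat.floor_le h0)
      (Nat.lt_floor_add_one _).le⟩
  rcases eq_or_lt_of_le hb1 with hb | hb
  · have eb : curve m X b = X (m - 1) :=
      curve_eq_of_eq_natCast X (by omega) (by rw [hcast, ← hv, hb])
    rw [eb]
    rcases eq_or_lt_of_le (hab'.trans hb1) with ha | ha
    · exact (curve_eq_of_eq_natCast X (by omega) (by rw [hcast, ← hu, ha])).le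
    · obtain ⟨h1, h2⟩ := key a ha
      rw [h2, ← hu]
      rw [← hu] at h1
      have h3 := hX (show ⌊u⌋₊ ≤ ⌊u⌋₊ + 1 by omega)
      have h4 := hX (show ⌊u⌋₊ + 1 ≤ m - 1 by omega)
      nlinarith [Nat.floor_le ha0, Nat.lt_floor_add_one u]
  · obtain ⟨h1, h2⟩ := key b hb
    obtain ⟨h3, h4⟩ := key a (lt_of_le_of_lt hab' hb)
    rw [h2, h4, ← hu, ← hv]
    rw [← hu] at h3
    rw [← hv] at h1
    have i1 := hX (show ⌊u⌋₊ ≤ ⌊u⌋₊ + 1 by omega)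
    have i2 := hX (show ⌊v⌋₊ ≤ ⌊v⌋₊ + 1 by omega)
    have hv0 : 0 ≤ v := ha0.trans hab'
    rcases eq_or_lt_of_le (Nat.floor_mono hab') with h | h
    · rw [h]
      gcongr
    · have i3 := hX (show ⌊u⌋₊ + 1 ≤ ⌊v⌋₊ by omega)
      have i4 : (u - ⌊u⌋₊) * (X (⌊u⌋₊ + 1) - X ⌊u⌋₊) ≤ 1 * (X (⌊u⌋₊ + 1) - X ⌊u⌋₊) := by
        gcongr
        linarith [Nat.lt_floor_add_one u]
      have i5 : 0 ≤ (v - ⌊v⌋₊) * (X (⌊v⌋₊ + 1) - X ⌊v⌋₊) :=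
        mul_nonneg (by linarith [Nat.floor_le hv0]) (by linarith)
      linarith

/-- One step of a chain of matched parameters: both curves are affine between the two pairs, and
the matched points have distance at most `ρ`. -/
structure ChainStep (π τ : C(unitInterval, ℝ)) (ρ : ℝ) (a b : unitInterval × unitInterval) :
    Prop where
  le_fst : a.1 ≤ b.1
  le_snd : a.2 ≤ b.2
  affine_fst : AffineOn π a.1 b.1
  affine_snd : AffineOn τ a.2 b.2
  close : |π b.1 - τ b.2| ≤ ρ

/-- The reparametrization that interpolates a monotone sequence of parameters. -/
theorem exists_reparam_interpolating {N : ℕ} {S : ℕ → unitInterval}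
    (hS : Monotone S) (h0 : S 0 = 0) (h1 : S N = 1) :
    ∃ f : Reparam, ∀ (α : unitInterval) (p : ℕ), p < N → (p : ℝ) ≤ (α : ℝ) * N →
      (α : ℝ) * N ≤ p + 1 →
      (f.1 α : ℝ) = S p + ((α : ℝ) * N - p) * ((S (p + 1) : ℝ) - S p) := by
  have hN : 0 < N := by
    rcases Nat.eq_zero_or_pos N with h | h
    · subst h; rw [h0] at h1; exact absurd h1 (by simp)
    · exact h
  have hmono : Monotone fun p => (S p : ℝ) := fun p q h => Subtype.coe_le_coe.2 (hS h)
  have hc := monotone_curve (m := N + 1) (by omega) hmono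
  have e0 : curve (N + 1) (fun p => (S p : ℝ)) 0 = 0 := by
    rw [curve_zero (by omega), h0]; simp
  have e1 : curve (N + 1) (fun p => (S p : ℝ)) 1 = 1 := by
    rw [curve_eq_of_eq_natCast (p := N) _ (by omega) (by simp), h1]; simp
  have hmem : ∀ t, curve (N + 1) (fun p => (S p : ℝ)) t ∈ unitInterval := fun t =>
    ⟨by rw [← e0]; exact hc (unitInterval.nonneg t), by
      rw [← e1]; exact hc (unitInterval.le_one t)⟩
  refine ⟨⟨⟨fun t => ⟨_, hmem t⟩, by fun_prop⟩, fun a b h => Subtype.coe_le_coe.1 (hc h),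
    Subtype.ext e0, Subtype.ext e1⟩, fun α p hp h2 h3 => ?_⟩
  have := curve_eq_of_mem_edge (m := N + 1) (fun p => (S p : ℝ)) (t := α) (p := p) (by omega)
    (by push_cast; simpa using h2) (by push_cast; simpa using h3)
  simpa using this

theorem frechetDist_le_of_chain {π τ : C(unitInterval, ℝ)} {ρ : ℝ}
    (h0 : |π 0 - τ 0| ≤ ρ)
    (h : Relation.ReflTransGen (ChainStep π τ ρ) (0, 0) (1, 1)) : frechetDist π τ ≤ ρ := by
  -- the chain as a sequence of pairs that is constant from index `N` on
  have seq : ∀ b, Relation.ReflTransGen (ChainStep π τ ρ) (0, 0) b →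
      ∃ (N : ℕ) (c : ℕ → unitInterval × unitInterval), c 0 = (0, 0) ∧ (∀ i, N ≤ i → c i = b) ∧
        ∀ i < N, ChainStep π τ ρ (c i) (c (i + 1)) := by
    intro b hb
    induction hb with
    | refl => exact ⟨0, fun _ => (0, 0), rfl, fun _ _ => rfl, fun i hi => absurd hi (by omega)⟩
    | @tail b b' _ hs ih =>
      obtain ⟨N, c, c0, cN, cs⟩ := ih
      refine ⟨N + 1, fun i => if i ≤ N then c i else b', by simp [c0], fun i hi => ?_,
        fun i hi => ?_⟩
      · simp [show ¬ i ≤ N by omega]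
      · rcases Nat.lt_or_ge i N with hiN | hiN
        · simpa [hiN.le, show i + 1 ≤ N by omega] using cs i hiN
        · have : i = N := by omega
          subst this
          simpa [cN i le_rfl] using hs
  obtain ⟨N, c, c0, cN, cs⟩ := seq _ h
  have hm1 : Monotone fun i => (c i).1 := monotone_nat_of_le_succ fun i => by
    rcases Nat.lt_or_ge i N with hi | hi
    · exact (cs i hi).le_fst
    · rw [cN i hi, cN (i + 1) (by omega)]
  have hm2 : Monotone fun i => (c i).2 := monotone_nat_of_le_succ fun i => by
    rcases Nat.lt_or_ge i N with hi | hi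
    · exact (cs i hi).le_snd
    · rw [cN i hi, cN (i + 1) (by omega)]
  obtain ⟨f, hf⟩ := exists_reparam_interpolating (N := N) hm1 (by simp [c0]) (by simp [cN N le_rfl])
  obtain ⟨g, hg⟩ := exists_reparam_interpolating (N := N) hm2 (by simp [c0]) (by simp [cN N le_rfl])
  have hN : 0 < N := by
    rcases Nat.eq_zero_or_pos N with h | h
    · subst h
      have := cN 0 le_rfl
      rw [c0] at this
      exact absurd (congrArg Prod.fst this) (by simp)
    · exact h
  have hclose : ∀ i ≤ N, |π (c i).1 - τ (c i).2| ≤ ρ := by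
    intro i hi
    rcases i with _ | i
    · rw [c0]; exact h0
    · exact (cs i (by omega)).close
  refine frechetDist_le_of_reparam f g fun α => ?_
  have hα0 : 0 ≤ (α : ℝ) * N := mul_nonneg α.2.1 (by positivity)
  have hα1 : (α : ℝ) * N ≤ N := by
    have := mul_le_mul_of_nonneg_right α.2.2 (show (0 : ℝ) ≤ N by positivity)
    linarith
  obtain ⟨p, hp, hp1, hp2⟩ : ∃ p : ℕ, p < N ∧ (p : ℝ) ≤ α * N ∧ (α : ℝ) * N ≤ p + 1 := by
    rcases eq_or_lt_of_le hα1 with h | h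
    · refine ⟨N - 1, by omega, ?_, ?_⟩
      all_goals rw [h, Nat.cast_sub hN]; push_cast; linarith
    · exact ⟨⌊(α : ℝ) * N⌋₊, (Nat.floor_lt hα0).2 h, Nat.floor_le hα0,
        (Nat.lt_floor_add_one _).le⟩
  have ef := hf α p hp hp1 hp2
  have eg := hg α p hp hp1 hp2
  set l := (α : ℝ) * N - p with hl
  have hl0 : 0 ≤ l := by linarith
  have hl1 : l ≤ 1 := by linarith
  have hs := cs p hp
  have i1 : ((c p).1 : ℝ) ≤ (c (p + 1)).1 := Subtype.coe_le_coe.2 hs.le_fst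
  have i2 : ((c p).2 : ℝ) ≤ (c (p + 1)).2 := Subtype.coe_le_coe.2 hs.le_snd
  have eπ : π (f.1 α) = (1 - l) * π (c p).1 + l * π (c (p + 1)).1 := by
    obtain ⟨a, b, hab⟩ := hs.affine_fst
    rw [hab _ le_rfl hs.le_fst, hab _ hs.le_fst le_rfl, hab (f.1 α), ef]
    · ring
    · rw [← Subtype.coe_le_coe, ef]; nlinarith
    · rw [← Subtype.coe_le_coe, ef]; nlinarith
  have eτ : τ (g.1 α) = (1 - l) * τ (c p).2 + l * τ (c (p + 1)).2 := by
    obtain ⟨a, b, hab⟩ := hs.affine_snd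
    rw [hab _ le_rfl hs.le_snd, hab _ hs.le_snd le_rfl, hab (g.1 α), eg]
    · ring
    · rw [← Subtype.coe_le_coe, eg]; nlinarith
    · rw [← Subtype.coe_le_coe, eg]; nlinarith
  have j1 := abs_le.1 (hclose p hp.le)
  have j2 := abs_le.1 (hclose (p + 1) hp)
  rw [eπ, eτ, abs_le]
  constructor <;> nlinarith

/-! ### The triangle inequality for the Fréchet distance -/

/-- Every reparametrization is uniformly close to one that has an inverse: perturb it towards the
identity. -/
theorem Reparam.exists_homeomorph_close (f : Reparam) {δ : ℝ} (h0 : 0 < δ) (h1 : δ ≤ 1) :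
    ∃ h : unitInterval ≃o unitInterval, ∀ α, dist (h α) (f.1 α) ≤ δ := by
  have hmem : ∀ α : unitInterval, (1 - δ) * (f.1 α : ℝ) + δ * α ∈ unitInterval := fun α => by
    have a1 := (f.1 α).2.1
    have a2 := (f.1 α).2.2
    have a3 := α.2.1
    have a4 := α.2.2
    constructor <;> nlinarith
  let g : unitInterval → unitInterval := fun α => ⟨_, hmem α⟩
  have hg : Continuous g := by fun_prop
  have hmono : StrictMono g := by
    intro a b hab
    have h2 : (f.1 a : ℝ) ≤ f.1 b := Subtype.coe_le_coe.2 (f.2.1 hab.le)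
    have h3 : (a : ℝ) < b := Subtype.coe_lt_coe.2 hab
    rw [← Subtype.coe_lt_coe]
    change (1 - δ) * (f.1 a : ℝ) + δ * a < (1 - δ) * (f.1 b : ℝ) + δ * b
    nlinarith
  have hg0 : g 0 = 0 := Subtype.ext (by simp [g, f.2.2.1])
  have hg1 : g 1 = 1 := Subtype.ext (by simp [g, f.2.2.2])
  have hsurj : Function.Surjective g := by
    intro y
    have := intermediate_value_Icc (show (0 : unitInterval) ≤ 1 from unitInterval.nonneg _)
      hg.continuousOn
    rw [hg0, hg1] at this
    obtain ⟨x, _, hx⟩ := this ⟨unitInterval.nonneg y, unitInterval.le_one y⟩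
    exact ⟨x, hx⟩
  refine ⟨hmono.orderIsoOfSurjective g hsurj, fun α => ?_⟩
  have e : ((hmono.orderIsoOfSurjective g hsurj) α : ℝ) = (1 - δ) * (f.1 α : ℝ) + δ * α := rfl
  rw [Subtype.dist_eq, e, Real.dist_eq, abs_le]
  have a1 := (f.1 α).2.1
  have a2 := (f.1 α).2.2
  have a3 := α.2.1
  have a4 := α.2.2
  constructor <;> nlinarith

/-- Align the two given pairs of reparametrizations along the middle curve `σ`, after making the
reparametrization of `σ` in the first pair invertible. -/
theorem frechetDist_triangle (π σ τ : C(unitInterval, ℝ)) :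
    frechetDist π τ ≤ frechetDist π σ + frechetDist σ τ := by
  refine le_of_forall_pos_le_add fun η hη => ?_
  obtain ⟨f₁, g₁, h₁⟩ := exists_reparam_of_frechetDist_lt
    (show frechetDist π σ < frechetDist π σ + η / 3 by linarith)
  obtain ⟨f₂, g₂, h₂⟩ := exists_reparam_of_frechetDist_lt
    (show frechetDist σ τ < frechetDist σ τ + η / 3 by linarith)
  have hu : UniformContinuous σ := CompactSpace.uniformContinuous_of_continuous σ.continuous
  obtain ⟨δ, hδ, hσ⟩ := Metric.uniformContinuous_iff.1 hu (η / 3) (by linarith)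
  obtain ⟨h, hh⟩ := g₁.exists_homeomorph_close (δ := min (δ / 2) 1)
    (lt_min (by linarith) one_pos) (min_le_right _ _)
  let i : C(unitInterval, unitInterval) := ⟨h.symm, h.symm.continuous⟩
  have hi : ∀ α, h (i α) = α := fun α => h.apply_symm_apply α
  let f : Reparam := ⟨f₁.1.comp (i.comp f₂.1),
    f₁.2.1.comp (h.symm.monotone.comp f₂.2.1), by
      have : i 0 = 0 := h.symm.map_bot
      simp [f₂.2.2.1, this, f₁.2.2.1], by
      have : i 1 = 1 := h.symm.map_top
      simp [f₂.2.2.2, this, f₁.2.2.2]⟩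
  refine frechetDist_le_of_reparam f g₂ fun α => ?_
  have e1 := h₁ (i (f₂.1 α))
  have e2 := h₂ α
  have e3 := hσ (lt_of_le_of_lt (hh (i (f₂.1 α))) (lt_of_le_of_lt (min_le_left _ _)
    (by linarith : δ / 2 < δ)))
  rw [hi, Real.dist_eq] at e3
  have e4 : f.1 α = f₁.1 (i (f₂.1 α)) := rfl
  rw [e4]
  have t1 := abs_sub_le (π (f₁.1 (i (f₂.1 α)))) (σ (g₁.1 (i (f₂.1 α)))) (τ (g₂.1 α))
  have t2 := abs_sub_le (σ (g₁.1 (i (f₂.1 α)))) (σ (f₂.1 α)) (τ (g₂.1 α))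
  rw [abs_sub_comm (σ (f₂.1 α))] at e3
  linarith

theorem frechetDist_comm (π τ : C(unitInterval, ℝ)) : frechetDist π τ = frechetDist τ π := by
  unfold frechetDist
  rw [← (Equiv.prodComm Reparam Reparam).iInf_comp]
  simp only [Equiv.prodComm_apply, Prod.fst_swap, Prod.snd_swap, abs_sub_comm]

/-- Two curves that are uniformly close have a small Fréchet distance. -/
theorem frechetDist_le_of_forall {π τ : C(unitInterval, ℝ)} {ρ : ℝ}
    (h : ∀ t, |π t - τ t| ≤ ρ) : frechetDist π τ ≤ ρ :=
  frechetDist_le_of_reparam ⟨ContinuousMap.id _, monotone_id, rfl, rfl⟩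
    ⟨ContinuousMap.id _, monotone_id, rfl, rfl⟩ fun α => h α

theorem frechetDist_smul {c : ℝ} (hc : 0 ≤ c) (π τ : C(unitInterval, ℝ)) :
    frechetDist (c • π) (c • τ) = c * frechetDist π τ := by
  unfold frechetDist
  rw [Real.mul_iInf_of_nonneg hc]
  congr 1
  ext φ
  rw [Real.mul_iSup_of_nonneg hc]
  congr 1
  ext α
  rw [ContinuousMap.smul_apply, ContinuousMap.smul_apply, ← smul_sub, smul_eq_mul, abs_mul,
    abs_of_nonneg hc]

theorem curve_smul (m : ℕ) (c : ℝ) (X : ℕ → ℝ) :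
    curve m (fun p => c * X p) = c • curve m X := by
  ext t
  rw [ContinuousMap.smul_apply, curve_eq_sum, curve_eq_sum, smul_eq_mul, Finset.mul_sum]
  exact Finset.sum_congr rfl fun i _ => by ring

theorem curve_congr {m : ℕ} {X Y : ℕ → ℝ} (h : ∀ p < m, X p = Y p) : curve m X = curve m Y := by
  ext t
  rw [curve_eq_sum, curve_eq_sum]
  exact Finset.sum_congr rfl fun i hi => by rw [h i (Finset.mem_range.1 hi)]

theorem curve_eq_convexComb {m : ℕ} (hm : 0 < m) (t : unitInterval) :
    ∃ (p q : ℕ) (l : ℝ), p < m ∧ q < m ∧ 0 ≤ l ∧ l ≤ 1 ∧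
      ∀ X : ℕ → ℝ, curve m X t = (1 - l) * X p + l * X q := by
  have hm1 : (0 : ℝ) ≤ (m : ℝ) - 1 := by
    have : (1 : ℝ) ≤ m := by exact_mod_cast hm
    linarith
  have hcast : ((m - 1 : ℕ) : ℝ) = (m : ℝ) - 1 := by rw [Nat.cast_sub hm]; simp
  have h0 : 0 ≤ (t : ℝ) * ((m : ℝ) - 1) := mul_nonneg t.2.1 hm1
  have h1 : (t : ℝ) * ((m : ℝ) - 1) ≤ (m : ℝ) - 1 := by
    have := mul_le_mul_of_nonneg_right t.2.2 hm1
    linarith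
  rcases eq_or_lt_of_le h1 with h | h
  · exact ⟨m - 1, m - 1, 0, by omega, by omega, le_rfl, zero_le_one, fun X => by
      rw [curve_eq_of_eq_natCast X (show m - 1 < m by omega) (by rw [hcast, h])]; ring⟩
  · have h2 : ⌊(t : ℝ) * ((m : ℝ) - 1)⌋₊ < m - 1 := by
      rw [Nat.floor_lt h0, hcast]; exact h
    refine ⟨⌊(t : ℝ) * ((m : ℝ) - 1)⌋₊, ⌊(t : ℝ) * ((m : ℝ) - 1)⌋₊ + 1,
      t * ((m : ℝ) - 1) - ⌊(t : ℝ) * ((m : ℝ) - 1)⌋₊, by omega, by omega,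
      by linarith [Nat.floor_le h0], by linarith [Nat.lt_floor_add_one ((t : ℝ) * ((m : ℝ) - 1))],
      fun X => ?_⟩
    rw [curve_eq_of_mem_edge X (by omega) (Nat.floor_le h0) (Nat.lt_floor_add_one _).le]
    ring

/-- Rounding the vertices of a curve by at most `δ` moves it by at most `δ`. -/
theorem frechetDist_curve_le {m : ℕ} (hm : 0 < m) {X Y : ℕ → ℝ} {δ : ℝ}
    (h : ∀ p < m, |X p - Y p| ≤ δ) : frechetDist (curve m X) (curve m Y) ≤ δ := by
  refine frechetDist_le_of_forall fun t => ?_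
  obtain ⟨p, q, l, hp, hq, l0, l1, e⟩ := curve_eq_convexComb hm t
  have a := abs_le.1 (h p hp)
  have b := abs_le.1 (h q hq)
  rw [e X, e Y, abs_le]
  constructor <;> nlinarith

/-! ### A combinatorial certificate for a small Fréchet distance -/

/-- The vertices `X p` with `a < p ≤ b` can be matched, in their order and within distance `ρ`, to
points of a segment from `v` to `w`: they stay within `ρ` of the range of the segment, and they
never move against its direction by more than `2ρ`. -/
def SegCond (ρ v w : ℝ) (X : ℕ → ℝ) (a b : ℕ) : Prop :=
  (v ≤ w ∧ (∀ p, a < p → p ≤ b → v - ρ ≤ X p ∧ X p ≤ w + ρ) ∧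
    ∀ p p', a < p → p < p' → p' ≤ b → X p - X p' ≤ 2 * ρ) ∨
  (w ≤ v ∧ (∀ p, a < p → p ≤ b → w - ρ ≤ X p ∧ X p ≤ v + ρ) ∧
    ∀ p p', a < p → p < p' → p' ≤ b → X p' - X p ≤ 2 * ρ)

/-- On an edge that moves from `x` to `y`, the height `h'` is the first one that is not before the
height `h` and within `ρ` of `w`. -/
def EdgeCond (ρ x y h w h' : ℝ) : Prop :=
  (x ≤ y ∧ h ≤ w + ρ ∧ w - ρ ≤ y ∧ h' = max h (w - ρ)) ∨
  (y < x ∧ w - ρ ≤ h ∧ y ≤ w + ρ ∧ h' = min h (w + ρ))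

/-- A partial matching of the curve with vertices `X` and the curve whose vertices are the values
under `c` of a list (in reverse order: the last vertex is the head). In `VReach c X ρ N l f h` the
last vertex is matched to the point of height `h` on the edge from `X f` to `X (f + 1)`. The
predicate `N` restricts the pairs of a vertex and the edge that it is matched to. -/
inductive VReach {α : Type*} (c : α → ℝ) (X : ℕ → ℝ) (ρ : ℝ) (N : ℕ → α → Prop) :
    List α → ℕ → ℝ → Prop
  | init {a : α} : |X 0 - c a| ≤ ρ → N 0 a → VReach c X ρ N [a] 0 (X 0)
  | next {a b : α} {l : List α} {f₀ f : ℕ} {h h' : ℝ} : VReach c X ρ N (a :: l) f₀ h →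
      f₀ ≤ f → SegCond ρ (c a) (c b) X f₀ f →
      EdgeCond ρ (X f) (X (f + 1)) (if f = f₀ then h else X f) (c b) h' → N f b →
      VReach c X ρ N (b :: a :: l) f h'

/-- The height `h` lies between `x` and `y`. -/
def Between (x h y : ℝ) : Prop := (x ≤ h ∧ h ≤ y) ∨ (y ≤ h ∧ h ≤ x)

theorem EdgeCond.between {ρ x y h w h' : ℝ} (H : EdgeCond ρ x y h w h')
    (hb : Between x h y) : Between x h' y ∧ Between h h' y ∧ (0 ≤ ρ → |h' - w| ≤ ρ) := by
  rcases H with ⟨h1, h2, h3, rfl⟩ | ⟨h1, h2, h3, rfl⟩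
  · have hx : x ≤ h ∧ h ≤ y := by
      rcases hb with hb | hb
      · exact hb
      · constructor <;> linarith
    refine ⟨Or.inl ⟨le_max_of_le_left hx.1, max_le hx.2 h3⟩,
      Or.inl ⟨le_max_left _ _, max_le hx.2 h3⟩, fun hρ => abs_le.2 ⟨?_, ?_⟩⟩
    · linarith [le_max_right h (w - ρ)]
    · have : max h (w - ρ) ≤ w + ρ := max_le h2 (by linarith)
      linarith
  · have hx : y ≤ h ∧ h ≤ x := by
      rcases hb with hb | hb
      · constructor <;> linarith
      · exact hb
    refine ⟨Or.inr ⟨le_min hx.1 h3, min_le_of_left_le hx.2⟩,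
      Or.inr ⟨le_min hx.1 h3, min_le_left _ _⟩, fun hρ => abs_le.2 ⟨?_, ?_⟩⟩
    · have : w - ρ ≤ min h (w + ρ) := le_min h2 (by linarith)
      linarith
    · linarith [min_le_right h (w + ρ)]

/-- The parameters `t 0 ≤ t 1 ≤ …` cut the curve `τ` into affine pieces. -/
structure IsNodes (τ : C(unitInterval, ℝ)) (t : ℕ → unitInterval) : Prop where
  mono : Monotone t
  affine_zero : AffineOn τ 0 (t 0)
  affine : ∀ j, AffineOn τ (t j) (t (j + 1))

theorem isNodes_node {m : ℕ} (hm : 0 < m) (X : ℕ → ℝ) : IsNodes (curve m X) (node m) :=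
  ⟨node_mono m, affineOn_zero_node hm X, affineOn_edge hm X⟩

/-- Matching the vertices between two edges greedily: each is matched to the first point of the
segment that is not before the previous one and is close enough. -/
theorem SegCond.exists_chain {π τ : C(unitInterval, ℝ)} {ρ : ℝ} {X : ℕ → ℝ} {u : ℕ → unitInterval}
    {a b : ℕ} {s₀ t₀ t₁ : unitInterval} {start : unitInterval × unitInterval}
    (hu : IsNodes π u) (hX : ∀ p ≤ b, π (u p) = X p) (ht : t₀ ≤ t₁) (hτ : AffineOn τ t₀ t₁)
    (hs : u a ≤ s₀ ∧ s₀ ≤ u (a + 1))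
    (hchain : Relation.ReflTransGen (ChainStep π τ ρ) start (s₀, t₀))
    (hρ : 0 ≤ ρ) (H : SegCond ρ (τ t₀) (τ t₁) X a b) :
    ∀ p, a < p → p ≤ b → ∃ t, t₀ ≤ t ∧ t ≤ t₁ ∧
      Relation.ReflTransGen (ChainStep π τ ρ) start (u p, t) := by
  rcases H with ⟨hvw, hband, hdrop⟩ | ⟨hvw, hband, hdrop⟩
  · suffices ∀ d, a + 1 + d ≤ b → ∃ t, t₀ ≤ t ∧ t ≤ t₁ ∧
        Relation.ReflTransGen (ChainStep π τ ρ) start (u (a + 1 + d), t) ∧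
        (τ t = τ t₀ ∨ ∃ p, a < p ∧ p ≤ a + 1 + d ∧ τ t = X p - ρ) ∧ τ t₀ ≤ τ t ∧ τ t ≤ τ t₁ by
      intro p hp hpb
      obtain ⟨t, h1, h2, h3, _⟩ := this (p - (a + 1)) (by omega)
      exact ⟨t, h1, h2, by rwa [show a + 1 + (p - (a + 1)) = p by omega] at h3⟩
    -- moving on from a matched pair to the vertex `p`
    have step : ∀ (s t : unitInterval) (p : ℕ), a < p → p ≤ b → s ≤ u p → AffineOn π s (u p) →
        t₀ ≤ t → t ≤ t₁ → Relation.ReflTransGen (ChainStep π τ ρ) start (s, t) →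
        (τ t = τ t₀ ∨ ∃ p', a < p' ∧ p' < p ∧ τ t = X p' - ρ) → τ t₀ ≤ τ t → τ t ≤ τ t₁ →
        ∃ t, t₀ ≤ t ∧ t ≤ t₁ ∧ Relation.ReflTransGen (ChainStep π τ ρ) start (u p, t) ∧
          (τ t = τ t₀ ∨ ∃ p', a < p' ∧ p' ≤ p ∧ τ t = X p' - ρ) ∧ τ t₀ ≤ τ t ∧ τ t ≤ τ t₁ := by
      intro s t p hap hpb hsp haff ht0 ht1 hc hg hg0 hg1
      obtain ⟨b1, b2⟩ := hband p hap hpb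
      have hle : τ t ≤ X p + ρ := by
        rcases hg with hg | ⟨p', h1, h2, hg⟩
        · linarith
        · have := hdrop p' p h1 h2 hpb
          linarith
      obtain ⟨t', i1, i2, i3⟩ := exists_param_eq τ ht1 (z := max (τ t) (X p - ρ))
        (Or.inl ⟨le_max_left _ _, max_le hg1 (by linarith)⟩)
      refine ⟨t', ht0.trans i1, i2, hc.tail ⟨hsp, i1, haff, hτ.mono ht0 i2, ?_⟩, ?_, ?_, ?_⟩
      · simp only
        rw [i3, hX p hpb, abs_le]
        constructor
        · have : max (τ t) (X p - ρ) ≤ X p + ρ := max_le hle (by linarith)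
          linarith
        · linarith [le_max_right (τ t) (X p - ρ)]
      · rw [i3]
        rcases max_choice (τ t) (X p - ρ) with e | e <;> rw [e]
        · rcases hg with hg | ⟨p', h1, h2, hg⟩
          · exact Or.inl hg
          · exact Or.inr ⟨p', h1, h2.le, hg⟩
        · exact Or.inr ⟨p, hap, le_rfl, rfl⟩
      · rw [i3]; exact le_max_of_le_left hg0
      · rw [i3]; exact max_le hg1 (by linarith)
    intro d
    induction d with
    | zero =>
      intro hd
      obtain ⟨t, h⟩ := step s₀ t₀ (a + 1) (by omega) (by omega) hs.2
        ((hu.affine a).mono hs.1 le_rfl) le_rfl ht hchain (Or.inl rfl) le_rfl hvw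
      exact ⟨t, h⟩
    | succ d ih =>
      intro hd
      obtain ⟨t, h1, h2, h3, h4, h5, h6⟩ := ih (by omega)
      refine step _ t (a + 1 + (d + 1)) (by omega) hd (hu.mono (Nat.le_succ _)) (hu.affine _)
        h1 h2 h3
        ?_ h5 h6
      rcases h4 with h4 | ⟨p', i1, i2, i3⟩
      · exact Or.inl h4
      · exact Or.inr ⟨p', i1, by omega, i3⟩
  · suffices ∀ d, a + 1 + d ≤ b → ∃ t, t₀ ≤ t ∧ t ≤ t₁ ∧
        Relation.ReflTransGen (ChainStep π τ ρ) start (u (a + 1 + d), t) ∧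
        (τ t = τ t₀ ∨ ∃ p, a < p ∧ p ≤ a + 1 + d ∧ τ t = X p + ρ) ∧ τ t ≤ τ t₀ ∧ τ t₁ ≤ τ t by
      intro p hp hpb
      obtain ⟨t, h1, h2, h3, _⟩ := this (p - (a + 1)) (by omega)
      exact ⟨t, h1, h2, by rwa [show a + 1 + (p - (a + 1)) = p by omega] at h3⟩
    have step : ∀ (s t : unitInterval) (p : ℕ), a < p → p ≤ b → s ≤ u p → AffineOn π s (u p) →
        t₀ ≤ t → t ≤ t₁ → Relation.ReflTransGen (ChainStep π τ ρ) start (s, t) →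
        (τ t = τ t₀ ∨ ∃ p', a < p' ∧ p' < p ∧ τ t = X p' + ρ) → τ t ≤ τ t₀ → τ t₁ ≤ τ t →
        ∃ t, t₀ ≤ t ∧ t ≤ t₁ ∧ Relation.ReflTransGen (ChainStep π τ ρ) start (u p, t) ∧
          (τ t = τ t₀ ∨ ∃ p', a < p' ∧ p' ≤ p ∧ τ t = X p' + ρ) ∧ τ t ≤ τ t₀ ∧ τ t₁ ≤ τ t := by
      intro s t p hap hpb hsp haff ht0 ht1 hc hg hg0 hg1
      obtain ⟨b1, b2⟩ := hband p hap hpb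
      have hle : X p - ρ ≤ τ t := by
        rcases hg with hg | ⟨p', h1, h2, hg⟩
        · linarith
        · have := hdrop p' p h1 h2 hpb
          linarith
      obtain ⟨t', i1, i2, i3⟩ := exists_param_eq τ ht1 (z := min (τ t) (X p + ρ))
        (Or.inr ⟨le_min hg1 (by linarith), min_le_left _ _⟩)
      refine ⟨t', ht0.trans i1, i2, hc.tail ⟨hsp, i1, haff, hτ.mono ht0 i2, ?_⟩, ?_, ?_, ?_⟩
      · simp only
        rw [i3, hX p hpb, abs_le]
        constructor
        · linarith [min_le_right (τ t) (X p + ρ)]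
        · have : X p - ρ ≤ min (τ t) (X p + ρ) := le_min hle (by linarith)
          linarith
      · rw [i3]
        rcases min_choice (τ t) (X p + ρ) with e | e <;> rw [e]
        · rcases hg with hg | ⟨p', h1, h2, hg⟩
          · exact Or.inl hg
          · exact Or.inr ⟨p', h1, h2.le, hg⟩
        · exact Or.inr ⟨p, hap, le_rfl, rfl⟩
      · rw [i3]; exact min_le_of_left_le hg0
      · rw [i3]; exact le_min hg1 (by linarith)
    intro d
    induction d with
    | zero =>
      intro hd
      obtain ⟨t, h⟩ := step s₀ t₀ (a + 1) (by omega) (by omega) hs.2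
        ((hu.affine a).mono hs.1 le_rfl) le_rfl ht hchain (Or.inl rfl) le_rfl hvw
      exact ⟨t, h⟩
    | succ d ih =>
      intro hd
      obtain ⟨t, h1, h2, h3, h4, h5, h6⟩ := ih (by omega)
      refine step _ t (a + 1 + (d + 1)) (by omega) hd (hu.mono (Nat.le_succ _)) (hu.affine _)
        h1 h2 h3
        ?_ h5 h6
      rcases h4 with h4 | ⟨p', i1, i2, i3⟩
      · exact Or.inl h4
      · exact Or.inr ⟨p', i1, by omega, i3⟩

theorem VReach.exists_chain {α : Type*} {c : α → ℝ} {X : ℕ → ℝ} {ρ : ℝ} {N : ℕ → α → Prop}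
    {m : ℕ} (hm : 0 < m) (hX : X m = X (m - 1)) (hρ : 0 ≤ ρ) (hN : ∀ f a, N f a → f < m)
    {l : List α} {f : ℕ} {h : ℝ} (H : VReach c X ρ N l f h) (τ : C(unitInterval, ℝ))
    (t : ℕ → unitInterval) (ht : IsNodes τ t)
    (hl : ∀ j a, l.reverse[j]? = some a → τ (t j) = c a) :
    f < m ∧ Between (X f) h (X (f + 1)) ∧ ∃ s, node m f ≤ s ∧ s ≤ node m (f + 1) ∧
      curve m X s = h ∧
      Relation.ReflTransGen (ChainStep (curve m X) τ ρ) (0, 0) (s, t (l.length - 1)) := by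
  have hu := isNodes_node hm X
  induction H with
  | @init a h1 h2 =>
    have hlt := hN _ _ h2
    refine ⟨hlt, ?_, node m 0, le_rfl, node_mono m (by omega), curve_node X hlt,
      Relation.ReflTransGen.single ⟨unitInterval.nonneg _, unitInterval.nonneg _, hu.affine_zero,
        ht.affine_zero, ?_⟩⟩
    · rcases le_total (X 0) (X 1) with h | h
      · exact Or.inl ⟨le_rfl, h⟩
      · exact Or.inr ⟨h, le_rfl⟩
    · have := hl 0 a (by simp)
      simp only [List.length_singleton, Nat.sub_self]
      rw [this, curve_node X hlt]
      exact h1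
  | @next a b l f₀ f h h' _ hff hseg hedge hNf ih =>
    have hfm := hN _ _ hNf
    obtain ⟨hf₀, hb₀, s₀, hs1, hs2, hs3, hs4⟩ := ih (fun j x hj => hl j x (by
      rw [List.reverse_cons, List.getElem?_append_left (List.getElem?_eq_some_iff.1 hj).1, hj]))
    have e0 : τ (t l.length) = c a := hl _ _ (by simp)
    have e1 : τ (t (l.length + 1)) = c b := hl _ _ (by simp)
    simp only [List.length_cons, Nat.add_sub_cancel] at hs4 ⊢
    have htt := ht.mono (show l.length ≤ l.length + 1 by omega)
    have hnn := node_mono m (show f ≤ f + 1 by omega)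
    have hXf : curve m X (node m (f + 1)) = X (f + 1) := curve_node_of_clip hm hX (by omega)
    -- it suffices to reach the edge `f` at the current height
    have last : ∀ (s t' : unitInterval) (y : ℝ), node m f ≤ s → s ≤ node m (f + 1) →
        curve m X s = y → Between (X f) y (X (f + 1)) →
        EdgeCond ρ (X f) (X (f + 1)) y (c b) h' → t l.length ≤ t' → t' ≤ t (l.length + 1) →
        Relation.ReflTransGen (ChainStep (curve m X) τ ρ) (0, 0) (s, t') →
        f < m ∧ Between (X f) h' (X (f + 1)) ∧ ∃ s, node m f ≤ s ∧ s ≤ node m (f + 1) ∧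
          curve m X s = h' ∧
          Relation.ReflTransGen (ChainStep (curve m X) τ ρ) (0, 0) (s, t (l.length + 1)) := by
      intro s t' y i1 i2 i3 i4 i5 i6 i7 i8
      obtain ⟨j1, j2, j3⟩ := i5.between i4
      obtain ⟨s', k1, k2, k3⟩ := exists_param_eq (curve m X) i2 (z := h') (by
        rw [i3, hXf]; exact j2)
      refine ⟨hfm, j1, s', i1.trans k1, k2, k3, i8.tail ⟨k1, i7, (hu.affine f).mono i1 k2,
        (ht.affine _).mono i6 le_rfl, ?_⟩⟩
      simp only
      rw [k3, e1]
      exact j3 hρ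
    rcases eq_or_lt_of_le hff with hf | hf
    · subst hf
      rw [if_pos rfl] at hedge
      exact last s₀ _ h hs1 hs2 hs3 hb₀ hedge le_rfl htt hs4
    · rw [if_neg (by omega)] at hedge
      obtain ⟨t', i1, i2, i3⟩ := SegCond.exists_chain (b := f) hu
        (fun p hp => curve_node X (by omega)) htt (ht.affine _) ⟨hs1, hs2⟩ hs4
        hρ (by rw [e0, e1]; exact hseg) f hf le_rfl
      refine last _ t' _ le_rfl hnn (curve_node X hfm) ?_ hedge i1 i2 i3
      rcases le_total (X f) (X (f + 1)) with h | h
      · exact Or.inl ⟨le_rfl, h⟩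
      · exact Or.inr ⟨h, le_rfl⟩

/-- The first vertices of the two curves are close. -/
theorem VReach.exists_first {α : Type*} {c : α → ℝ} {X : ℕ → ℝ} {ρ : ℝ} {N : ℕ → α → Prop}
    {l : List α} {f : ℕ} {h : ℝ} (H : VReach c X ρ N l f h) :
    ∃ a, l.reverse[0]? = some a ∧ |X 0 - c a| ≤ ρ := by
  induction H with
  | @init a h1 _ => exact ⟨a, by simp, h1⟩
  | next _ _ _ _ _ ih =>
    obtain ⟨x, hx, h⟩ := ih
    exact ⟨x, by
      rw [List.reverse_cons, List.getElem?_append_left (List.getElem?_eq_some_iff.1 hx).1, hx], h⟩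

/-- A complete matching bounds the Fréchet distance: the vertices of the first curve behind the
last matched point have to be close to the last vertex of the second curve. -/
theorem VReach.frechetDist_le {α : Type*} {c : α → ℝ} {X : ℕ → ℝ} {ρ : ℝ} {N : ℕ → α → Prop}
    {m : ℕ} (hm : 0 < m) (hX : X m = X (m - 1)) (hρ : 0 ≤ ρ) (hN : ∀ f a, N f a → f < m)
    {a : α} {l : List α} {f : ℕ} {h : ℝ} (H : VReach c X ρ N (a :: l) f h)
    (hlast : ∀ p, f < p → p < m → |X p - c a| ≤ ρ) {Y : ℕ → ℝ}
    (hY : ∀ j b, (a :: l).reverse[j]? = some b → Y j = c b) :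
    frechetDist (curve m X) (curve (a :: l).length Y) ≤ ρ := by
  set k := (a :: l).length with hk
  have hk0 : 0 < k := by simp [hk]
  have hu := isNodes_node hm X
  have ht := isNodes_node hk0 Y
  have hl : ∀ j b, (a :: l).reverse[j]? = some b → curve k Y (node k j) = c b :=
    fun j b hj => by
      have hjk := (List.getElem?_eq_some_iff.1 hj).1
      rw [List.length_reverse] at hjk
      rw [curve_node Y hjk, hY j b hj]
  obtain ⟨hf, _, s, h1, h2, -, h4⟩ := H.exists_chain hm hX hρ hN _ _ ht hl
  rw [← hk, node_of_le le_rfl] at h4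
  have e1 : curve k Y 1 = c a := by
    rw [← node_of_le (le_refl (k - 1))]
    exact hl _ _ (by simp [hk])
  have e0 : |curve m X 0 - curve k Y 0| ≤ ρ := by
    obtain ⟨x, hx, h⟩ := H.exists_first
    rw [curve_zero hm, curve_zero hk0, hY 0 x hx]
    exact h
  have haff : AffineOn (curve k Y) 1 1 :=
    (ht.affine (k - 1)).mono (by rw [node_of_le le_rfl]) (by rw [node_of_le (by omega)])
  refine frechetDist_le_of_chain e0 ?_
  have reach : ∀ d, f + 1 + d < m →
      Relation.ReflTransGen (ChainStep (curve m X) (curve k Y) ρ) (0, 0)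
        (node m (f + 1 + d), 1) := by
    intro d
    induction d with
    | zero =>
      intro hd
      refine h4.tail ⟨h2, le_rfl, (hu.affine f).mono h1 le_rfl, haff, ?_⟩
      simp only
      rw [e1, curve_node X (by omega)]
      exact hlast _ (by omega) (by omega)
    | succ d ih =>
      intro hd
      refine (ih (by omega)).tail ⟨node_mono m (by omega), le_rfl, hu.affine _, haff, ?_⟩
      simp only
      rw [e1, curve_node X (by omega)]
      exact hlast _ (by omega) (by omega)
  rcases Nat.lt_or_ge (f + 1) m with h | h
  · have := reach (m - 1 - (f + 1)) (by omega)
    rwa [node_of_le (by omega)] at this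
  · rw [node_of_le (by omega)] at h1
    have hs : s = 1 := le_antisymm (unitInterval.le_one s) h1
    rwa [hs] at h4

/-! ### Discrete alignments of two close curves -/

/-- An alignment of the vertices `Q j` with the edges of `X`: the vertex `Q j` is matched to a
point of the edge from `X (e j)` to `X (e j + 1)`. -/
structure Align (X Q : ℕ → ℝ) (m k : ℕ) (ρ : ℝ) (e : ℕ → ℕ) : Prop where
  zero : e 0 = 0
  first : |X 0 - Q 0| ≤ ρ
  mono : Monotone e
  le : ∀ j, e j ≤ m - 1
  on_edge : ∀ j < k, min (X (e j)) (X (e j + 1)) - ρ ≤ Q j ∧ Q j ≤ max (X (e j)) (X (e j + 1)) + ρ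
  same_up : ∀ j j', j ≤ j' → j' < k → e j = e j' → X (e j) ≤ X (e j + 1) → Q j - Q j' ≤ 2 * ρ
  same_down : ∀ j j', j ≤ j' → j' < k → e j = e j' → X (e j + 1) ≤ X (e j) → Q j' - Q j ≤ 2 * ρ
  seg : ∀ j, j + 1 < k → SegCond ρ (Q j) (Q (j + 1)) X (e j) (e (j + 1))
  last : ∀ p, e (k - 1) < p → p < m → |X p - Q (k - 1)| ≤ ρ

theorem Reparam.exists_monotone_rightInverse (f : Reparam) :
    ∃ A : unitInterval → unitInterval, Monotone A ∧ ∀ y, f.1 (A y) = y := by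
  have hsurj : Function.Surjective f.1 := by
    intro y
    have := intermediate_value_Icc (show (0 : unitInterval) ≤ 1 from unitInterval.nonneg _)
      f.1.continuous.continuousOn
    rw [f.2.2.1, f.2.2.2] at this
    obtain ⟨x, _, hx⟩ := this ⟨unitInterval.nonneg y, unitInterval.le_one y⟩
    exact ⟨x, hx⟩
  choose A hA using hsurj
  refine ⟨A, fun y z hyz => ?_, hA⟩
  by_contra h
  have h1 := f.2.1 (not_le.1 h).le
  rw [hA, hA] at h1
  rw [le_antisymm hyz h1] at h
  exact h le_rfl

theorem curve_eq_on_edge {m p : ℕ} (hpm : p < m) {X : ℕ → ℝ} {s : unitInterval}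
    (h1 : p = 0 ∨ node m p ≤ s) (h2 : s ≤ node m (p + 1)) :
    0 ≤ (s : ℝ) * ((m : ℝ) - 1) - p ∧ (s : ℝ) * ((m : ℝ) - 1) - p ≤ 1 ∧
      curve m X s = X p + (s * ((m : ℝ) - 1) - p) * (X (p + 1) - X p) := by
  have hm1 : (0 : ℝ) ≤ (m : ℝ) - 1 := by
    have : (1 : ℝ) ≤ m := by exact_mod_cast (show 1 ≤ m by omega)
    linarith
  have e1 : (p : ℝ) ≤ s * ((m : ℝ) - 1) := by
    rcases h1 with h1 | h1
    · subst h1; simpa using mul_nonneg s.2.1 hm1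
    · have := mul_le_mul_of_nonneg_right (Subtype.coe_le_coe.2 h1) hm1
      rwa [node_mul hpm] at this
  rcases Nat.lt_or_ge (p + 1) m with hp | hp
  · have e2 := mul_le_mul_of_nonneg_right (Subtype.coe_le_coe.2 h2) hm1
    rw [node_mul hp] at e2
    push_cast at e2
    exact ⟨by linarith, by linarith, curve_eq_of_mem_edge X hp e1 e2⟩
  · have hm : m = p + 1 := by omega
    have e2 : (s : ℝ) * ((m : ℝ) - 1) ≤ p := by
      have := mul_le_mul_of_nonneg_right s.2.2 hm1
      rw [hm] at this ⊢; push_cast at this ⊢; linarith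
    have e3 : (s : ℝ) * ((m : ℝ) - 1) = p := le_antisymm e2 e1
    rw [e3, curve_eq_of_eq_natCast X hpm e3]
    norm_num

/-- Two curves at distance less than `ρ` have an alignment: `e j` is the edge on which the first
curve is at a time at which the second one passes its vertex `Q j`. -/
theorem exists_align {X Q : ℕ → ℝ} {m k : ℕ} {ρ : ℝ} (hm : 0 < m) (hk : 0 < k)
    (h : frechetDist (curve m X) (curve k Q) < ρ) : ∃ e, Align X Q m k ρ e := by
  obtain ⟨f, g, hfg⟩ := exists_reparam_of_frechetDist_lt h
  obtain ⟨B, hB, hfB⟩ := f.exists_monotone_rightInverse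
  obtain ⟨A, hA, hgA⟩ := g.exists_monotone_rightInverse
  -- `β p` is a time at which the first curve is in its vertex `p`
  set β : ℕ → unitInterval := fun p => B (node m p) with hβ
  set α : ℕ → unitInterval := fun j => if j = 0 then 0 else A (node k j) with hα
  have hαm : Monotone α := by
    intro i j hij
    simp only [hα]
    split_ifs with h1 h2 h2
    · exact le_rfl
    · exact unitInterval.nonneg _
    · omega
    · exact hA (node_mono k hij)
  have hβm : Monotone β := hB.comp (node_mono m)
  have hgα : ∀ j < k, curve k Q (g.1 (α j)) = Q j := by
    intro j hj
    by_cases h0 : j = 0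
    · subst h0
      simp only [hα, if_true, g.2.2.1]
      exact curve_zero hk Q
    · simp only [hα, if_neg h0, hgA]
      exact curve_node Q hj
  have hfβ : ∀ p < m, curve m X (f.1 (β p)) = X p := by
    intro p hp
    simp only [hβ, hfB]
    exact curve_node X hp
  classical
  set e : ℕ → ℕ := fun j => Nat.findGreatest (fun p => p = 0 ∨ β p ≤ α j) (m - 1) with he
  have hele : ∀ j, e j ≤ m - 1 := fun j => Nat.findGreatest_le _
  have hespec : ∀ j p, 0 < p → p ≤ e j → β p ≤ α j := by
    intro j p hp hpe
    have : e j = 0 ∨ β (e j) ≤ α j :=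
      Nat.findGreatest_spec (P := fun p => p = 0 ∨ β p ≤ α j) (Nat.zero_le _) (Or.inl rfl)
    rcases this with h | h
    · omega
    · exact (hβm hpe).trans h
  have hegt : ∀ j p, e j < p → p < m → α j < β p := by
    intro j p hp hpm
    have := Nat.findGreatest_is_greatest (P := fun p => p = 0 ∨ β p ≤ α j) hp (by omega)
    push Not at this
    exact this.2
  have hmono : Monotone e := by
    intro i j hij
    by_cases h0 : e i = 0
    · omega
    · exact Nat.le_findGreatest (hele i)
        (Or.inr ((hespec i (e i) (by omega) le_rfl).trans (hαm hij)))
  -- the position of the first curve at time `α j`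
  have hpos : ∀ j, (e j = 0 ∨ node m (e j) ≤ f.1 (α j)) ∧ f.1 (α j) ≤ node m (e j + 1) := by
    intro j
    constructor
    · by_cases h0 : e j = 0
      · exact Or.inl h0
      · right
        have := f.2.1 (hespec j (e j) (by omega) le_rfl)
        rwa [hfB] at this
    · rcases Nat.lt_or_ge (e j + 1) m with h | h
      · have := f.2.1 (hegt j (e j + 1) (by omega) h).le
        rwa [hfB] at this
      · rw [node_of_le (by omega)]; exact unitInterval.le_one _
  have hclose : ∀ j < k, |curve m X (f.1 (α j)) - Q j| ≤ ρ := by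
    intro j hj
    have := hfg (α j)
    rwa [hgα j hj] at this
  have hem : ∀ j, e j < m := fun j => by have := hele j; omega
  refine ⟨e, ⟨?_, ?_, hmono, hele, ?_, ?_, ?_, ?_, ?_⟩⟩
  · by_contra h0
    have h1 := hespec 0 (e 0) (by omega) le_rfl
    have h2 : f.1 (β (e 0)) ≤ 0 := by
      have := f.2.1 h1
      simp only [hα, if_true, f.2.2.1] at this
      exact this
    simp only [hβ, hfB] at h2
    have h3 := node_mul (hem 0)
    rw [le_antisymm h2 (unitInterval.nonneg _)] at h3
    simp at h3
    exact h0 (by exact_mod_cast h3.symm)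
  · have := hclose 0 hk
    simp only [hα, if_true, f.2.2.1] at this
    rwa [curve_zero hm] at this
  · intro j hj
    obtain ⟨l0, l1, hl⟩ := curve_eq_on_edge (X := X) (hem j) (hpos j).1 (hpos j).2
    have := abs_le.1 (hclose j hj)
    rw [hl] at this
    set x := X (e j)
    set y := X (e j + 1)
    set l := (f.1 (α j) : ℝ) * ((m : ℝ) - 1) - (e j : ℝ)
    rcases le_total x y with hxy | hxy
    · rw [min_eq_left hxy, max_eq_right hxy]
      constructor <;> nlinarith
    · rw [min_eq_right hxy, max_eq_left hxy]
      constructor <;> nlinarith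
  · intro j j' hjj hj' hee hxy
    obtain ⟨l0, l1, hl⟩ := curve_eq_on_edge (X := X) (hem j) (hpos j).1 (hpos j).2
    obtain ⟨l0', l1', hl'⟩ := curve_eq_on_edge (X := X) (hem j') (hpos j').1 (hpos j').2
    have c1 := abs_le.1 (hclose j (by omega))
    have c2 := abs_le.1 (hclose j' hj')
    rw [hl] at c1
    rw [hl', ← hee] at c2
    have hm1 : (0 : ℝ) ≤ (m : ℝ) - 1 := by
      have : (1 : ℝ) ≤ m := by exact_mod_cast hm
      linarith
    have := mul_le_mul_of_nonneg_right (Subtype.coe_le_coe.2 (f.2.1 (hαm hjj))) hm1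
    have := mul_le_mul_of_nonneg_right this (sub_nonneg.2 hxy)
    nlinarith
  · intro j j' hjj hj' hee hxy
    obtain ⟨l0, l1, hl⟩ := curve_eq_on_edge (X := X) (hem j) (hpos j).1 (hpos j).2
    obtain ⟨l0', l1', hl'⟩ := curve_eq_on_edge (X := X) (hem j') (hpos j').1 (hpos j').2
    have c1 := abs_le.1 (hclose j (by omega))
    have c2 := abs_le.1 (hclose j' hj')
    rw [hl] at c1
    rw [hl', ← hee] at c2
    have hm1 : (0 : ℝ) ≤ (m : ℝ) - 1 := by
      have : (1 : ℝ) ≤ m := by exact_mod_cast hm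
      linarith
    have := mul_le_mul_of_nonneg_right (Subtype.coe_le_coe.2 (f.2.1 (hαm hjj))) hm1
    have := mul_le_mul_of_nonneg_right this (sub_nonneg.2 hxy)
    nlinarith
  · intro j hj
    have hk1 : (0 : ℝ) ≤ (k : ℝ) - 1 := by
      have : (1 : ℝ) ≤ k := by exact_mod_cast hk
      linarith
    have hgα' : ∀ i < k, (g.1 (α i) : ℝ) * ((k : ℝ) - 1) = i := by
      intro i hi
      by_cases h0 : i = 0
      · subst h0; simp [hα, g.2.2.1]
      · simp only [hα, if_neg h0, hgA]
        exact node_mul hi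
    -- the second curve at the time at which the first one is in a vertex between the two edges
    have key : ∀ p, e j < p → p ≤ e (j + 1) → ∃ l : ℝ, l = (g.1 (β p) : ℝ) * ((k : ℝ) - 1) - j ∧
        0 ≤ l ∧ l ≤ 1 ∧ |X p - (Q j + l * (Q (j + 1) - Q j))| ≤ ρ := by
      intro p h1 h2
      have hpm : p < m := by have := hele (j + 1); omega
      have i1 := mul_le_mul_of_nonneg_right
        (Subtype.coe_le_coe.2 (g.2.1 (hegt j p h1 hpm).le)) hk1
      have i2 := mul_le_mul_of_nonneg_right
        (Subtype.coe_le_coe.2 (g.2.1 (hespec (j + 1) p (by omega) h2))) hk1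
      rw [hgα' j (by omega)] at i1
      rw [hgα' (j + 1) hj] at i2
      push_cast at i2
      have := hfg (β p)
      rw [hfβ p hpm, curve_eq_of_mem_edge Q hj i1 i2] at this
      exact ⟨_, rfl, by linarith, by linarith, this⟩
    have kmono : ∀ p p', p < p' → (g.1 (β p) : ℝ) * ((k : ℝ) - 1) - j ≤
        (g.1 (β p') : ℝ) * ((k : ℝ) - 1) - j := fun p p' hpp => by
      have := mul_le_mul_of_nonneg_right
        (Subtype.coe_le_coe.2 (g.2.1 (hβm hpp.le))) hk1
      linarith
    rcases le_total (Q j) (Q (j + 1)) with hq | hq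
    · refine Or.inl ⟨hq, fun p h1 h2 => ?_, fun p p' h1 h2 h3 => ?_⟩
      · obtain ⟨l, -, l0, l1, hl⟩ := key p h1 h2
        have := abs_le.1 hl
        constructor <;> nlinarith
      · obtain ⟨l, el, l0, l1, hl⟩ := key p h1 (by omega)
        obtain ⟨l', el', l0', l1', hl'⟩ := key p' (by omega) h3
        have := kmono p p' h2
        rw [← el, ← el'] at this
        have c1 := abs_le.1 hl
        have c2 := abs_le.1 hl'
        nlinarith
    · refine Or.inr ⟨hq, fun p h1 h2 => ?_, fun p p' h1 h2 h3 => ?_⟩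
      · obtain ⟨l, -, l0, l1, hl⟩ := key p h1 h2
        have := abs_le.1 hl
        constructor <;> nlinarith
      · obtain ⟨l, el, l0, l1, hl⟩ := key p h1 (by omega)
        obtain ⟨l', el', l0', l1', hl'⟩ := key p' (by omega) h3
        have := kmono p p' h2
        rw [← el, ← el'] at this
        have c1 := abs_le.1 hl
        have c2 := abs_le.1 hl'
        nlinarith
  · intro p h1 h2
    have := hfg (β p)
    rw [hfβ p h2] at this
    refine le_of_eq_of_le (congrArg (fun z => |X p - z|) (Eq.symm ?_)) this
    by_cases hk1 : k = 1
    · subst hk1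
      exact curve_eq_of_eq_natCast Q (by omega) (by simp)
    · have h3 := g.2.1 (hegt (k - 1) p h1 h2).le
      simp only [hα, if_neg (show k - 1 ≠ 0 by omega), hgA] at h3
      rw [node_of_le le_rfl] at h3
      have hs : g.1 (β p) = node k (k - 1) := by
        rw [node_of_le le_rfl]; exact le_antisymm (unitInterval.le_one _) h3
      exact (congrArg _ hs).trans (curve_node Q (by omega))

/-! ### Simplifying the query curve -/

theorem SegCond.neg {ρ v w : ℝ} {X : ℕ → ℝ} {a b : ℕ} (h : SegCond ρ v w X a b) :
    SegCond ρ (-v) (-w) (fun p => -X p) a b := by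
  rcases h with ⟨h1, h2, h3⟩ | ⟨h1, h2, h3⟩
  · refine Or.inr ⟨by linarith, fun p hp hp' => ?_, fun p p' hp hp' hp'' => ?_⟩
    · obtain ⟨i, j⟩ := h2 p hp hp'
      constructor <;> linarith
    · have := h3 p p' hp hp' hp''
      linarith
  · refine Or.inl ⟨by linarith, fun p hp hp' => ?_, fun p p' hp hp' hp'' => ?_⟩
    · obtain ⟨i, j⟩ := h2 p hp hp'
      constructor <;> linarith
    · have := h3 p p' hp hp' hp''
      linarith

theorem Align.neg {X Q : ℕ → ℝ} {m k : ℕ} {ρ : ℝ} {e : ℕ → ℕ} (h : Align X Q m k ρ e) :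
    Align (fun p => -X p) (fun p => -Q p) m k ρ e where
  zero := h.zero
  first := by
    have := h.first
    rw [abs_le] at this ⊢
    constructor <;> linarith
  mono := h.mono
  le := h.le
  on_edge j hj := by
    obtain ⟨h1, h2⟩ := h.on_edge j hj
    rw [min_neg_neg, max_neg_neg]
    constructor <;> linarith
  same_up j j' h1 h2 h3 h4 := by
    have := h.same_down j j' h1 h2 h3 (by linarith)
    linarith
  same_down j j' h1 h2 h3 h4 := by
    have := h.same_up j j' h1 h2 h3 (by linarith)
    linarith
  seg j hj := (h.seg j hj).neg
  last p h1 h2 := by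
    have := h.last p h1 h2
    rw [abs_le] at this ⊢
    constructor <;> linarith

/-- On its edge, which goes up, the vertex `Q j` lies behind all the vertices that are close to
the lower end, and before all the vertices that are close to the upper end. -/
def Align.DropUp (X Q : ℕ → ℝ) (k : ℕ) (ρ : ℝ) (e : ℕ → ℕ) (j : ℕ) : Prop :=
  (∀ i, j ≤ i → i < k → e i = e j → X (e j) + ρ < Q i) ∧
    ∀ i, i ≤ j → e i = e j → Q i < X (e j + 1) - ρ

/-- The vertices of the query curve that the simplification drops. -/
def Align.Drop (X Q : ℕ → ℝ) (k : ℕ) (ρ : ℝ) (e : ℕ → ℕ) (j : ℕ) : Prop :=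
  Align.DropUp X Q k ρ e j ∨ Align.DropUp (fun p => -X p) (fun p => -Q p) k ρ e j

namespace Align

variable {X Q : ℕ → ℝ} {m k : ℕ} {ρ : ℝ} {e : ℕ → ℕ}

theorem DropUp.lt_self {c : ℕ} (hc : DropUp X Q k ρ e c) (hk : c < k) :
    X (e c) + ρ < Q c ∧ Q c < X (e c + 1) - ρ :=
  ⟨hc.1 c le_rfl hk rfl, hc.2 c le_rfl rfl⟩

/-- The segment that enters the edge of a dropped vertex goes up. -/
theorem DropUp.up_before (H : Align X Q m k ρ e) {c : ℕ} (hc : DropUp X Q k ρ e (c + 1))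
    (hk : c + 1 < k) (he : e c < e (c + 1)) : Q c < Q (c + 1) ∧ Q c ≤ X (e (c + 1)) + ρ := by
  have h1 := (hc.lt_self hk).1
  rcases H.seg c hk with ⟨_, h3, _⟩ | ⟨_, h3, _⟩
  · have := (h3 (e (c + 1)) he le_rfl).1
    constructor <;> linarith
  · have := (h3 (e (c + 1)) he le_rfl).1
    linarith

/-- The segment that leaves the edge of a dropped vertex goes up. -/
theorem DropUp.up_after (H : Align X Q m k ρ e) {c : ℕ} (hc : DropUp X Q k ρ e c)
    (hk : c + 1 < k) (he : e c < e (c + 1)) :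
    Q c < Q (c + 1) ∧ X (e c + 1) - ρ ≤ Q (c + 1) := by
  have h1 := (hc.lt_self (by omega)).2
  rcases H.seg c hk with ⟨_, h3, _⟩ | ⟨_, h3, _⟩
  · have := (h3 (e c + 1) (by omega) (by omega)).2
    constructor <;> linarith
  · have := (h3 (e c + 1) (by omega) (by omega)).2
    linarith

/-- A segment that goes up meets the vertices between its edges without long drops. -/
theorem seg_up (H : Align X Q m k ρ e) (hρ : 0 ≤ ρ) {c : ℕ} (hk : c + 1 < k)
    (hq : e c < e (c + 1) → Q c < Q (c + 1)) :
    (∀ p, e c < p → p ≤ e (c + 1) → Q c - ρ ≤ X p ∧ X p ≤ Q (c + 1) + ρ) ∧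
      ∀ p p', e c < p → p ≤ p' → p' ≤ e (c + 1) → X p - X p' ≤ 2 * ρ := by
  by_cases he : e c < e (c + 1)
  · rcases H.seg c hk with ⟨_, h3, h4⟩ | ⟨h3, _⟩
    · refine ⟨h3, fun p p' h1 h2 h5 => ?_⟩
      rcases eq_or_lt_of_le h2 with h | h
      · rw [h]; linarith
      · exact h4 p p' h1 h h5
    · have := hq he
      linarith
  · exact ⟨fun p h1 h2 => by omega, fun p p' h1 h2 h3 => by omega⟩

/-- Along a run of dropped vertices, `z` stays below the lower ends of the edges. -/
theorem le_of_run (H : Align X Q m k ρ e) (hρ : 0 ≤ ρ) {a b : ℕ} (hb : b ≤ k)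
    (hd : ∀ c, a ≤ c → c < b → DropUp X Q k ρ e c) {z : ℝ} (hz : z ≤ X (e a) + ρ) :
    ∀ d, a ≤ d → d < b → z ≤ X (e d) + ρ := by
  intro d had
  induction d, had using Nat.le_induction with
  | base => exact fun _ => hz
  | succ n hn ih =>
    intro hnb
    have hz' := ih (by omega)
    rcases eq_or_lt_of_le (H.mono (Nat.le_add_right n 1)) with h | h
    · rwa [← h]
    · have hn' := hd n hn (by omega)
      have h1 := (hn'.lt_self (by omega))
      have h2 := (H.seg_up hρ (show n + 1 < k by omega) fun he => (hn'.up_after H (by omega) he).1).2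
        (e n + 1) (e (n + 1)) (by omega) h le_rfl
      linarith

theorem lt_of_run (H : Align X Q m k ρ e) (hρ : 0 ≤ ρ) {a b : ℕ} (hb : b ≤ k)
    (hd : ∀ c, a ≤ c → c < b → DropUp X Q k ρ e c) {c d : ℕ} (hac : a ≤ c) (hcd : c ≤ d)
    (hdb : d < b) : (e c < e d → Q c < Q d) ∧ (e c = e d → Q c - Q d ≤ 2 * ρ) := by
  have h1 := (hd c hac (by omega)).lt_self (by omega)
  have h2 := (hd d (by omega) hdb).lt_self (by omega)
  constructor
  · intro he
    by_contra hlt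
    -- the first vertex after the edge of `c`
    classical
    have hex : ∃ i, c ≤ i ∧ e c < e i := ⟨d, hcd, he⟩
    obtain ⟨j1, j2⟩ := Nat.find_spec hex
    set i := Nat.find hex with hi
    have hic : c < i := by
      rcases eq_or_lt_of_le j1 with h | h
      · rw [← h] at j2; omega
      · exact h
    have hid : i ≤ d := Nat.find_min' hex ⟨hcd, he⟩
    have hprev : e (i - 1) = e c := by
      have := Nat.find_min hex (show i - 1 < i by omega)
      push Not at this
      have h3 := this (by omega)
      have h4 := H.mono (show c ≤ i - 1 by omega)
      omega
    have hdi := hd (i - 1) (by omega) (by omega)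
    have e1 : i - 1 + 1 = i := by omega
    have h3 := (H.seg_up hρ (show i - 1 + 1 < k by omega)
      fun he => (hdi.up_after H (by omega) he).1).2
      (e c + 1) (e i) (by omega) (by omega) (by rw [e1])
    have h4 : Q c ≤ X (e i) + ρ := by linarith
    have h5 : Q c ≤ X (e d) + ρ := by
      have hi' := (hd i (by omega) (by omega)).lt_self (by omega)
      exact H.le_of_run hρ hb (a := i) (fun j hj => hd j (by omega)) h4 d hid hdb
    linarith
  · intro he
    exact H.same_up c d hcd (by omega) he (by linarith)

/-- Dropping a maximal run of vertices on edges that go up keeps the matching, and the new segment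
is close to the part of the query curve that it replaces. -/
theorem segCond_of_run (H : Align X Q m k ρ e) (hρ : 0 ≤ ρ) {a b : ℕ} (hab : a + 1 < b)
    (hb : b < k) (ha : ¬ DropUp X Q k ρ e a) (hb' : ¬ DropUp X Q k ρ e b)
    (hd : ∀ c, a + 1 ≤ c → c < b → DropUp X Q k ρ e c) :
    SegCond ρ (Q a) (Q b) Q a b ∧ SegCond ρ (Q a) (Q b) X (e a) (e b) := by
  -- `Q a` is below the dropped vertices
  have hlow : Q a ≤ X (e (a + 1)) + ρ := by
    rcases eq_or_lt_of_le (H.mono (Nat.le_succ a)) with h | h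
    · have hda := hd (a + 1) le_rfl hab
      by_contra hlt
      refine ha ⟨fun i h1 h2 h3 => ?_, fun i h1 h3 => ?_⟩
      · rcases eq_or_lt_of_le h1 with h4 | h4
        · rw [← h4, h]; exact not_le.1 hlt
        · rw [h]
          exact hda.1 i h4 h2 (by rw [h3]; exact h)
      · rw [h]
        exact hda.2 i (by omega) (by rw [h3]; exact h)
    · exact ((hd (a + 1) le_rfl hab).up_before H (by omega) h).2
  have hlow' : ∀ d, a + 1 ≤ d → d < b → Q a < Q d := by
    intro d h1 h2
    have h3 := (hd (a + 1) le_rfl hab).lt_self (by omega)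
    have := H.le_of_run hρ hb.le hd hlow d h1 h2
    have := ((hd d h1 h2).lt_self (by omega)).1
    linarith
  -- `Q b` is above the dropped vertices
  have hhigh : X (e (b - 1) + 1) - ρ ≤ Q b := by
    have hdb := hd (b - 1) (by omega) (by omega)
    have e1 : b - 1 + 1 = b := by omega
    rcases eq_or_lt_of_le (H.mono (show b - 1 ≤ b by omega)) with h | h
    · by_contra hlt
      refine hb' ⟨fun i h1 h2 h3 => ?_, fun i h1 h3 => ?_⟩
      · rw [← h]
        exact hdb.1 i (by omega) h2 (by rw [h3]; exact h.symm)
      · rcases eq_or_lt_of_le h1 with h4 | h4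
        · rw [h4, ← h]; exact not_le.1 hlt
        · rw [← h]
          exact hdb.2 i (by omega) (by rw [h3]; exact h.symm)
    · have := (hdb.up_after H (by omega) (by rw [e1]; exact h)).2
      rwa [e1] at this
  have hhigh' : ∀ i, a + 1 ≤ b - 1 - i → X (e (b - 1 - i) + 1) - ρ ≤ Q b := by
    intro i
    induction i with
    | zero => exact fun _ => hhigh
    | succ i ih =>
      intro h1
      have h2 := ih (by omega)
      have e1 : b - 1 - (i + 1) + 1 = b - 1 - i := by omega
      have hdc := hd (b - 1 - (i + 1)) h1 (by omega)
      rcases eq_or_lt_of_le (H.mono (show b - 1 - (i + 1) ≤ b - 1 - i by omega)) with h | h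
      · rwa [h]
      · have h3 := hdc.up_after H (by omega) (by rw [e1]; exact h)
        rw [e1] at h3
        have h4 := (hd (b - 1 - i) (by omega) (by omega)).lt_self (by omega)
        linarith
  have hhigh'' : ∀ d, a + 1 ≤ d → d < b → Q d < Q b := by
    intro d h1 h2
    have h3 := hhigh' (b - 1 - d) (by omega)
    rw [show b - 1 - (b - 1 - d) = d by omega] at h3
    have := ((hd d h1 h2).lt_self (by omega)).2
    linarith
  have hQab : Q a < Q b := (hlow' (a + 1) le_rfl hab).trans (hhigh'' (a + 1) le_rfl hab)
  refine ⟨Or.inl ⟨hQab.le, fun p h1 h2 => ?_, fun p p' h1 h2 h3 => ?_⟩,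
    Or.inl ⟨hQab.le, ?_⟩⟩
  · rcases eq_or_lt_of_le h2 with h | h
    · rw [h]; constructor <;> linarith
    · have := hlow' p h1 h
      have := hhigh'' p h1 h
      constructor <;> linarith
  · rcases eq_or_lt_of_le h3 with h | h
    · have := hhigh'' p h1 (by omega)
      rw [h]; linarith
    · have := H.lt_of_run hρ hb.le hd (c := p) (d := p') h1 h2.le h
      rcases eq_or_lt_of_le (H.mono h2.le) with h' | h'
      · exact this.2 h'
      · have := this.1 h'
        linarith
  · -- the segment that meets the vertex `p`
    have hex : ∀ p, e a < p → p ≤ e b → ∃ c, a ≤ c ∧ c < b ∧ e c < p ∧ p ≤ e (c + 1) := by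
      intro p h1 h2
      classical
      have hex : ∃ i, p ≤ e i := ⟨b, h2⟩
      have j1 := Nat.find_spec hex
      have j2 := Nat.find_min' hex h2
      have j3 : a < Nat.find hex := by
        by_contra h
        have := H.mono (not_lt.1 h)
        omega
      refine ⟨Nat.find hex - 1, by omega, by omega, ?_, ?_⟩
      · exact not_le.1 (Nat.find_min hex (by omega))
      · rwa [show Nat.find hex - 1 + 1 = Nat.find hex by omega]
    have hup : ∀ c, a ≤ c → c < b → e c < e (c + 1) → Q c < Q (c + 1) := by
      intro c h1 h2 h3
      rcases eq_or_lt_of_le h1 with h | h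
      · rw [← h]
        exact hlow' (a + 1) le_rfl hab
      · exact ((hd c h h2).up_after H (by omega) h3).1
    have hle : ∀ c, a ≤ c → c < b → Q a ≤ Q c ∧ Q (c + 1) ≤ Q b := by
      intro c h1 h2
      constructor
      · rcases eq_or_lt_of_le h1 with h | h
        · rw [h]
        · exact (hlow' c h h2).le
      · rcases eq_or_lt_of_le (show c + 1 ≤ b from h2) with h | h
        · rw [h]
        · exact (hhigh'' (c + 1) (by omega) h).le
    refine ⟨fun p h1 h2 => ?_, fun p p' h1 h2 h3 => ?_⟩
    · obtain ⟨c, i1, i2, i3, i4⟩ := hex p h1 h2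
      have := (H.seg_up hρ (show c + 1 < k by omega) (hup c i1 i2)).1 p i3 i4
      have := hle c i1 i2
      constructor <;> linarith
    · obtain ⟨c, i1, i2, i3, i4⟩ := hex p h1 (by omega)
      obtain ⟨c', i1', i2', i3', i4'⟩ := hex p' (by omega) h3
      have s := H.seg_up hρ (show c + 1 < k by omega) (hup c i1 i2)
      have s' := H.seg_up hρ (show c' + 1 < k by omega) (hup c' i1' i2')
      have hcc : c ≤ c' := by
        by_contra h
        have := H.mono (show c' + 1 ≤ c by omega)
        omega
      rcases eq_or_lt_of_le hcc with h | h
      · subst h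
        exact s.2 p p' i3 h2.le i4'
      · have l := H.lt_of_run hρ hb.le hd (c := c + 1) (d := c') (by omega) h i2'
        have b1 := (s.1 p i3 i4).2
        have b2 := (s'.1 p' i3' i4').1
        rcases eq_or_lt_of_le (H.mono (show c + 1 ≤ c' from h)) with h' | h'
        · have d1 := s.2 p (e (c + 1)) i3 i4 le_rfl
          have d2 := s'.2 (e c' + 1) p' (by omega) (by omega) i4'
          have d3 := (hd c' (by omega) i2').lt_self (by omega)
          rw [h'] at d1
          linarith
        · have := l.1 h'
          linarith

/-- Neighbouring dropped vertices lie on edges of the same direction. -/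
theorem dropUp_succ (H : Align X Q m k ρ e) (hρ : 0 ≤ ρ) {c : ℕ} (hk : c + 1 < k)
    (h : DropUp X Q k ρ e c) (h' : Drop X Q k ρ e (c + 1)) : DropUp X Q k ρ e (c + 1) := by
  rcases h' with h' | h'
  · exact h'
  · exfalso
    rcases eq_or_lt_of_le (H.mono (Nat.le_succ c)) with he | he
    · have h1 := h.lt_self (by omega)
      have h2 := h'.lt_self (by omega)
      rw [← Nat.succ_eq_add_one, ← he] at h2
      linarith
    · have h1 := (h.up_after H hk he).1
      have h2 := (h'.up_before H.neg hk he).1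
      linarith

theorem dropUp_run (H : Align X Q m k ρ e) (hρ : 0 ≤ ρ) {a b : ℕ} (hb : b ≤ k)
    (h : DropUp X Q k ρ e a) (hd : ∀ c, a ≤ c → c < b → Drop X Q k ρ e c) :
    ∀ c, a ≤ c → c < b → DropUp X Q k ρ e c := by
  intro c hac
  induction c, hac using Nat.le_induction with
  | base => exact fun _ => h
  | succ n hn ih =>
    intro hnb
    exact H.dropUp_succ hρ (by omega) (ih (by omega)) (hd _ (by omega) hnb)

/-- The query curve has a simplification to some of its vertices, the first and the last one
among them, such that all of its vertices are close to vertices of the other curve. -/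
theorem exists_simplification (H : Align X Q m k ρ e) (hρ : 0 ≤ ρ) (hm : 0 < m) (hk : 0 < k)
    (hX : X m = X (m - 1)) :
    ∃ S : ℕ → Prop, S 0 ∧ S (k - 1) ∧
      (∀ j < k, S j → |Q j - X (e j)| ≤ 3 * ρ ∨ |Q j - X (e j + 1)| ≤ 3 * ρ) ∧
      ∀ a b, a < b → b < k → S a → S b → (∀ c, a < c → c < b → ¬ S c) →
        SegCond ρ (Q a) (Q b) Q a b ∧ SegCond ρ (Q a) (Q b) X (e a) (e b) := by
  refine ⟨fun j => ¬ Drop X Q k ρ e j, ?_, ?_, ?_, ?_⟩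
  · have h0 := abs_le.1 H.first
    rintro (h | h)
    · have := (h.lt_self hk).1
      rw [H.zero] at this
      linarith
    · have := (h.lt_self hk).1
      rw [H.zero] at this
      linarith
  · have hle := H.le (k - 1)
    rcases Nat.lt_or_ge (e (k - 1) + 1) m with h0 | h0
    · have h0 := abs_le.1 (H.last (e (k - 1) + 1) (by omega) h0)
      rintro (h | h)
      · have := (h.lt_self (by omega)).2
        linarith
      · have := (h.lt_self (by omega)).2
        linarith
    · have h1 : X (e (k - 1) + 1) = X (e (k - 1)) := by
        rw [show e (k - 1) + 1 = m by omega, hX]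
        congr 1
        omega
      rintro (h | h)
      · have := h.lt_self (by omega)
        rw [h1] at this
        linarith
      · have := h.lt_self (by omega)
        rw [h1] at this
        linarith
  · intro j hj hS
    simp only [Drop, not_or] at hS
    obtain ⟨s1, s2⟩ := hS
    have hE := H.on_edge j hj
    rcases le_total (X (e j)) (X (e j + 1)) with hxy | hxy
    · rw [min_eq_left hxy, max_eq_right hxy] at hE
      simp only [DropUp, not_and_or, not_forall, not_lt] at s1
      rcases s1 with ⟨i, h1, h2, h3, h4⟩ | ⟨i, h1, h3, h4⟩
      · left
        have := H.same_up j i h1 h2 h3.symm hxy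
        rw [abs_le]; constructor <;> linarith
      · right
        have := H.same_up i j h1 hj h3 (by rw [h3]; exact hxy)
        rw [abs_le]; constructor <;> linarith
    · rw [min_eq_right hxy, max_eq_left hxy] at hE
      simp only [DropUp, not_and_or, not_forall, not_lt] at s2
      rcases s2 with ⟨i, h1, h2, h3, h4⟩ | ⟨i, h1, h3, h4⟩
      · left
        have := H.same_down j i h1 h2 h3.symm hxy
        rw [abs_le]; constructor <;> linarith
      · right
        have := H.same_down i j h1 hj h3 (by rw [h3]; exact hxy)
        rw [abs_le]; constructor <;> linarith
  · intro a b hab hb hSa hSb hD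
    simp only [not_not] at hD
    rcases eq_or_lt_of_le (show a + 1 ≤ b from hab) with h | h
    · subst h
      refine ⟨?_, H.seg a hb⟩
      rcases le_total (Q a) (Q (a + 1)) with h | h
      · refine Or.inl ⟨h, fun p h1 h2 => ?_, fun p p' h1 h2 h3 => by omega⟩
        rw [show p = a + 1 by omega]; constructor <;> linarith
      · refine Or.inr ⟨h, fun p h1 h2 => ?_, fun p p' h1 h2 h3 => by omega⟩
        rw [show p = a + 1 by omega]; constructor <;> linarith
    · simp only [Drop, not_or] at hSa hSb
      rcases hD (a + 1) (by omega) h with h' | h'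
      · exact H.segCond_of_run hρ h hb hSa.1 hSb.1
          (H.dropUp_run hρ hb.le h' fun c h1 h2 => hD c h1 h2)
      · have := H.neg.segCond_of_run hρ h hb hSa.2 hSb.2
          (H.neg.dropUp_run hρ hb.le h' fun c h1 h2 => by
            rcases hD c h1 h2 with h'' | h''
            · right; simpa [DropUp] using h''
            · exact Or.inl h'')
        obtain ⟨h1, h2⟩ := this
        have h1 := h1.neg
        have h2 := h2.neg
        simp only [neg_neg] at h1 h2
        exact ⟨h1, h2⟩

end Align

/-! ### The simplified and rounded query curve -/

open Classical in
/-- The indices below `j` that satisfy `S`, in decreasing order. -/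
noncomputable def keptList (S : ℕ → Prop) : ℕ → List ℕ
  | 0 => []
  | j + 1 => if S j then j :: keptList S j else keptList S j

/-- The part of `Q` between consecutive indices in `S` is within `ρ` of the segment between the
values at these indices. -/
def GapsOK (ρ : ℝ) (Q : ℕ → ℝ) (S : ℕ → Prop) (k : ℕ) : Prop :=
  ∀ a b, a < b → b < k → S a → S b → (∀ c, a < c → c < b → ¬ S c) → SegCond ρ (Q a) (Q b) Q a b

theorem SegCond.mono {ρ ρ' v w : ℝ} {X : ℕ → ℝ} {a b : ℕ} (hρ : ρ ≤ ρ')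
    (h : SegCond ρ v w X a b) : SegCond ρ' v w X a b := by
  rcases h with ⟨h1, h2, h3⟩ | ⟨h1, h2, h3⟩
  · refine Or.inl ⟨h1, fun p hp hp' => ?_, fun p p' hp hp' hp'' => ?_⟩
    · have := h2 p hp hp'
      constructor <;> linarith
    · have := h3 p p' hp hp' hp''
      linarith
  · refine Or.inr ⟨h1, fun p hp hp' => ?_, fun p p' hp hp' hp'' => ?_⟩
    · have := h2 p hp hp'
      constructor <;> linarith
    · have := h3 p p' hp hp' hp''
      linarith

theorem SegCond.floor {ρ v w : ℝ} {X : ℕ → ℝ} {a b : ℕ} (h : SegCond ρ v w X a b) :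
    SegCond (ρ + 1) ⌊v⌋ ⌊w⌋ X a b := by
  have v1 := Int.floor_le v
  have v2 := Int.lt_floor_add_one v
  have w1 := Int.floor_le w
  have w2 := Int.lt_floor_add_one w
  rcases h with ⟨h1, h2, h3⟩ | ⟨h1, h2, h3⟩
  · refine Or.inl ⟨by exact_mod_cast Int.floor_mono h1, fun p hp hp' => ?_,
      fun p p' hp hp' hp'' => ?_⟩
    · have := h2 p hp hp'
      constructor <;> linarith
    · have := h3 p p' hp hp' hp''
      linarith
  · refine Or.inr ⟨by exact_mod_cast Int.floor_mono h1, fun p hp hp' => ?_,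
      fun p p' hp hp' hp'' => ?_⟩
    · have := h2 p hp hp'
      constructor <;> linarith
    · have := h3 p p' hp hp' hp''
      linarith

theorem GapsOK.mono {ρ ρ' : ℝ} {Q : ℕ → ℝ} {S : ℕ → Prop} {k : ℕ} (hρ : ρ ≤ ρ')
    (h : GapsOK ρ Q S k) : GapsOK ρ' Q S k :=
  fun a b h1 h2 h3 h4 h5 => (h a b h1 h2 h3 h4 h5).mono hρ

theorem keptList_eq_cons {S : ℕ → Prop} (h0 : S 0) (j : ℕ) :
    ∃ a l, keptList S (j + 1) = a :: l ∧ a ≤ j ∧ S a ∧ ∀ c, a < c → c ≤ j → ¬ S c := by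
  induction j with
  | zero => exact ⟨0, [], by simp [keptList, h0], le_rfl, h0, fun c h1 h2 => by omega⟩
  | succ j ih =>
    obtain ⟨a, l, h1, h2, h3, h4⟩ := ih
    by_cases hS : S (j + 1)
    · exact ⟨j + 1, keptList S (j + 1), by rw [keptList, if_pos hS], le_rfl, hS,
        fun c _ _ => by omega⟩
    · refine ⟨a, l, by rw [keptList, if_neg hS, h1], by omega, h3, fun c hc hc' => ?_⟩
      rcases eq_or_lt_of_le hc' with h | h
      · rwa [h]
      · exact h4 c hc (by omega)

theorem length_keptList_le (S : ℕ → Prop) (j : ℕ) : (keptList S j).length ≤ j := by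
  induction j with
  | zero => simp [keptList]
  | succ j ih =>
    rw [keptList]
    split_ifs
    · simpa using ih
    · omega

theorem vreach_keptList {ρ : ℝ} (hρ : 0 ≤ ρ) {Q : ℕ → ℝ} {S : ℕ → Prop} {k : ℕ}
    (h0 : S 0) (h : GapsOK ρ Q S k) (j : ℕ) (hj : j < k) :
    ∃ a, (keptList S (j + 1)).head? = some a ∧
      VReach Q Q ρ (fun f _ => f < k) (keptList S (j + 1)) a (Q a) := by
  induction j with
  | zero =>
    refine ⟨0, by simp [keptList, h0], ?_⟩
    rw [keptList, if_pos h0, keptList]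
    exact .init (by simpa using hρ) hj
  | succ j ih =>
    obtain ⟨a, ha, hv⟩ := ih (by omega)
    obtain ⟨a', l, h1, h2, h3, h4⟩ := keptList_eq_cons h0 j
    rw [h1] at ha hv
    simp only [List.head?_cons, Option.some.injEq] at ha
    subst ha
    by_cases hS : S (j + 1)
    · refine ⟨j + 1, by simp [keptList, hS], ?_⟩
      rw [keptList, if_pos hS, h1]
      refine .next hv (by omega) (h a' (j + 1) (by omega) hj h3 hS
        fun c hc hc' => h4 c hc (by omega)) ?_ hj
      rw [if_neg (by omega)]
      rcases le_or_gt (Q (j + 1)) (Q (j + 1 + 1)) with hq | hq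
      · exact Or.inl ⟨hq, by linarith, by linarith, by rw [max_eq_left]; linarith⟩
      · exact Or.inr ⟨hq, by linarith, by linarith, by rw [min_eq_left]; linarith⟩
    · refine ⟨a', ?_, ?_⟩
      · rw [keptList, if_neg hS, h1]; rfl
      · rw [keptList, if_neg hS, h1]; exact hv

/-- If the simplified and rounded query curve is matched to `X`, then the query curve is close to
`X`. The three terms of the bound stem from the matching, the rounding and the simplification. -/
theorem frechetDist_le_of_vreach_floor {ρ : ℝ} (hρ : 0 ≤ ρ) {X Q : ℕ → ℝ} {S : ℕ → Prop} {m k : ℕ}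
    (hm : 0 < m) (hk : 0 < k) (hX : X m = X (m - 1)) (hQ : Q k = Q (k - 1)) (h0 : S 0)
    (h1 : S (k - 1)) (hgap : GapsOK ρ Q S k) {N : ℕ → ℤ → Prop} (hN : ∀ f a, N f a → f < m)
    {a : ℤ} {l : List ℤ} (hl : (keptList S k).map (fun j => ⌊Q j⌋) = a :: l) {f : ℕ} {h : ℝ}
    (hv : VReach (fun z : ℤ => (z : ℝ)) X ρ N (a :: l) f h)
    (hlast : ∀ p, f < p → p < m → |X p - a| ≤ ρ) :
    frechetDist (curve m X) (curve k Q) ≤ 2 * ρ + 1 := by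
  obtain ⟨b, l', e1, e2, e3, e4⟩ := keptList_eq_cons h0 (k - 1)
  rw [show k - 1 + 1 = k by omega] at e1
  have hb : b = k - 1 := by
    by_contra hne
    exact e4 (k - 1) (by omega) le_rfl h1
  obtain ⟨b', hb', hv'⟩ := vreach_keptList hρ h0 hgap (k - 1) (by omega)
  rw [show k - 1 + 1 = k by omega, e1] at hb' hv'
  simp only [List.head?_cons, Option.some.injEq] at hb'
  subst hb'
  have hlen : (a :: l).length = (b :: l').length := by rw [← hl, e1, List.length_map]
  set L := b :: l' with hL
  have d1 := hv.frechetDist_le hm hX hρ hN hlast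
    (Y := fun j => ((((a :: l).reverse[j]?).getD 0 : ℤ) : ℝ)) (fun j x hx => by rw [hx]; rfl)
  have d2 := hv'.frechetDist_le hk hQ hρ (fun f _ h => h) (fun p hp hp' => by omega)
    (Y := fun j => Q ((L.reverse[j]?).getD 0)) (fun j x hx => by rw [hx]; rfl)
  rw [hlen] at d1
  have d3 : frechetDist (curve L.length fun j => ((((a :: l).reverse[j]?).getD 0 : ℤ) : ℝ))
      (curve L.length fun j => Q ((L.reverse[j]?).getD 0)) ≤ 1 := by
    refine frechetDist_curve_le (by simp [hL]) fun p hp => ?_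
    have hp' : p < L.reverse.length := by simpa using hp
    rw [← hl, e1, ← List.map_reverse, List.getElem?_map, List.getElem?_eq_getElem hp']
    simp only [Option.map_some, Option.getD_some]
    have i1 := Int.floor_le (Q L.reverse[p])
    have i2 := Int.lt_floor_add_one (Q L.reverse[p])
    rw [abs_le]
    constructor <;> linarith
  rw [frechetDist_comm] at d2
  have t1 := frechetDist_triangle (curve m X)
    (curve L.length fun j => ((((a :: l).reverse[j]?).getD 0 : ℤ) : ℝ)) (curve k Q)
  have t2 := frechetDist_triangle
    (curve L.length fun j => ((((a :: l).reverse[j]?).getD 0 : ℤ) : ℝ))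
    (curve L.length fun j => Q ((L.reverse[j]?).getD 0)) (curve k Q)
  linarith

/-- The integer `v` is close to one of the two ends of the edge `f`. -/
def NearEdge (X : ℕ → ℝ) (m : ℕ) (δ : ℝ) (f : ℕ) (v : ℤ) : Prop :=
  f < m ∧ (|(v : ℝ) - X f| ≤ δ ∨ |(v : ℝ) - X (f + 1)| ≤ δ)

theorem abs_floor_sub_le {q x δ : ℝ} (h : |q - x| ≤ δ) : |(⌊q⌋ : ℝ) - x| ≤ δ + 1 := by
  have i1 := Int.floor_le q
  have i2 := Int.lt_floor_add_one q
  rw [abs_le] at h ⊢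
  constructor <;> linarith

theorem Align.vreach_keptList {X Q : ℕ → ℝ} {m k : ℕ} {ρ : ℝ} {e : ℕ → ℕ} {S : ℕ → Prop}
    (H : Align X Q m k ρ e) (hm : 0 < m) (h0 : S 0)
    (hnear : ∀ j < k, S j → |Q j - X (e j)| ≤ 3 * ρ ∨ |Q j - X (e j + 1)| ≤ 3 * ρ)
    (hseg : ∀ a b, a < b → b < k → S a → S b → (∀ c, a < c → c < b → ¬ S c) →
      SegCond ρ (Q a) (Q b) X (e a) (e b)) (j : ℕ) (hj : j < k) :
    ∃ a h, (keptList S (j + 1)).head? = some a ∧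
      VReach (fun z : ℤ => (z : ℝ)) X (ρ + 1) (NearEdge X m (3 * ρ + 1))
        ((keptList S (j + 1)).map fun j => ⌊Q j⌋) (e a) h ∧
      (X (e a) ≤ X (e a + 1) → ∀ b, a ≤ b → b < k → e b = e a → h ≤ ⌊Q b⌋ + (ρ + 1)) ∧
      (X (e a + 1) < X (e a) → ∀ b, a ≤ b → b < k → e b = e a → ⌊Q b⌋ - (ρ + 1) ≤ h) := by
  have hN : ∀ j < k, S j → NearEdge X m (3 * ρ + 1) (e j) ⌊Q j⌋ := fun j hj hS =>
    ⟨by have := H.le j; omega, (hnear j hj hS).imp abs_floor_sub_le abs_floor_sub_le⟩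
  -- rounding keeps the vertices on their edges
  have hon : ∀ b < k, (X (e b) ≤ X (e b + 1) →
      X (e b) ≤ ⌊Q b⌋ + (ρ + 1) ∧ ⌊Q b⌋ - (ρ + 1) ≤ X (e b + 1)) ∧
      (X (e b + 1) < X (e b) →
        ⌊Q b⌋ - (ρ + 1) ≤ X (e b) ∧ X (e b + 1) ≤ ⌊Q b⌋ + (ρ + 1)) := by
    intro b hb
    have i1 := Int.floor_le (Q b)
    have i2 := Int.lt_floor_add_one (Q b)
    obtain ⟨j1, j2⟩ := H.on_edge b hb
    constructor
    · intro h
      rw [min_eq_left h] at j1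
      rw [max_eq_right h] at j2
      constructor <;> linarith
    · intro h
      rw [min_eq_right h.le] at j1
      rw [max_eq_left h.le] at j2
      constructor <;> linarith
  induction j with
  | zero =>
    have hl : keptList S 1 = [0] := by simp [keptList, h0]
    refine ⟨0, X 0, by rw [hl]; rfl, ?_, fun hx b _ hb he => ?_, fun hx b _ hb he => ?_⟩
    · rw [hl, H.zero]
      refine .init ?_ (by have := hN 0 hj h0; rwa [H.zero] at this)
      rw [abs_sub_comm]
      exact abs_floor_sub_le (by rw [abs_sub_comm]; exact H.first)
    · rw [H.zero] at hx he
      have := ((hon b hb).1 (by rw [he]; exact hx)).1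
      rwa [he] at this
    · rw [H.zero] at hx he
      have := ((hon b hb).2 (by rw [he]; exact hx)).1
      rwa [he] at this
  | succ j ih =>
    obtain ⟨a, h, ha, hv, hup, hdown⟩ := ih (by omega)
    obtain ⟨a', l, h1, h2, h3, h4⟩ := keptList_eq_cons h0 j
    rw [h1] at ha hv
    simp only [List.head?_cons, Option.some.injEq] at ha
    subst ha
    by_cases hS : S (j + 1)
    · have hs := (hseg a' (j + 1) (by omega) hj h3 hS fun c hc hc' => h4 c hc (by omega)).floor
      have hmono := H.mono (show a' ≤ j + 1 by omega)
      have hkept : keptList S (j + 1 + 1) = (j + 1) :: a' :: l := by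
        rw [keptList, if_pos hS, h1]
      set y := (if e (j + 1) = e a' then h else X (e (j + 1))) with hy
      rcases le_or_gt (X (e (j + 1))) (X (e (j + 1) + 1)) with hx | hx
      · have hle : ∀ b, j + 1 ≤ b → b < k → e b = e (j + 1) → y ≤ ⌊Q b⌋ + (ρ + 1) := by
          intro b hb hbk he
          rw [hy]
          split_ifs with hf
          · exact hup (by rw [← hf]; exact hx) b (by omega) hbk (by omega)
          · have := ((hon b hbk).1 (by rw [he]; exact hx)).1
            rwa [he] at this
        refine ⟨j + 1, max y (⌊Q (j + 1)⌋ - (ρ + 1)), by rw [hkept]; rfl, ?_,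
          fun _ b hb hbk he => ?_, fun hx' => absurd hx' (not_lt.2 hx)⟩
        · rw [hkept]
          exact .next hv hmono hs (Or.inl ⟨hx, hle _ le_rfl hj rfl, ((hon _ hj).1 hx).2, rfl⟩)
            (hN _ hj hS)
        · refine max_le (hle b hb hbk he) ?_
          have := H.same_up (j + 1) b hb hbk he.symm hx
          have i1 := Int.floor_le (Q (j + 1))
          have i2 := Int.lt_floor_add_one (Q b)
          linarith
      · have hle : ∀ b, j + 1 ≤ b → b < k → e b = e (j + 1) → ⌊Q b⌋ - (ρ + 1) ≤ y := by
          intro b hb hbk he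
          rw [hy]
          split_ifs with hf
          · exact hdown (by rw [← hf]; exact hx) b (by omega) hbk (by omega)
          · have := ((hon b hbk).2 (by rw [he]; exact hx)).1
            rwa [he] at this
        refine ⟨j + 1, min y (⌊Q (j + 1)⌋ + (ρ + 1)), by rw [hkept]; rfl, ?_,
          fun hx' => absurd hx' (not_le.2 hx), fun _ b hb hbk he => ?_⟩
        · rw [hkept]
          exact .next hv hmono hs (Or.inr ⟨hx, hle _ le_rfl hj rfl, ((hon _ hj).2 hx).2, rfl⟩)
            (hN _ hj hS)
        · refine le_min (hle b hb hbk he) ?_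
          have := H.same_down (j + 1) b hb hbk he.symm hx.le
          have i1 := Int.floor_le (Q b)
          have i2 := Int.lt_floor_add_one (Q (j + 1))
          linarith
    · have hkept : keptList S (j + 1 + 1) = a' :: l := by rw [keptList, if_neg hS, h1]
      exact ⟨a', h, by rw [hkept]; rfl, by rw [hkept]; exact hv, hup, hdown⟩

/-- If the query curve is close to `X`, then some simplification of it, after rounding, has
a matching with `X` all of whose vertices are close to vertices of `X`. -/
theorem exists_vreach_of_frechetDist_lt {ρ : ℝ} (hρ : 0 ≤ ρ) {X Q : ℕ → ℝ} {m k : ℕ}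
    (hm : 0 < m) (hk : 0 < k) (hX : X m = X (m - 1))
    (hlt : frechetDist (curve m X) (curve k Q) < ρ) :
    ∃ S : ℕ → Prop, S 0 ∧ S (k - 1) ∧ GapsOK ρ Q S k ∧ ∃ a l f h,
      (keptList S k).map (fun j => ⌊Q j⌋) = a :: l ∧
      VReach (fun z : ℤ => (z : ℝ)) X (ρ + 1) (NearEdge X m (3 * ρ + 1)) (a :: l) f h ∧
      ∀ p, f < p → p < m → |X p - a| ≤ ρ + 1 := by
  obtain ⟨e, H⟩ := exists_align hm hk hlt
  obtain ⟨S, h0, h1, hnear, hseg⟩ := H.exists_simplification hρ hm hk hX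
  obtain ⟨b, h, hb, hv, -⟩ := H.vreach_keptList hm h0 hnear
    (fun a b h1 h2 h3 h4 h5 => (hseg a b h1 h2 h3 h4 h5).2) (k - 1) (by omega)
  obtain ⟨b', l', e1, e2, e3, e4⟩ := keptList_eq_cons h0 (k - 1)
  have hb' : b' = k - 1 := by
    by_contra hne
    exact e4 (k - 1) (by omega) le_rfl h1
  rw [e1] at hb hv
  rw [show k - 1 + 1 = k by omega] at e1
  simp only [List.head?_cons, Option.some.injEq] at hb
  refine ⟨S, h0, h1, fun a b h1 h2 h3 h4 h5 => (hseg a b h1 h2 h3 h4 h5).1, ⌊Q b'⌋,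
    l'.map fun j => ⌊Q j⌋, e b, h, by rw [e1]; rfl, hv, fun p hp hp' => ?_⟩
  rw [hb'] at *
  rw [← hb] at hp
  rw [abs_sub_comm]
  exact abs_floor_sub_le (by rw [abs_sub_comm]; exact H.last p hp hp')

/-! ### The search for matchings as a state machine -/

/-- `mx`, `mn`, `D` and `R` are the maximum, the minimum, the longest drop and the longest rise of
the sequence `v, X (a + 1), …, X b`. -/
structure IsStats (X : ℕ → ℝ) (v : ℝ) (a b : ℕ) (mx mn D R : ℝ) : Prop where
  mx_le_iff : ∀ c, mx ≤ c ↔ v ≤ c ∧ ∀ p, a < p → p ≤ b → X p ≤ c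
  le_mn_iff : ∀ c, c ≤ mn ↔ c ≤ v ∧ ∀ p, a < p → p ≤ b → c ≤ X p
  drop_le_iff : ∀ c, D ≤ c ↔ 0 ≤ c ∧ (∀ p, a < p → p ≤ b → v - X p ≤ c) ∧
    ∀ p p', a < p → p < p' → p' ≤ b → X p - X p' ≤ c
  rise_le_iff : ∀ c, R ≤ c ↔ 0 ≤ c ∧ (∀ p, a < p → p ≤ b → X p - v ≤ c) ∧
    ∀ p p', a < p → p < p' → p' ≤ b → X p' - X p ≤ c

theorem IsStats.refl (X : ℕ → ℝ) (v : ℝ) {a b : ℕ} (h : b ≤ a) : IsStats X v a b v v 0 0 where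
  mx_le_iff c := ⟨fun h' => ⟨h', fun p _ _ => by omega⟩, fun h => h.1⟩
  le_mn_iff c := ⟨fun h' => ⟨h', fun p _ _ => by omega⟩, fun h => h.1⟩
  drop_le_iff c := ⟨fun h' => ⟨h', fun p _ _ => by omega, fun p p' _ _ _ => by omega⟩,
    fun h => h.1⟩
  rise_le_iff c := ⟨fun h' => ⟨h', fun p _ _ => by omega, fun p p' _ _ _ => by omega⟩,
    fun h => h.1⟩

theorem IsStats.succ {X : ℕ → ℝ} {v : ℝ} {a b : ℕ} {mx mn D R : ℝ} (hab : a ≤ b)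
    (H : IsStats X v a b mx mn D R) :
    IsStats X v a (b + 1) (max mx (X (b + 1))) (min mn (X (b + 1)))
      (max D (mx - X (b + 1))) (max R (X (b + 1) - mn)) where
  mx_le_iff c := by
    rw [max_le_iff, H.mx_le_iff]
    constructor
    · rintro ⟨⟨h1, h2⟩, h3⟩
      refine ⟨h1, fun p hp hp' => ?_⟩
      rcases eq_or_lt_of_le hp' with h | h
      · rwa [h]
      · exact h2 p hp (by omega)
    · rintro ⟨h1, h2⟩
      exact ⟨⟨h1, fun p hp hp' => h2 p hp (by omega)⟩, h2 _ (by omega) le_rfl⟩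
  le_mn_iff c := by
    rw [le_min_iff, H.le_mn_iff]
    constructor
    · rintro ⟨⟨h1, h2⟩, h3⟩
      refine ⟨h1, fun p hp hp' => ?_⟩
      rcases eq_or_lt_of_le hp' with h | h
      · rwa [h]
      · exact h2 p hp (by omega)
    · rintro ⟨h1, h2⟩
      exact ⟨⟨h1, fun p hp hp' => h2 p hp (by omega)⟩, h2 _ (by omega) le_rfl⟩
  drop_le_iff c := by
    rw [max_le_iff, H.drop_le_iff, sub_le_iff_le_add, H.mx_le_iff]
    constructor
    · rintro ⟨⟨h1, h2, h3⟩, h4, h5⟩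
      refine ⟨h1, fun p hp hp' => ?_, fun p p' hp hpp hp' => ?_⟩
      · rcases eq_or_lt_of_le hp' with h | h
        · rw [h]; linarith
        · exact h2 p hp (by omega)
      · rcases eq_or_lt_of_le hp' with h | h
        · rw [h]; linarith [h5 p hp (by omega)]
        · exact h3 p p' hp hpp (by omega)
    · rintro ⟨h1, h2, h3⟩
      exact ⟨⟨h1, fun p hp hp' => h2 p hp (by omega), fun p p' hp hpp hp' =>
        h3 p p' hp hpp (by omega)⟩, by linarith [h2 (b + 1) (by omega) le_rfl],
        fun p hp hp' => by linarith [h3 p (b + 1) hp (by omega) le_rfl]⟩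
  rise_le_iff c := by
    rw [max_le_iff, H.rise_le_iff, sub_le_comm, H.le_mn_iff]
    constructor
    · rintro ⟨⟨h1, h2, h3⟩, h4, h5⟩
      refine ⟨h1, fun p hp hp' => ?_, fun p p' hp hpp hp' => ?_⟩
      · rcases eq_or_lt_of_le hp' with h | h
        · rw [h]; linarith
        · exact h2 p hp (by omega)
      · rcases eq_or_lt_of_le hp' with h | h
        · rw [h]; linarith [h5 p hp (by omega)]
        · exact h3 p p' hp hpp (by omega)
    · rintro ⟨h1, h2, h3⟩
      exact ⟨⟨h1, fun p hp hp' => h2 p hp (by omega), fun p p' hp hpp hp' =>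
        h3 p p' hp hpp (by omega)⟩, by linarith [h2 (b + 1) (by omega) le_rfl],
        fun p hp hp' => by linarith [h3 p (b + 1) hp (by omega) le_rfl]⟩

/-- The condition `SegCond` in terms of maximum, minimum, drop and rise. -/
def SegTest (ρ v w mx mn D R : ℝ) : Prop :=
  (v ≤ w ∧ D ≤ 2 * ρ ∧ v - ρ ≤ mn ∧ mx ≤ w + ρ) ∨
  (w ≤ v ∧ R ≤ 2 * ρ ∧ mx ≤ v + ρ ∧ w - ρ ≤ mn)

theorem IsStats.segTest_iff {X : ℕ → ℝ} {v : ℝ} {a b : ℕ} {mx mn D R ρ w : ℝ} (hρ : 0 ≤ ρ)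
    (H : IsStats X v a b mx mn D R) : SegTest ρ v w mx mn D R ↔ SegCond ρ v w X a b := by
  unfold SegTest SegCond
  rw [H.mx_le_iff, H.mx_le_iff, H.le_mn_iff, H.le_mn_iff, H.drop_le_iff, H.rise_le_iff]
  constructor
  · rintro (⟨h1, ⟨_, _, h2⟩, ⟨_, h3⟩, _, h4⟩ | ⟨h1, ⟨_, _, h2⟩, ⟨_, h3⟩, _, h4⟩)
    · exact Or.inl ⟨h1, fun p hp hp' => ⟨h3 p hp hp', h4 p hp hp'⟩, h2⟩
    · exact Or.inr ⟨h1, fun p hp hp' => ⟨h4 p hp hp', h3 p hp hp'⟩, h2⟩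
  · rintro (⟨h1, h2, h3⟩ | ⟨h1, h2, h3⟩)
    · refine Or.inl ⟨h1, ⟨by linarith, fun p hp hp' => ?_, h3⟩,
        ⟨by linarith, fun p hp hp' => (h2 p hp hp').1⟩, by linarith,
        fun p hp hp' => (h2 p hp hp').2⟩
      linarith [(h2 p hp hp').1]
    · refine Or.inr ⟨h1, ⟨by linarith, fun p hp hp' => ?_, h3⟩,
        ⟨by linarith, fun p hp hp' => (h2 p hp hp').2⟩, by linarith,
        fun p hp hp' => (h2 p hp hp').1⟩
      linarith [(h2 p hp hp').2]

/-- The number with the digits `a + off`, in base `B`, where `a` runs through a list whose head is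
the least significant digit. -/
def encode (B off : ℤ) : List ℤ → ℤ
  | [] => 0
  | a :: l => encode B off l * B + (a + off)

theorem encode_nonneg {B off : ℤ} (hB : 0 ≤ B) {l : List ℤ} (h : ∀ a ∈ l, 1 ≤ a + off) :
    0 ≤ encode B off l := by
  induction l with
  | nil => exact le_rfl
  | cons a l ih =>
    have h1 := ih fun a ha => h a (List.mem_cons_of_mem _ ha)
    have h2 := h a List.mem_cons_self
    have := mul_nonneg h1 hB
    rw [encode]
    omega

theorem encode_injective {B off : ℤ} {l l' : List ℤ} (h : ∀ a ∈ l, 1 ≤ a + off ∧ a + off < B)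
    (h' : ∀ a ∈ l', 1 ≤ a + off ∧ a + off < B) (e : encode B off l = encode B off l') :
    l = l' := by
  -- a number with a nonzero digit is positive
  have pos : ∀ (a : ℤ) (l : List ℤ), (∀ b ∈ a :: l, 1 ≤ b + off ∧ b + off < B) →
      0 < encode B off (a :: l) := by
    intro a l h
    have h2 := h a List.mem_cons_self
    have h1 := encode_nonneg (show 0 ≤ B by omega)
      fun a ha => (h a (List.mem_cons_of_mem _ ha)).1
    have := mul_nonneg h1 (show 0 ≤ B by omega)
    rw [encode]
    omega
  induction l generalizing l' with
  | nil =>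
    cases l' with
    | nil => rfl
    | cons a l' =>
      have := pos a l' h'
      rw [← e, encode] at this
      omega
  | cons a l ih =>
    cases l' with
    | nil =>
      have := pos a l h
      rw [e, encode] at this
      omega
    | cons b l' =>
      have ha := h a List.mem_cons_self
      have hb := h' b List.mem_cons_self
      rw [encode, encode] at e
      have e1 : a + off = b + off := by
        have := congrArg (· % B) e
        simp only [Int.mul_add_emod_self_right] at this
        rwa [Int.emod_eq_of_lt (by omega) ha.2, Int.emod_eq_of_lt (by omega) hb.2] at this
      have e2 : encode B off l = encode B off l' := by
        rw [e1] at e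
        exact mul_right_cancel₀ (show B ≠ 0 by omega) (by linarith)
      rw [ih (fun a ha => h a (List.mem_cons_of_mem _ ha))
        (fun a ha => h' a (List.mem_cons_of_mem _ ha)) e2, show a = b by omega]

/-- A state of the search: on the time series `cur`, a matching has been built for a curve with
`len` vertices, which has the code `key` and the last vertex `v`. The search has moved on to
the point of height `h` on the edge `f`, and `mx`, `mn`, `D`, `R` describe the vertices that it
has met since it matched the last vertex. -/
structure SearchState where
  cur : ℕ
  f : ℕ
  v : ℝ
  h : ℝ
  mx : ℝ
  mn : ℝ
  D : ℝ
  R : ℝ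
  len : ℕ
  key : ℤ

namespace SearchState

/-- The initial state for the time series `i`: no vertex has been matched. -/
def init (X : ℕ → ℕ → ℝ) (i : ℕ) : SearchState :=
  ⟨i, 0, X i 0, X i 0, X i 0, X i 0, 0, 0, 0, 0⟩

/-- Moving on to the next edge. -/
def advance (X : ℕ → ℕ → ℝ) (s : SearchState) : SearchState :=
  { s with
    f := s.f + 1
    h := X s.cur (s.f + 1)
    mx := max s.mx (X s.cur (s.f + 1))
    mn := min s.mn (X s.cur (s.f + 1))
    D := max s.D (s.mx - X s.cur (s.f + 1))
    R := max s.R (X s.cur (s.f + 1) - s.mn) }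

/-- The candidates for the next vertex: the integers within `K` of the rounded ends of the current
edge. -/
noncomputable def cand (X : ℕ → ℕ → ℝ) (K : ℕ) (s : SearchState) (t : ℕ) : ℤ :=
  if t < 2 * K + 1 then ⌊X s.cur s.f⌋ - K + t else ⌊X s.cur (s.f + 1)⌋ - K + (t - (2 * K + 1))

/-- The vertex `w` can be matched to a point of the current edge. -/
def CanEmit (X : ℕ → ℕ → ℝ) (ρ : ℝ) (s : SearchState) (w : ℝ) : Prop :=
  (1 ≤ s.len ∨ (X s.cur s.f - ρ ≤ w ∧ w ≤ X s.cur s.f + ρ)) ∧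
  SegTest ρ s.v w s.mx s.mn s.D s.R ∧
  ((X s.cur s.f ≤ X s.cur (s.f + 1) ∧ s.h ≤ w + ρ ∧ w - ρ ≤ X s.cur (s.f + 1)) ∨
    (X s.cur (s.f + 1) < X s.cur s.f ∧ w - ρ ≤ s.h ∧ X s.cur (s.f + 1) ≤ w + ρ))

open Classical in
/-- The state after matching the vertex `w`. -/
noncomputable def emit (X : ℕ → ℕ → ℝ) (ρ : ℝ) (B off : ℤ) (s : SearchState) (w : ℤ) :
    SearchState :=
  ⟨s.cur, s.f, w, if X s.cur s.f ≤ X s.cur (s.f + 1) then max s.h (w - ρ) else min s.h (w + ρ),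
    w, w, 0, 0, s.len + 1, s.key * B + (w + off)⟩

/-- The matching is complete. -/
def Accepts (m : ℕ) (ρ : ℝ) (s : SearchState) : Prop :=
  m ≤ s.f + 1 ∧ 1 ≤ s.len ∧ s.mx ≤ s.v + ρ ∧ s.v - ρ ≤ s.mn

/-- The vertices that a search on the time series `X` with `m` vertices may match. -/
def Allowed (m : ℕ) (B off : ℤ) (f : ℕ) (a : ℤ) : Prop :=
  f < m ∧ 1 ≤ a + off ∧ a + off < B

/-- The state describes a matching. -/
structure Valid (X : ℕ → ℕ → ℝ) (n m k : ℕ) (ρ : ℝ) (B off : ℤ) (s : SearchState) : Prop where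
  cur_lt : s.cur < n
  f_lt : s.f < m
  len_le : s.len ≤ k
  of_len_eq_zero : s.len = 0 → s = init X s.cur
  of_len_pos : 1 ≤ s.len → ∃ a l f₀ h₀, (a :: l).length = s.len ∧ s.key = encode B off (a :: l) ∧
    s.v = (a : ℤ) ∧ f₀ ≤ s.f ∧ s.h = (if s.f = f₀ then h₀ else X s.cur s.f) ∧
    VReach (fun z : ℤ => (z : ℝ)) (X s.cur) ρ (Allowed m B off) (a :: l) f₀ h₀ ∧
    IsStats (X s.cur) s.v f₀ s.f s.mx s.mn s.D s.R

variable {X : ℕ → ℕ → ℝ} {n m k K : ℕ} {ρ : ℝ} {B off : ℤ} {s : SearchState}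

theorem valid_init {i : ℕ} (hi : i < n) (hm : 0 < m) : Valid X n m k ρ B off (init X i) where
  cur_lt := hi
  f_lt := hm
  len_le := Nat.zero_le _
  of_len_eq_zero _ := rfl
  of_len_pos h := by simp [init] at h

theorem Valid.advance (H : Valid X n m k ρ B off s) (hf : s.f + 1 < m) (hl : 1 ≤ s.len) :
    Valid X n m k ρ B off (s.advance X) where
  cur_lt := H.cur_lt
  f_lt := hf
  len_le := H.len_le
  of_len_eq_zero h := by simp only [SearchState.advance] at h; omega
  of_len_pos _ := by
    obtain ⟨a, l, f₀, h₀, h1, h2, h3, h4, h5, h6, h7⟩ := H.of_len_pos hl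
    exact ⟨a, l, f₀, h₀, h1, h2, h3, by simp only [SearchState.advance]; omega, by
      exact (if_neg (show ¬ s.f + 1 = f₀ by omega)).symm, h6, h7.succ h4⟩

theorem emit_h_edgeCond {w : ℤ} (h : s.CanEmit X ρ w) :
    EdgeCond ρ (X s.cur s.f) (X s.cur (s.f + 1)) s.h w (s.emit X ρ B off w).h := by
  rcases h.2.2 with ⟨h1, h2, h3⟩ | ⟨h1, h2, h3⟩
  · exact Or.inl ⟨h1, h2, h3, by simp [emit, h1]⟩
  · exact Or.inr ⟨h1, h2, h3, by simp [emit, not_le.2 h1]⟩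

theorem Valid.emit (hρ : 0 ≤ ρ) (H : Valid X n m k ρ B off s) (hl : s.len < k) {w : ℤ}
    (hw : 1 ≤ w + off ∧ w + off < B) (h : s.CanEmit X ρ w) :
    Valid X n m k ρ B off (s.emit X ρ B off w) where
  cur_lt := H.cur_lt
  f_lt := H.f_lt
  len_le := hl
  of_len_eq_zero h := by simp [SearchState.emit] at h
  of_len_pos _ := by
    have hE := emit_h_edgeCond (B := B) (off := off) h
    rcases Nat.eq_zero_or_pos s.len with h0 | h0
    · have hs := H.of_len_eq_zero h0
      have hf : s.f = 0 := by rw [hs]; rfl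
      have hh : s.h = X s.cur 0 := by rw [hs]; rfl
      have hkey : s.key = 0 := by rw [hs]; rfl
      have hw' := h.1.resolve_left (by omega)
      rw [hf] at hw'
      refine ⟨w, [], 0, X s.cur 0, by simp [SearchState.emit, h0],
        by simp [SearchState.emit, hkey, encode], rfl, Nat.zero_le _, ?_,
        .init (show |X s.cur 0 - (w : ℝ)| ≤ ρ from abs_le.2 ⟨by linarith, by linarith⟩) ⟨?_, hw⟩,
        IsStats.refl _ _ (by simp [SearchState.emit, hf])⟩
      · rw [if_pos (by simp [SearchState.emit, hf])]
        rcases hE with ⟨_, _, _, e⟩ | ⟨_, _, _, e⟩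
        · rw [e, hh, max_eq_left (by linarith)]
        · rw [e, hh, min_eq_left (by linarith)]
      · have := H.f_lt; omega
    · obtain ⟨a, l, f₀, h₀, h1, h2, h3, h4, h5, h6, h7⟩ := H.of_len_pos h0
      refine ⟨w, a :: l, s.f, (s.emit X ρ B off w).h, by simp [SearchState.emit, ← h1], ?_, rfl,
        le_rfl, by simp [SearchState.emit], ?_, IsStats.refl _ _ le_rfl⟩
      · simp only [SearchState.emit]
        rw [h2, encode.eq_2 B off w]
      · refine .next h6 h4 ?_ ?_ ⟨H.f_lt, hw⟩
        · rw [← h3]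
          exact (h7.segTest_iff hρ).1 h.2.1
        · rw [h5] at hE
          exact hE

theorem Valid.abs_sub_le (H : Valid X n m k ρ B off s) (ha : s.Accepts m ρ) :
    ∃ a l f h, s.key = encode B off (a :: l) ∧
      VReach (fun z : ℤ => (z : ℝ)) (X s.cur) ρ (Allowed m B off) (a :: l) f h ∧
      ∀ p, f < p → p < m → |X s.cur p - a| ≤ ρ := by
  obtain ⟨a, l, f₀, h₀, h1, h2, h3, h4, h5, h6, h7⟩ := H.of_len_pos ha.2.1
  refine ⟨a, l, f₀, h₀, h2, h6, fun p hp hp' => ?_⟩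
  have e1 := ((h7.mx_le_iff _).1 ha.2.2.1).2 p hp (by have := ha.1; omega)
  have e2 := ((h7.le_mn_iff _).1 ha.2.2.2).2 p hp (by have := ha.1; omega)
  rw [h3] at e1 e2
  rw [abs_le]
  constructor <;> linarith

theorem exists_cand {w : ℤ} {δ : ℝ} (hK : δ + 1 ≤ K) (h : NearEdge (X s.cur) m δ s.f w) :
    ∃ t < 2 * (2 * K + 1), s.cand X K t = w := by
  have aux : ∀ x : ℝ, |(w : ℝ) - x| ≤ δ → ∃ t < 2 * K + 1, ⌊x⌋ - K + (t : ℕ) = w := by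
    intro x hx
    have h1 := abs_le.1 hx
    have i1 := Int.floor_le x
    have i2 := Int.lt_floor_add_one x
    have j1 : (⌊x⌋ : ℝ) - K ≤ w := by linarith
    have j2 : (w : ℝ) ≤ ⌊x⌋ + K := by linarith
    have j1' : ⌊x⌋ - (K : ℤ) ≤ w := by exact_mod_cast j1
    have j2' : w ≤ ⌊x⌋ + (K : ℤ) := by exact_mod_cast j2
    exact ⟨(w - (⌊x⌋ - K)).toNat, by omega, by omega⟩
  rcases h.2 with h | h
  · obtain ⟨t, ht, e⟩ := aux _ h
    exact ⟨t, by omega, by rw [cand, if_pos ht]; exact e⟩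
  · obtain ⟨t, ht, e⟩ := aux _ h
    refine ⟨t + (2 * K + 1), by omega, ?_⟩
    rw [cand, if_neg (by omega)]
    push_cast
    linarith

/-- A set of states that contains the initial states and all the states that can be reached from
its elements contains a state for every matching with vertices close to those of the time
series. -/
theorem exists_state_of_vreach {Q : Set SearchState} (hρ : 0 ≤ ρ) {δ : ℝ} (hδ : δ + 1 ≤ K)
    (hinit : ∀ i < n, init X i ∈ Q)
    (hadv : ∀ s ∈ Q, s.f + 1 < m → 1 ≤ s.len → s.advance X ∈ Q)
    (hemit : ∀ s ∈ Q, s.len < k → ∀ t < 2 * (2 * K + 1), s.CanEmit X ρ (s.cand X K t) →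
      s.emit X ρ B off (s.cand X K t) ∈ Q) {i : ℕ} (hi : i < n) {a : ℤ} {l : List ℤ} {f : ℕ} {h : ℝ}
    (hv : VReach (fun z : ℤ => (z : ℝ)) (X i) ρ (NearEdge (X i) m δ) (a :: l) f h)
    (hk : (a :: l).length ≤ k) :
    ∀ f', f ≤ f' → f' < m → ∃ s ∈ Q, s.cur = i ∧ s.f = f' ∧ s.v = a ∧
      s.len = (a :: l).length ∧ s.key = encode B off (a :: l) ∧
      s.h = (if f' = f then h else X i f') ∧ IsStats (X i) a f f' s.mx s.mn s.D s.R := by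
  -- it suffices to reach the state right after matching the last vertex
  have adv : ∀ (a : ℤ) (l : List ℤ) (f : ℕ) (h : ℝ),
      (∃ s ∈ Q, s.cur = i ∧ s.f = f ∧ s.v = a ∧ s.len = (a :: l).length ∧
        s.key = encode B off (a :: l) ∧ s.h = h ∧ IsStats (X i) a f f s.mx s.mn s.D s.R) →
      ∀ f', f ≤ f' → f' < m → ∃ s ∈ Q, s.cur = i ∧ s.f = f' ∧ s.v = a ∧
        s.len = (a :: l).length ∧ s.key = encode B off (a :: l) ∧
        s.h = (if f' = f then h else X i f') ∧ IsStats (X i) a f f' s.mx s.mn s.D s.R := by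
    intro a l f h hs f' hf'
    induction f', hf' using Nat.le_induction with
    | base => intro _; simpa using hs
    | succ g hg ih =>
      intro hgm
      obtain ⟨s, hsQ, h1, h2, h3, h4, h5, h6, h7⟩ := ih (by omega)
      subst h2
      refine ⟨s.advance X, hadv s hsQ hgm (by simp [h4]), h1, rfl, h3, h4, h5, ?_, ?_⟩
      · rw [if_neg (by omega)]
        simp only [SearchState.advance]
        rw [h1]
      · have := h7.succ hg
        rw [← h1] at this ⊢
        exact this
  suffices main : ∀ (L : List ℤ) (f : ℕ) (h : ℝ),
      VReach (fun z : ℤ => (z : ℝ)) (X i) ρ (NearEdge (X i) m δ) L f h → L.length ≤ k →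
      ∃ a l, L = a :: l ∧ ∃ s ∈ Q, s.cur = i ∧ s.f = f ∧ s.v = a ∧ s.len = (a :: l).length ∧
        s.key = encode B off (a :: l) ∧ s.h = h ∧ IsStats (X i) a f f s.mx s.mn s.D s.R by
    obtain ⟨a', l', e, hs⟩ := main _ _ _ hv hk
    rw [List.cons.injEq] at e
    rw [e.1, e.2]
    exact adv a' l' f h hs
  intro L f h hL
  induction hL with
  | @init a h1 h2 =>
    intro hk
    refine ⟨a, [], rfl, ?_⟩
    have h1' := abs_le.1 h1
    obtain ⟨t, ht, et⟩ := exists_cand (X := X) (s := init X i) hδ h2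
    have hcan : (init X i).CanEmit X ρ ((init X i).cand X K t) := by
      rw [et]
      refine ⟨Or.inr ?_, ?_, ?_⟩
      · simp only [init]; constructor <;> linarith
      · simp only [SegTest, init]
        rcases le_total (X i 0) a with h | h
        · exact Or.inl ⟨h, by linarith, by linarith, by linarith⟩
        · exact Or.inr ⟨h, by linarith, by linarith, by linarith⟩
      · simp only [init]
        rcases le_or_gt (X i 0) (X i (0 + 1)) with h | h
        · exact Or.inl ⟨h, by linarith, by linarith⟩
        · exact Or.inr ⟨h, by linarith, by linarith⟩
    refine ⟨_, hemit _ (hinit i hi)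
      (show 0 < k by simpa [Nat.one_le_iff_ne_zero, Nat.pos_iff_ne_zero] using hk) t ht hcan, rfl, rfl,
      ?_, ?_, ?_, ?_, ?_⟩
    · rw [et]; rfl
    · rfl
    · rw [et]; simp [SearchState.emit, init, encode]
    · rcases emit_h_edgeCond (B := B) (off := off) hcan with ⟨_, _, _, e⟩ | ⟨_, _, _, e⟩
      · rw [e, et]
        exact max_eq_left (by simp only [init]; linarith)
      · rw [e, et]
        exact min_eq_left (by simp only [init]; linarith)
    · rw [et]
      exact IsStats.refl _ _ le_rfl
  | @next a b l f₀ f h h' _ hff hseg hedge hN ih =>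
    intro hk
    refine ⟨b, a :: l, rfl, ?_⟩
    obtain ⟨a', l', e, hs⟩ := ih (by simp at hk ⊢; omega)
    rw [List.cons.injEq] at e
    obtain ⟨e1, e2⟩ := e
    subst e1 e2
    obtain ⟨s, hsQ, h1, h2, h3, h4, h5, h6, h7⟩ := adv _ _ _ _ hs f hff hN.1
    subst h1
    subst h2
    obtain ⟨t, ht, et⟩ := exists_cand (X := X) (s := s) hδ hN
    have hcan : s.CanEmit X ρ (s.cand X K t) := by
      rw [et]
      refine ⟨Or.inl (by simp [h4]), ?_, ?_⟩
      · rw [h3]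
        exact (h7.segTest_iff hρ).2 hseg
      · rw [h6]
        rcases hedge with ⟨i1, i2, i3, _⟩ | ⟨i1, i2, i3, _⟩
        · exact Or.inl ⟨i1, i2, i3⟩
        · exact Or.inr ⟨i1, i2, i3⟩
    refine ⟨_, hemit _ hsQ (by simp [h4] at hk ⊢; omega) t ht hcan, rfl, rfl, ?_, ?_, ?_, ?_, ?_⟩
    · rw [et]; rfl
    · simp [SearchState.emit, h4]
    · rw [et]
      simp only [SearchState.emit]
      rw [h5, encode.eq_2 B off b]
    · have hE := emit_h_edgeCond (B := B) (off := off) hcan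
      rw [h6] at hE
      rw [et] at hE ⊢
      rcases hedge with ⟨i1, _, _, i2⟩ | ⟨i1, _, _, i2⟩ <;>
        rcases hE with ⟨j1, _, _, j2⟩ | ⟨j1, _, _, j2⟩
      · rw [i2, j2]
      · linarith
      · linarith
      · rw [i2, j2]
    · rw [et]
      exact IsStats.refl _ _ le_rfl

end SearchState

/-! ### Reasoning about programs -/

namespace RealRAM

instance : Add Expr := ⟨Expr.add⟩
instance : Sub Expr := ⟨Expr.sub⟩
instance : Mul Expr := ⟨Expr.mul⟩
instance : Div Expr := ⟨Expr.div⟩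
instance (z : ℕ) : OfNat Expr z := ⟨Expr.const z⟩

section Eval

variable (s : State) (e₁ e₂ : Expr)

@[simp] theorem Expr.eval_hadd : (e₁ + e₂).eval s = e₁.eval s + e₂.eval s := rfl
@[simp] theorem Expr.eval_hsub : (e₁ - e₂).eval s = e₁.eval s - e₂.eval s := rfl
@[simp] theorem Expr.eval_hmul : (e₁ * e₂).eval s = e₁.eval s * e₂.eval s := rfl
@[simp] theorem Expr.eval_hdiv : (e₁ / e₂).eval s = e₁.eval s / e₂.eval s := rfl
@[simp] theorem Expr.eval_ofNat (z : ℕ) [z.AtLeastTwo] :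
    (ofNat(z) : Expr).eval s = ofNat(z) :=
  show (((z : ℕ) : ℤ) : ℝ) = _ by rw [Int.cast_natCast]; rfl
@[simp] theorem Expr.eval_zero : (0 : Expr).eval s = 0 := show (((0 : ℕ) : ℤ) : ℝ) = 0 by simp
@[simp] theorem Expr.eval_one : (1 : Expr).eval s = 1 := show (((1 : ℕ) : ℤ) : ℝ) = 1 by simp
@[simp] theorem Expr.eval_reg (x : ℕ) : (Expr.reg x).eval s = s.reg x := rfl
@[simp] theorem Expr.eval_load (a : ℕ) : (Expr.load a e₁).eval s = s.arr a ⌊e₁.eval s⌋₊ := rfl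
@[simp] theorem Expr.eval_floor : (Expr.floor e₁).eval s = ((⌊e₁.eval s⌋ : ℤ) : ℝ) := rfl

end Eval

/-- The comparison `<`. -/
def Test.lt (e₁ e₂ : Expr) : Test := .not (.le e₂ e₁)

/-- Disjunction. -/
def Test.or (b₁ b₂ : Test) : Test := .not (.and (.not b₁) (.not b₂))

section Holds

variable (s : State)

@[simp] theorem Test.holds_le (e₁ e₂ : Expr) : (Test.le e₁ e₂).holds s ↔ e₁.eval s ≤ e₂.eval s :=
  Iff.rfl
@[simp] theorem Test.holds_not (b : Test) : b.not.holds s ↔ ¬ b.holds s := Iff.rfl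
@[simp] theorem Test.holds_and (b₁ b₂ : Test) :
    (b₁.and b₂).holds s ↔ b₁.holds s ∧ b₂.holds s := Iff.rfl
@[simp] theorem Test.holds_lt (e₁ e₂ : Expr) : (Test.lt e₁ e₂).holds s ↔ e₁.eval s < e₂.eval s := by
  simp [Test.lt]
@[simp] theorem Test.holds_or (b₁ b₂ : Test) :
    (b₁.or b₂).holds s ↔ b₁.holds s ∨ b₂.holds s := by
  simp only [Test.or, Test.holds_not, Test.holds_and]
  tauto

theorem Test.cost_pos (b : Test) : 0 < b.cost := by
  cases b <;> simp [Test.cost]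

end Holds

@[simp] theorem State.setReg_reg (s : State) (x y : ℕ) (v : ℝ) :
    (s.setReg x v).reg y = if y = x then v else s.reg y := by
  simp [State.setReg, Function.update_apply]
@[simp] theorem State.setReg_arr (s : State) (x : ℕ) (v : ℝ) : (s.setReg x v).arr = s.arr := rfl
@[simp] theorem State.setCell_reg (s : State) (a i : ℕ) (v : ℝ) : (s.setCell a i v).reg = s.reg :=
  rfl
@[simp] theorem State.setCell_arr (s : State) (a i b : ℕ) (v : ℝ) :
    (s.setCell a i v).arr b = if b = a then Function.update (s.arr a) i v else s.arr b := by
  simp only [State.setCell, Function.update_apply]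
@[simp] theorem State.draw_reg (s : State) (x y : ℕ) :
    (s.draw x).reg y = if y = x then (s.tape 0 : ℝ) else s.reg y := by
  simp [State.draw, Function.update_apply]
@[simp] theorem State.draw_tape (s : State) (x i : ℕ) : (s.draw x).tape i = s.tape (i + 1) := rfl

infixr:60 " ;; " => Prog.seq
infix:62 " ≔ " => Prog.assign

/-- Executions are deterministic. -/
theorem Exec.deterministic {c : Prog} {s s₁ s₂ : State} {t₁ t₂ : ℕ} (h₁ : Exec c s t₁ s₁)
    (h₂ : Exec c s t₂ s₂) : t₁ = t₂ ∧ s₁ = s₂ := by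
  induction h₁ generalizing t₂ s₂ with
  | skip | assign | store | rand => cases h₂; exact ⟨rfl, rfl⟩
  | seq _ _ ih₁ ih₂ =>
    cases h₂ with
    | seq a b =>
      obtain ⟨rfl, rfl⟩ := ih₁ a
      obtain ⟨rfl, rfl⟩ := ih₂ b
      exact ⟨rfl, rfl⟩
  | iteTrue hb _ ih =>
    cases h₂ with
    | iteTrue _ a =>
      obtain ⟨rfl, rfl⟩ := ih a
      exact ⟨rfl, rfl⟩
    | iteFalse hb' _ => exact absurd hb hb'
  | iteFalse hb _ ih =>
    cases h₂ with
    | iteTrue hb' _ => exact absurd hb' hb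
    | iteFalse _ a =>
      obtain ⟨rfl, rfl⟩ := ih a
      exact ⟨rfl, rfl⟩
  | whileTrue hb _ _ ih₁ ih₂ =>
    cases h₂ with
    | whileTrue _ a b =>
      obtain ⟨rfl, rfl⟩ := ih₁ a
      obtain ⟨rfl, rfl⟩ := ih₂ b
      exact ⟨rfl, rfl⟩
    | whileFalse hb' => exact absurd hb hb'
  | whileFalse hb =>
    cases h₂ with
    | whileTrue hb' _ _ => exact absurd hb' hb
    | whileFalse _ => exact ⟨rfl, rfl⟩

/-- The registers that a program may write to. -/
def Prog.writesReg : Prog → List ℕ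
  | .skip => []
  | .assign x _ => [x]
  | .store _ _ _ => []
  | .rand x => [x]
  | .seq c₁ c₂ => c₁.writesReg ++ c₂.writesReg
  | .ite _ c₁ c₂ => c₁.writesReg ++ c₂.writesReg
  | .while _ c => c.writesReg

/-- The arrays that a program may write to. -/
def Prog.writesArr : Prog → List ℕ
  | .skip => []
  | .assign _ _ => []
  | .store a _ _ => [a]
  | .rand _ => []
  | .seq c₁ c₂ => c₁.writesArr ++ c₂.writesArr
  | .ite _ c₁ c₂ => c₁.writesArr ++ c₂.writesArr
  | .while _ c => c.writesArr

/-- The program draws no random numbers. -/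
def Prog.NoRand : Prog → Prop
  | .skip => True
  | .assign _ _ => True
  | .store _ _ _ => True
  | .rand _ => False
  | .seq c₁ c₂ => c₁.NoRand ∧ c₂.NoRand
  | .ite _ c₁ c₂ => c₁.NoRand ∧ c₂.NoRand
  | .while _ c => c.NoRand

theorem Exec.reg_eq {c : Prog} {s s' : State} {t : ℕ} (h : Exec c s t s') {x : ℕ}
    (hx : x ∉ c.writesReg) : s'.reg x = s.reg x := by
  induction h with
  | skip | store | whileFalse => rfl
  | assign s y e | rand s y =>
    have : x ≠ y := by simpa [Prog.writesReg] using hx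
    simp [this]
  | seq _ _ ih₁ ih₂ =>
    simp only [Prog.writesReg, List.mem_append, not_or] at hx
    rw [ih₂ hx.2, ih₁ hx.1]
  | iteTrue _ _ ih =>
    simp only [Prog.writesReg, List.mem_append, not_or] at hx
    exact ih hx.1
  | iteFalse _ _ ih =>
    simp only [Prog.writesReg, List.mem_append, not_or] at hx
    exact ih hx.2
  | whileTrue _ _ _ ih₁ ih₂ => rw [ih₂ hx, ih₁ hx]

theorem Exec.arr_eq {c : Prog} {s s' : State} {t : ℕ} (h : Exec c s t s') {a : ℕ}
    (ha : a ∉ c.writesArr) : s'.arr a = s.arr a := by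
  induction h with
  | skip | assign | rand | whileFalse => rfl
  | store s b i e =>
    have : a ≠ b := by simpa [Prog.writesArr] using ha
    simp [this]
  | seq _ _ ih₁ ih₂ =>
    simp only [Prog.writesArr, List.mem_append, not_or] at ha
    rw [ih₂ ha.2, ih₁ ha.1]
  | iteTrue _ _ ih =>
    simp only [Prog.writesArr, List.mem_append, not_or] at ha
    exact ih ha.1
  | iteFalse _ _ ih =>
    simp only [Prog.writesArr, List.mem_append, not_or] at ha
    exact ih ha.2
  | whileTrue _ _ _ ih₁ ih₂ => rw [ih₂ ha, ih₁ ha]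

theorem Exec.tape_eq {c : Prog} {s s' : State} {t : ℕ} (h : Exec c s t s')
    (hc : c.NoRand) : s'.tape = s.tape := by
  induction h with
  | skip | assign | store | whileFalse => rfl
  | rand => exact hc.elim
  | seq _ _ ih₁ ih₂ => rw [ih₂ hc.2, ih₁ hc.1]
  | iteTrue _ _ ih => exact ih hc.1
  | iteFalse _ _ ih => exact ih hc.2
  | whileTrue _ _ _ ih₁ ih₂ => rw [ih₂ hc, ih₁ hc]

/-- The program has no loops. -/
def Prog.LoopFree : Prog → Prop
  | .skip => True
  | .assign _ _ => True
  | .store _ _ _ => True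
  | .rand _ => True
  | .seq c₁ c₂ => c₁.LoopFree ∧ c₂.LoopFree
  | .ite _ c₁ c₂ => c₁.LoopFree ∧ c₂.LoopFree
  | .while _ _ => False

open Classical in
/-- The final state of a loop-free program (and the state itself for a loop). -/
noncomputable def Prog.result : Prog → State → State
  | .skip, s => s
  | .assign x e, s => s.setReg x (e.eval s)
  | .store a i e, s => s.setCell a ⌊i.eval s⌋₊ (e.eval s)
  | .rand x, s => s.draw x
  | .seq c₁ c₂, s => c₂.result (c₁.result s)
  | .ite b c₁ c₂, s => if b.holds s then c₁.result s else c₂.result s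
  | .while _ _, s => s

/-- A bound for the running time of a loop-free program. -/
def Prog.maxCost : Prog → ℕ
  | .skip => 1
  | .assign _ e => e.cost + 1
  | .store _ i e => i.cost + e.cost + 1
  | .rand _ => 1
  | .seq c₁ c₂ => c₁.maxCost + c₂.maxCost
  | .ite b c₁ c₂ => b.cost + (c₁.maxCost + c₂.maxCost)
  | .while _ _ => 0

theorem Prog.LoopFree.exec {c : Prog} (h : c.LoopFree) (s : State) :
    ∃ t ≤ c.maxCost, Exec c s t (c.result s) := by
  induction c generalizing s with
  | skip => exact ⟨_, le_rfl, .skip s⟩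
  | assign x e => exact ⟨_, le_rfl, .assign s x e⟩
  | store a i e => exact ⟨_, le_rfl, .store s a i e⟩
  | rand x => exact ⟨_, le_rfl, .rand s x⟩
  | seq c₁ c₂ ih₁ ih₂ =>
    obtain ⟨t₁, h₁, e₁⟩ := ih₁ h.1 s
    obtain ⟨t₂, h₂, e₂⟩ := ih₂ h.2 (c₁.result s)
    exact ⟨_, Nat.add_le_add h₁ h₂, .seq e₁ e₂⟩
  | ite b c₁ c₂ ih₁ ih₂ =>
    by_cases hb : b.holds s
    · obtain ⟨t, ht, e⟩ := ih₁ h.1 s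
      refine ⟨_, ?_, by rw [Prog.result, if_pos hb]; exact .iteTrue hb e⟩
      simp only [Prog.maxCost]; omega
    · obtain ⟨t, ht, e⟩ := ih₂ h.2 s
      refine ⟨_, ?_, by rw [Prog.result, if_neg hb]; exact .iteFalse hb e⟩
      simp only [Prog.maxCost]; omega
  | _ => exact h.elim

/-- A loop terminates if every iteration decreases a potential by at least the time it takes. -/
theorem exec_while {b : Test} {c : Prog} (I : ℕ → State → Prop)
    (h : ∀ φ s, I φ s → b.holds s →
      ∃ t s' φ', Exec c s t s' ∧ I φ' s' ∧ b.cost + t + φ' ≤ φ) (φ : ℕ) (s : State) (hs : I φ s) :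
    ∃ t s' φ', Exec (.while b c) s t s' ∧ t ≤ φ + b.cost ∧ I φ' s' ∧ ¬ b.holds s' := by
  induction φ using Nat.strong_induction_on generalizing s with
  | _ φ ih =>
    by_cases hb : b.holds s
    · obtain ⟨t, s', φ', h1, h2, h3⟩ := h φ s hs hb
      have := b.cost_pos
      obtain ⟨t', s'', φ'', i1, i2, i3, i4⟩ := ih φ' (by omega) s' h2
      exact ⟨_, s'', φ'', .whileTrue hb h1 i1, by omega, i3, i4⟩
    · exact ⟨_, s, φ, .whileFalse hb, by omega, hs, hb⟩

/-- A loop whose number of iterations is known in advance. -/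
theorem exec_for {b : Test} {c : Prog} (N T : ℕ) (I : ℕ → State → Prop)
    (hb : ∀ i s, i ≤ N → I i s → (b.holds s ↔ i < N))
    (h : ∀ i s, i < N → I i s → ∃ t s', t ≤ T ∧ Exec c s t s' ∧ I (i + 1) s') (s : State)
    (hs : I 0 s) :
    ∃ t s', t ≤ N * (T + b.cost) + b.cost ∧ Exec (.while b c) s t s' ∧ I N s' := by
  obtain ⟨t, s', φ', h1, h2, ⟨i, hi, -, hI⟩, h3⟩ := exec_while (b := b) (c := c)
    (fun φ s => ∃ i ≤ N, φ = (N - i) * (T + b.cost) ∧ I i s) (by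
      rintro φ s ⟨i, hi, rfl, hI⟩ hs
      have hiN := (hb i s hi hI).1 hs
      obtain ⟨t, s', ht, he, hI'⟩ := h i s hiN hI
      refine ⟨t, s', _, he, ⟨i + 1, hiN, rfl, hI'⟩, ?_⟩
      obtain ⟨d, rfl⟩ := Nat.exists_eq_add_of_lt hiN
      rw [show i + d + 1 - i = d + 1 by omega, show i + d + 1 - (i + 1) = d by omega]
      rw [Nat.add_mul]
      omega) (N * (T + b.cost)) s ⟨0, Nat.zero_le _, by simp, hs⟩
  refine ⟨t, s', h2, h1, ?_⟩
  have : i = N := by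
    by_contra hne
    exact h3 ((hb i s' hi hI).2 (by omega))
  rwa [this] at hI

/-- `s'` differs from `s` only in registers and arrays that `c` may write to. -/
def Frame (c : Prog) (s s' : State) : Prop :=
  (∀ x ∉ c.writesReg, s'.reg x = s.reg x) ∧ ∀ a ∉ c.writesArr, s'.arr a = s.arr a

theorem Frame.refl (c : Prog) (s : State) : Frame c s s := ⟨fun _ _ => rfl, fun _ _ => rfl⟩

theorem Frame.trans {c : Prog} {s₁ s₂ s₃ : State} (h₁ : Frame c s₁ s₂) (h₂ : Frame c s₂ s₃) :
    Frame c s₁ s₃ :=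
  ⟨fun x hx => (h₂.1 x hx).trans (h₁.1 x hx), fun a ha => (h₂.2 a ha).trans (h₁.2 a ha)⟩

theorem Exec.frame {c : Prog} {s s' : State} {t : ℕ} (h : Exec c s t s') : Frame c s s' :=
  ⟨fun _ hx => h.reg_eq hx, fun _ ha => h.arr_eq ha⟩

/-- A loop whose number of iterations is known in advance, with the frame condition made available
to the body. -/
theorem exec_for_frame {b : Test} {c : Prog} (N T : ℕ) (I : ℕ → State → Prop) (s : State)
    (hb : ∀ i s', i ≤ N → I i s' → Frame c s s' → (b.holds s' ↔ i < N))
    (h : ∀ i s', i < N → I i s' → Frame c s s' →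
      ∃ t s'', t ≤ T ∧ Exec c s' t s'' ∧ I (i + 1) s'')
    (hs : I 0 s) :
    ∃ t s', t ≤ N * (T + b.cost) + b.cost ∧ Exec (.while b c) s t s' ∧ I N s' := by
  obtain ⟨t, s', h1, h2, h3, -⟩ := exec_for (b := b) (c := c) N T
    (fun i s' => I i s' ∧ Frame c s s') (fun i s' hi h => hb i s' hi h.1 h.2)
    (by
      rintro i s' hi ⟨h1, h2⟩
      obtain ⟨t, s'', ht, he, h3⟩ := h i s' hi h1 h2
      exact ⟨t, s'', ht, he, h3, h2.trans he.frame⟩) s ⟨hs, .refl c s⟩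
  exact ⟨t, s', h1, h2, h3⟩

/-- Started in `s`, the program `c` halts after at most `T` operations in a configuration that
satisfies `P`. -/
def Runs (c : Prog) (s : State) (T : ℕ) (P : State → Prop) : Prop :=
  ∃ t s', t ≤ T ∧ Exec c s t s' ∧ P s'

section Runs

variable {c c₁ c₂ : Prog} {s : State} {T T' T₁ T₂ : ℕ} {P Q : State → Prop}

theorem Runs.mono (h : Runs c s T P) (hT : T ≤ T') (hP : ∀ s', Frame c s s' → P s' → Q s') :
    Runs c s T' Q := by
  obtain ⟨t, s', ht, he, hp⟩ := h
  exact ⟨t, s', ht.trans hT, he, hP s' he.frame hp⟩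

theorem Runs.seq (h : Runs c₁ s T₁ P)
    (h' : ∀ s', Frame c₁ s s' → P s' → Runs c₂ s' T₂ Q) : Runs (c₁ ;; c₂) s (T₁ + T₂) Q := by
  obtain ⟨t, s', ht, he, hp⟩ := h
  obtain ⟨t', s'', ht', he', hq⟩ := h' s' he.frame hp
  exact ⟨_, s'', Nat.add_le_add ht ht', .seq he he', hq⟩

theorem Runs.ite {b : Test} (h₁ : b.holds s → Runs c₁ s T Q) (h₂ : ¬ b.holds s → Runs c₂ s T Q) :
    Runs (.ite b c₁ c₂) s (b.cost + T) Q := by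
  by_cases hb : b.holds s
  · obtain ⟨t, s', ht, he, hp⟩ := h₁ hb
    exact ⟨_, s', Nat.add_le_add_left ht _, .iteTrue hb he, hp⟩
  · obtain ⟨t, s', ht, he, hp⟩ := h₂ hb
    exact ⟨_, s', Nat.add_le_add_left ht _, .iteFalse hb he, hp⟩

theorem Prog.LoopFree.runs (h : c.LoopFree) (hT : c.maxCost ≤ T) (hP : P (c.result s)) :
    Runs c s T P := by
  obtain ⟨t, ht, he⟩ := h.exec s
  exact ⟨t, _, ht.trans hT, he, hP⟩

theorem Runs.for {b : Test} (N : ℕ) (I : ℕ → State → Prop) (hs : I 0 s)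
    (hb : ∀ i s', i ≤ N → I i s' → Frame c s s' → (b.holds s' ↔ i < N))
    (h : ∀ i s', i < N → I i s' → Frame c s s' → Runs c s' T (I (i + 1))) :
    Runs (.while b c) s (N * (T + b.cost) + b.cost) (I N) :=
  exec_for_frame N T I s hb h hs

end Runs

/-- An assertion that a loop preserves still holds when the loop halts. -/
theorem Exec.while_invariant {b : Test} {c : Prog} (I : State → Prop)
    (h : ∀ s t s', I s → b.holds s → Exec c s t s' → I s') {s s' : State} {t : ℕ}
    (he : Exec (.while b c) s t s') (hs : I s) : I s' ∧ ¬ b.holds s' := by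
  generalize hw : Prog.while b c = w at he
  induction he with
  | whileTrue hb h1 h2 ih1 ih2 =>
    cases hw
    exact ih2 (h _ _ _ hs hb h1) rfl
  | whileFalse hb =>
    cases hw
    exact ⟨hs, hb⟩
  | _ => cases hw

theorem runTime_le {c : Prog} {s s' : State} {t : ℕ} (h : Exec c s t s') : runTime c s ≤ t :=
  iInf_le_of_le t (iInf_le_of_le s' (iInf_le_of_le h le_rfl))

/-- `x := max x e`. -/
def setMax (x : ℕ) (e : Expr) : Prog := .ite (.le (.reg x) e) (.assign x e) .skip

/-- `x := min x e`. -/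
def setMin (x : ℕ) (e : Expr) : Prog := .ite (.le e (.reg x)) (.assign x e) .skip

theorem State.setReg_self (s : State) (x : ℕ) : s.setReg x (s.reg x) = s := by
  simp [State.setReg]

theorem result_setMax (x : ℕ) (e : Expr) (s : State) :
    (setMax x e).result s = s.setReg x (max (s.reg x) (e.eval s)) := by
  simp only [setMax, Prog.result, Test.holds_le, Expr.eval_reg]
  split_ifs with h
  · rw [max_eq_right h]
  · rw [max_eq_left (not_le.1 h).le, State.setReg_self]

theorem result_setMin (x : ℕ) (e : Expr) (s : State) :
    (setMin x e).result s = s.setReg x (min (s.reg x) (e.eval s)) := by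
  simp only [setMin, Prog.result, Test.holds_le, Expr.eval_reg]
  split_ifs with h
  · rw [min_eq_right h]
  · rw [min_eq_left (not_le.1 h).le, State.setReg_self]

end RealRAM

/-! ### A static dictionary in one real number -/

/-- The digit of `W` at the position `u` in base `b`. -/
def digit (b W : ℤ) (u : ℕ) : ℤ := W / b ^ u % b

theorem digit_nonneg {b : ℤ} (hb : 0 < b) (W : ℤ) (u : ℕ) : 0 ≤ digit b W u :=
  Int.emod_nonneg _ hb.ne'

theorem digit_zero (b : ℤ) (u : ℕ) : digit b 0 u = 0 := by simp [digit]

theorem digit_add_mul_pow {b W d : ℤ} (hd : 0 ≤ d) (hdb : d < b) {v : ℕ} (hv : digit b W v = 0)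
    (u : ℕ) : digit b (W + d * b ^ v) u = if u = v then d else digit b W u := by
  have hb : 0 < b := by omega
  unfold digit at *
  split_ifs with h
  · subst h
    rw [Int.add_mul_ediv_right _ _ (pow_pos hb u).ne', Int.add_emod, hv, zero_add,
      Int.emod_emod_of_dvd _ dvd_rfl, Int.emod_eq_of_lt hd hdb]
  · rcases lt_or_gt_of_ne h with h | h
    · obtain ⟨e, rfl⟩ := Nat.exists_eq_add_of_lt h
      rw [show d * b ^ (u + e + 1) = (d * b ^ e * b) * b ^ u by ring,
        Int.add_mul_ediv_right _ _ (pow_pos hb u).ne', Int.add_mul_emod_self_right]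
    · obtain ⟨e, rfl⟩ := Nat.exists_eq_add_of_lt h
      have key : ∀ V : ℤ, V / b ^ (v + e + 1) = V / b ^ v / b / b ^ e := by
        intro V
        rw [Int.ediv_ediv_of_nonneg (pow_pos hb v).le, Int.ediv_ediv_of_nonneg
          (mul_pos (pow_pos hb v) hb).le]
        congr 1
        ring
      rw [key, key, Int.add_mul_ediv_right _ _ (pow_pos hb v).ne']
      congr 2
      obtain ⟨A, hA⟩ := Int.dvd_of_emod_eq_zero hv
      rw [hA, Int.mul_ediv_cancel_left _ hb.ne', mul_comm b A, add_comm,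
        Int.add_mul_ediv_right _ _ hb.ne', Int.ediv_eq_zero_of_lt hd hdb, zero_add]

theorem floor_intCast_div_intCast (x : ℤ) {y : ℤ} (hy : 0 < y) : ⌊(x : ℝ) / (y : ℝ)⌋ = x / y := by
  have hy' : (0 : ℝ) < y := by exact_mod_cast hy
  rw [Int.floor_eq_iff, le_div_iff₀ hy', div_lt_iff₀ hy']
  have h1 := Int.ediv_mul_le x hy.ne'
  have h2 := Int.lt_ediv_add_one_mul_self x hy
  exact ⟨by exact_mod_cast h1, by exact_mod_cast h2⟩

/-- The digits of a number can be computed with division and rounding. -/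
theorem floor_sub_mul_floor_eq_digit (W : ℤ) {b : ℤ} (hb : 0 < b) (u : ℕ) :
    (⌊(W : ℝ) / (b : ℝ) ^ u⌋ : ℝ) - b * ⌊(W : ℝ) / ((b : ℝ) ^ u * b)⌋ = digit b W u := by
  have h1 : ⌊(W : ℝ) / (b : ℝ) ^ u⌋ = W / b ^ u := by
    have := floor_intCast_div_intCast W (pow_pos hb u)
    push_cast at this
    exact this
  have h2 : ⌊(W : ℝ) / ((b : ℝ) ^ u * b)⌋ = W / b ^ u / b := by
    have := floor_intCast_div_intCast W (mul_pos (pow_pos hb u) hb)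
    push_cast at this
    rw [this, Int.ediv_ediv_of_nonneg (pow_pos hb u).le]
  rw [h1, h2, digit, Int.emod_def]
  push_cast
  ring

/-- The position of the key `x` in a table with `L * L` places, under the hash function given
by `a`. It is computed in two steps, so that it splits into a row and a column. -/
noncomputable def bucket (L : ℕ) (a : ℝ) (x : ℤ) : ℕ :=
  ⌊L * Int.fract (L * Int.fract (a * x))⌋₊ + L * ⌊L * Int.fract (a * x)⌋₊

theorem floor_mul_fract_lt {L : ℕ} (hL : 0 < L) (z : ℝ) : ⌊L * Int.fract z⌋₊ < L := by
  have hL' : (0 : ℝ) < L := by exact_mod_cast hL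
  rw [Nat.floor_lt (mul_nonneg hL'.le (Int.fract_nonneg z))]
  nlinarith [Int.fract_lt_one z]

theorem abs_sub_lt_one_of_natFloor_eq {x y : ℝ} (hx : 0 ≤ x) (hy : 0 ≤ y) (h : ⌊x⌋₊ = ⌊y⌋₊) :
    |x - y| < 1 := by
  have h1 := Nat.floor_le hx
  have h2 := Nat.lt_floor_add_one x
  have h3 := Nat.floor_le hy
  have h4 := Nat.lt_floor_add_one y
  rw [h] at h1 h2
  rw [abs_lt]
  constructor <;> linarith

theorem exists_abs_sub_lt_of_bucket_eq {L : ℕ} (hL : 0 < L) {a : ℝ} {x y : ℤ}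
    (h : bucket L a x = bucket L a y) : ∃ c : ℤ, |a * (x - y) - c| < 1 / (L : ℝ) ^ 2 := by
  have hL' : (0 : ℝ) < L := by exact_mod_cast hL
  unfold bucket at h
  have hcol : ⌊L * Int.fract (L * Int.fract (a * x))⌋₊ =
      ⌊L * Int.fract (L * Int.fract (a * y))⌋₊ := by
    have := congrArg (· % L) h
    simpa [Nat.add_mul_mod_self_left, Nat.mod_eq_of_lt (floor_mul_fract_lt hL _)] using this
  have hrow : ⌊L * Int.fract (a * x)⌋₊ = ⌊L * Int.fract (a * y)⌋₊ := by
    rw [hcol] at h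
    exact Nat.eq_of_mul_eq_mul_left hL (Nat.add_left_cancel h)
  have hx0 := mul_nonneg hL'.le (Int.fract_nonneg (a * x))
  have hy0 := mul_nonneg hL'.le (Int.fract_nonneg (a * y))
  have h1 := abs_sub_lt_one_of_natFloor_eq (mul_nonneg hL'.le (Int.fract_nonneg _))
    (mul_nonneg hL'.le (Int.fract_nonneg _)) hcol
  have hrow' : ⌊L * Int.fract (a * x)⌋ = ⌊L * Int.fract (a * y)⌋ := by
    have e1 := Int.natCast_floor_eq_floor hx0
    have e2 := Int.natCast_floor_eq_floor hy0
    rw [← e1, ← e2, hrow]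
  refine ⟨⌊a * x⌋ - ⌊a * y⌋, ?_⟩
  have f1 := Int.self_sub_floor (L * Int.fract (a * x))
  rw [hrow'] at f1
  rw [← mul_sub, ← f1, ← Int.self_sub_floor (L * Int.fract (a * y))] at h1
  rw [lt_div_iff₀ (by positivity)]
  have e : (a * (x - y) - ((⌊a * x⌋ - ⌊a * y⌋ : ℤ) : ℝ)) * (L : ℝ) ^ 2 =
      L * (L * Int.fract (a * x) - ⌊L * Int.fract (a * y)⌋ -
        (L * Int.fract (a * y) - ⌊L * Int.fract (a * y)⌋)) := by
    rw [Int.fract, Int.fract]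
    push_cast
    ring
  rw [← abs_of_pos (show (0 : ℝ) < (L : ℝ) ^ 2 by positivity), ← abs_mul, e]
  exact h1

/-- The entries of the table `W` in base `b`. An entry `d` has the key `d / N`; the table `W` holds
entries from `E` at the places of their keys, and, unless `fail`, an entry for every key
from `E`. -/
structure IsTable (N b : ℤ) (L : ℕ) (a : ℝ) (E : Set ℤ) (W : ℤ) (fail : Prop) : Prop where
  digit_mem : ∀ u, digit b W u = 0 ∨ digit b W u ∈ E ∧ bucket L a (digit b W u / N) = u
  exists_digit : ¬ fail → ∀ d ∈ E, digit b W (bucket L a (d / N)) ≠ 0 ∧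
    digit b W (bucket L a (d / N)) / N = d / N
  not_fail : Set.InjOn (bucket L a) ((· / N) '' E) → ¬ fail

theorem isTable_empty (N b : ℤ) (L : ℕ) (a : ℝ) : IsTable N b L a ∅ 0 False where
  digit_mem u := Or.inl (digit_zero b u)
  exists_digit _ _ hd := hd.elim
  not_fail _ := not_false

section Insert

variable {N b : ℤ} {L : ℕ} {a : ℝ} {E : Set ℤ} {W d : ℤ} {fail : Prop}

theorem IsTable.insert_new (H : IsTable N b L a E W fail) (hd : 1 ≤ d) (hdb : d < b)
    (h : digit b W (bucket L a (d / N)) = 0) :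
    IsTable N b L a (insert d E) (W + d * b ^ bucket L a (d / N)) fail where
  digit_mem u := by
    rw [digit_add_mul_pow (by omega) hdb h]
    split_ifs with hu
    · exact Or.inr ⟨Set.mem_insert _ _, hu.symm⟩
    · exact (H.digit_mem u).imp_right fun h => ⟨Set.mem_insert_of_mem _ h.1, h.2⟩
  exists_digit hf d' hd' := by
    rw [digit_add_mul_pow (by omega) hdb h]
    rcases hd' with rfl | hd'
    · rw [if_pos rfl]
      exact ⟨by omega, rfl⟩
    · obtain ⟨h1, h2⟩ := H.exists_digit hf d' hd'
      have : bucket L a (d' / N) ≠ bucket L a (d / N) := fun e => h1 (e ▸ h)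
      rw [if_neg this]
      exact ⟨h1, h2⟩
  not_fail hi := H.not_fail (hi.mono (Set.image_mono (Set.subset_insert d E)))

theorem IsTable.insert_old (H : IsTable N b L a E W fail)
    (h : digit b W (bucket L a (d / N)) ≠ 0) (h' : digit b W (bucket L a (d / N)) / N = d / N) :
    IsTable N b L a (insert d E) W fail where
  digit_mem u := (H.digit_mem u).imp_right fun h => ⟨Set.mem_insert_of_mem _ h.1, h.2⟩
  exists_digit hf d' hd' := by
    rcases hd' with rfl | hd'
    · exact ⟨h, h'⟩
    · exact H.exists_digit hf d' hd'
  not_fail hi := H.not_fail (hi.mono (Set.image_mono (Set.subset_insert d E)))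

theorem IsTable.insert_collision (H : IsTable N b L a E W fail)
    (h : digit b W (bucket L a (d / N)) ≠ 0) (h' : digit b W (bucket L a (d / N)) / N ≠ d / N) :
    IsTable N b L a (insert d E) W True where
  digit_mem u := (H.digit_mem u).imp_right fun h => ⟨Set.mem_insert_of_mem _ h.1, h.2⟩
  exists_digit hf := absurd trivial hf
  not_fail hi := by
    obtain ⟨h1, h2⟩ := (H.digit_mem (bucket L a (d / N))).resolve_left h
    exact absurd (hi (Set.mem_image_of_mem _ (Set.mem_insert_of_mem _ h1))
      (Set.mem_image_of_mem _ (Set.mem_insert _ _)) h2) h'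

end Insert

/-! ### The probability of a collision -/

section

open MeasureTheory

/-- The hash functions `a` for which the keys `x` and `y` may collide, for a table with `L * L`
places: `a * (x - y)` is close to an integer. -/
def collisionSet (L : ℕ) (x y : ℤ) : Set unitInterval :=
  ⋃ c ∈ Finset.range ((x - y).natAbs + 1), {a | |(a : ℝ) * (x - y).natAbs - c| < 1 / (L : ℝ) ^ 2}

theorem isOpen_collisionSet (L : ℕ) (x y : ℤ) : IsOpen (collisionSet L x y) :=
  isOpen_biUnion fun _ _ => isOpen_lt (by fun_prop) continuous_const

theorem mem_collisionSet {L : ℕ} (hL : 0 < L) {a : unitInterval} {x y : ℤ}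
    (h : bucket L a x = bucket L a y) : a ∈ collisionSet L x y := by
  have hL' : (1 : ℝ) ≤ (L : ℝ) ^ 2 := one_le_pow₀ (by exact_mod_cast hL)
  have hsmall : 1 / (L : ℝ) ^ 2 ≤ 1 := by rw [div_le_one (by linarith)]; exact hL'
  obtain ⟨c, hc⟩ : ∃ c : ℤ, |(a : ℝ) * (x - y).natAbs - c| < 1 / (L : ℝ) ^ 2 := by
    rcases le_total y x with hxy | hxy
    · obtain ⟨c, hc⟩ := exists_abs_sub_lt_of_bucket_eq hL h
      refine ⟨c, ?_⟩
      rw [Nat.cast_natAbs, abs_of_nonneg (sub_nonneg.2 hxy), Int.cast_sub]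
      exact hc
    · obtain ⟨c, hc⟩ := exists_abs_sub_lt_of_bucket_eq hL h.symm
      refine ⟨c, ?_⟩
      rw [Nat.cast_natAbs, abs_of_nonpos (sub_nonpos.2 hxy), neg_sub, Int.cast_sub]
      exact hc
  have h1 := abs_lt.1 (hc.trans_le hsmall)
  have ha0 := a.2.1
  have ha1 := a.2.2
  have hd : (0 : ℝ) ≤ (x - y).natAbs := Nat.cast_nonneg _
  have c0 : -1 < c := by
    have : (-1 : ℝ) < c := by linarith [mul_nonneg ha0 hd, h1.2]
    exact_mod_cast this
  have c1 : c < (x - y).natAbs + 1 := by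
    have : (c : ℝ) < ((x - y).natAbs : ℤ) + 1 := by
      rw [Int.cast_natCast]
      linarith [mul_le_mul_of_nonneg_right ha1 hd, h1.1]
    exact_mod_cast this
  refine Set.mem_biUnion (x := c.toNat) (Finset.mem_coe.2 (Finset.mem_range.2 (by omega))) ?_
  have : ((c.toNat : ℕ) : ℝ) = c := by
    have : ((c.toNat : ℤ) : ℝ) = c := by rw [Int.toNat_of_nonneg (by omega)]
    rwa [Int.cast_natCast] at this
  simp only [Set.mem_ofPred_eq, this]
  exact hc

/-- The set consists of `d + 1` intervals of length `2 / (L² d)` each, where `d = |x - y|`. -/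
theorem volume_collisionSet_le {L : ℕ} (hL : 0 < L) {x y : ℤ} (hxy : x ≠ y) :
    volume (collisionSet L x y) ≤ ENNReal.ofReal (4 / (L : ℝ) ^ 2) := by
  set d := (x - y).natAbs with hd
  have hd1 : 1 ≤ d := by omega
  have hd0 : (0 : ℝ) < d := by exact_mod_cast hd1
  have hL0 : (0 : ℝ) < (L : ℝ) ^ 2 := by positivity
  have hc : ∀ c : ℕ, volume {a : unitInterval | |(a : ℝ) * d - c| < 1 / (L : ℝ) ^ 2} ≤
      ENNReal.ofReal (2 / ((L : ℝ) ^ 2 * d)) := by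
    intro c
    rw [unitInterval.volume_apply]
    calc volume (Subtype.val '' {a : unitInterval | |(a : ℝ) * d - c| < 1 / (L : ℝ) ^ 2})
        ≤ volume (Set.Ioo ((c - 1 / (L : ℝ) ^ 2) / d) ((c + 1 / (L : ℝ) ^ 2) / d)) := by
          refine measure_mono ?_
          rintro _ ⟨a, ha, rfl⟩
          have := abs_lt.1 (show |(a : ℝ) * d - c| < 1 / (L : ℝ) ^ 2 from ha)
          exact ⟨by rw [div_lt_iff₀ hd0]; linarith, by rw [lt_div_iff₀ hd0]; linarith⟩
      _ = ENNReal.ofReal (2 / ((L : ℝ) ^ 2 * d)) := by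
          rw [Real.volume_Ioo]
          congr 1
          field_simp
          ring
  calc volume (collisionSet L x y)
      ≤ ∑ c ∈ Finset.range (d + 1),
          volume {a : unitInterval | |(a : ℝ) * d - c| < 1 / (L : ℝ) ^ 2} :=
        measure_biUnion_finset_le _ _
    _ ≤ ∑ c ∈ Finset.range (d + 1), ENNReal.ofReal (2 / ((L : ℝ) ^ 2 * d)) :=
        Finset.sum_le_sum fun c _ => hc c
    _ = ENNReal.ofReal ((d + 1 : ℕ) * (2 / ((L : ℝ) ^ 2 * d))) := by
        rw [Finset.sum_const, Finset.card_range, nsmul_eq_mul, ENNReal.ofReal_mul (by positivity),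
          ENNReal.ofReal_natCast]
    _ ≤ ENNReal.ofReal (4 / (L : ℝ) ^ 2) := by
        refine ENNReal.ofReal_le_ofReal ?_
        have h1 : (1 : ℝ) ≤ d := by exact_mod_cast hd1
        rw [← mul_div_assoc, div_le_div_iff₀ (by positivity) hL0]
        push_cast
        nlinarith

/-- The hash functions for which two different keys among `x 0, …, x (N-1)` may collide. -/
def badSet (L N : ℕ) (x : ℕ → ℤ) : Set unitInterval :=
  ⋃ p ∈ (Finset.range N ×ˢ Finset.range N).filter fun p => x p.1 ≠ x p.2,
    collisionSet L (x p.1) (x p.2)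

theorem measurableSet_badSet (L N : ℕ) (x : ℕ → ℤ) : MeasurableSet (badSet L N x) :=
  (isOpen_biUnion fun _ _ => isOpen_collisionSet L _ _).measurableSet

theorem injOn_bucket {L N : ℕ} (hL : 0 < L) {x : ℕ → ℤ} {a : unitInterval}
    (ha : a ∉ badSet L N x) : Set.InjOn (bucket L a) (x '' {i | i < N}) := by
  rintro _ ⟨i, hi, rfl⟩ _ ⟨j, hj, rfl⟩ h
  by_contra hne
  refine ha (Set.mem_biUnion (x := (i, j)) ?_ (mem_collisionSet hL h))
  simp only [Finset.coe_filter, Finset.mem_product, Finset.mem_range, Set.mem_ofPred_eq]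
  exact ⟨⟨hi, hj⟩, hne⟩

/-- The number `4 * (N + 1)` of rows and columns makes a union bound over all pairs of keys work. -/
theorem volume_badSet_le (N : ℕ) (x : ℕ → ℤ) : volume (badSet (4 * (N + 1)) N x) ≤ 2⁻¹ := by
  have hL : 0 < 4 * (N + 1) := by omega
  calc volume (badSet (4 * (N + 1)) N x)
      ≤ ∑ p ∈ (Finset.range N ×ˢ Finset.range N).filter fun p => x p.1 ≠ x p.2,
          volume (collisionSet (4 * (N + 1)) (x p.1) (x p.2)) := measure_biUnion_finset_le _ _
    _ ≤ ∑ p ∈ (Finset.range N ×ˢ Finset.range N).filter fun p => x p.1 ≠ x p.2,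
          ENNReal.ofReal (4 / ((4 * (N + 1) : ℕ) : ℝ) ^ 2) :=
        Finset.sum_le_sum fun p hp =>
          volume_collisionSet_le hL (Finset.mem_filter.1 hp).2
    _ ≤ ∑ p ∈ Finset.range N ×ˢ Finset.range N,
          ENNReal.ofReal (4 / ((4 * (N + 1) : ℕ) : ℝ) ^ 2) :=
        Finset.sum_le_sum_of_subset (Finset.filter_subset _ _)
    _ = ENNReal.ofReal ((N * N : ℕ) * (4 / ((4 * (N + 1) : ℕ) : ℝ) ^ 2)) := by
        rw [Finset.sum_const, Finset.card_product, Finset.card_range, nsmul_eq_mul,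
          ENNReal.ofReal_mul (by positivity), ENNReal.ofReal_natCast]
    _ ≤ ENNReal.ofReal 2⁻¹ := by
        refine ENNReal.ofReal_le_ofReal ?_
        have : (0 : ℝ) ≤ N := Nat.cast_nonneg N
        rw [← mul_div_assoc, div_le_iff₀ (by positivity)]
        push_cast
        nlinarith
    _ = 2⁻¹ := by rw [ENNReal.ofReal_inv_of_pos (by norm_num)]; simp

open RealRAM in
/-- The expected number of independent attempts until one avoids a set of probability at
most `1/2` is at most `2`. -/
theorem lintegral_tsum_indicator_le {A : Set unitInterval} (hA : MeasurableSet A)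
    (h : volume A ≤ 2⁻¹) :
    ∫⁻ ω, ∑' j : ℕ, ((Finset.range j : Set ℕ).pi fun _ => A).indicator 1 ω ∂tapeMeasure ≤ 2 := by
  have hm : ∀ j : ℕ, MeasurableSet ((Finset.range j : Set ℕ).pi fun _ => A) := fun j =>
    MeasurableSet.pi (Finset.countable_toSet _) fun _ _ => hA
  rw [lintegral_tsum fun j => (measurable_one.indicator (hm j)).aemeasurable]
  calc ∑' j : ℕ, ∫⁻ ω, ((Finset.range j : Set ℕ).pi fun _ => A).indicator 1 ω ∂tapeMeasure
      ≤ ∑' j : ℕ, (2⁻¹ : ENNReal) ^ j := by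
        refine ENNReal.tsum_le_tsum fun j => ?_
        rw [lintegral_indicator_one (hm j), tapeMeasure,
          Measure.infinitePi_pi _ fun _ _ => hA, Finset.prod_const, Finset.card_range]
        exact pow_le_pow_left' h j
    _ = 2 := by rw [ENNReal.tsum_geometric, ENNReal.one_sub_inv_two, inv_inv]

end

/-! ### Counting -/

/-- The bound `k ^ k ≤ 3 ^ k * k!` turns the binomial coefficient into a power of `m / k`. -/
theorem choose_add_le_pow {m k : ℕ} (hk : 1 ≤ k) (hkm : k ≤ m) :
    ((m + k).choose k : ℝ) ≤ (6 * (m / k)) ^ k := by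
  have hk0 : (0 : ℝ) < k := by exact_mod_cast hk
  have hf : (0 : ℝ) < (k.factorial : ℝ) := by exact_mod_cast k.factorial_pos
  have h1 : ((m + k).choose k : ℝ) ≤ (2 * m) ^ k / k.factorial := by
    refine (Nat.choose_le_pow_div k (m + k)).trans ?_
    gcongr
    push_cast
    have : (k : ℝ) ≤ m := by exact_mod_cast hkm
    linarith
  have h2 : (k : ℝ) ^ k / k.factorial ≤ 3 ^ k := by
    refine (Real.pow_div_factorial_le_exp (k : ℝ) hk0.le k).trans ?_
    rw [← mul_one (k : ℝ), Real.exp_nat_mul]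
    exact pow_le_pow_left₀ (Real.exp_pos 1).le Real.exp_one_lt_three.le k
  calc ((m + k).choose k : ℝ) ≤ (2 * m) ^ k / k.factorial := h1
    _ = (2 * (m / k)) ^ k * ((k : ℝ) ^ k / k.factorial) := by
        rw [← mul_div_assoc, ← mul_pow]
        congr 2
        field_simp
    _ ≤ (2 * (m / k)) ^ k * 3 ^ k := by gcongr
    _ = (6 * (m / k)) ^ k := by
        rw [← mul_pow]
        congr 1
        ring

theorem choose_add_succ_le (m k : ℕ) : (m + k).choose (k + 1) ≤ m * (m + k).choose k := by
  have h := Nat.choose_succ_right_eq (m + k) k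
  rw [Nat.add_sub_cancel] at h
  calc (m + k).choose (k + 1) ≤ (m + k).choose (k + 1) * (k + 1) :=
        Nat.le_mul_of_pos_right _ (by omega)
    _ = m * (m + k).choose k := by rw [h, mul_comm]

/-- A bound for the number of matchings that the search completes from a state which has `a` edges
and `l` vertices to go, when there are `G` candidates for each vertex. -/
def leafBound (G a l : ℕ) : ℕ := (G + 1) ^ l * (a + l).choose l

/-- A bound for the work of the search from a state which has `a` edges and `l` vertices to go, when
processing a state takes time `c`, plus `c` for each of the `G` candidates if `l` is positive. -/
def workBound (c G a l : ℕ) : ℕ := c * ((2 * (G + 1)) ^ l * (a + l + 1).choose (l + 1))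

theorem leafBound_pos (G a l : ℕ) : 1 ≤ leafBound G a l :=
  Nat.mul_pos (pow_pos (Nat.succ_pos G) l) (Nat.choose_pos (Nat.le_add_left l a))

theorem leafBound_advance (G a l : ℕ) : leafBound G a l ≤ leafBound G (a + 1) l :=
  Nat.mul_le_mul_left _ (Nat.choose_le_choose l (by omega))

/-- On the last edge, the search may end, or match one more vertex. -/
theorem leafBound_emit (G l : ℕ) : 1 + G * leafBound G 0 l ≤ leafBound G 0 (l + 1) := by
  simp only [leafBound, zero_add, Nat.choose_self, mul_one]
  have := pow_pos (Nat.succ_pos G) l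
  rw [Nat.succ_eq_add_one] at this
  rw [pow_succ]
  linarith

/-- On any other edge, the search moves on to the next edge or matches one more vertex: this is
Pascal's rule. -/
theorem leafBound_advance_emit (G a l : ℕ) :
    leafBound G a (l + 1) + G * leafBound G (a + 1) l ≤ leafBound G (a + 1) (l + 1) := by
  simp only [leafBound]
  rw [show a + 1 + (l + 1) = (a + (l + 1)) + 1 by ring, Nat.choose_succ_succ,
    show a + 1 + l = a + (l + 1) by ring, mul_add, pow_succ]
  have := Nat.zero_le ((G + 1) ^ l * (a + (l + 1)).choose l)
  nlinarith

theorem workBound_advance (c G a : ℕ) : c + workBound c G a 0 ≤ workBound c G (a + 1) 0 := by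
  simp only [workBound, pow_zero, one_mul, add_zero, zero_add, Nat.choose_one_right]
  rw [Nat.mul_add c (a + 1) 1]
  omega

theorem workBound_zero (c G : ℕ) : c ≤ workBound c G 0 0 := by simp [workBound]

theorem workBound_emit (c G l : ℕ) :
    c + G * c + G * workBound c G 0 l ≤ workBound c G 0 (l + 1) := by
  simp only [workBound, zero_add, Nat.choose_self, mul_one]
  have := pow_pos (show 0 < 2 * (G + 1) by omega) l
  rw [pow_succ]
  nlinarith [Nat.mul_le_mul_left (c * (G + 2)) this]

/-- The factor `2` in the base of `workBound` absorbs the time for processing the state itself. -/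
theorem workBound_advance_emit (c G a l : ℕ) :
    c + G * c + workBound c G a (l + 1) + G * workBound c G (a + 1) l ≤
      workBound c G (a + 1) (l + 1) := by
  simp only [workBound]
  rw [show a + 1 + (l + 1) + 1 = (a + (l + 1) + 1) + 1 by ring,
    Nat.choose_succ_succ (a + (l + 1) + 1) (l + 1), show a + 1 + l + 1 = a + (l + 1) + 1 by ring]
  have h1 := pow_pos (show 0 < 2 * (G + 1) by omega) l
  have h2 := Nat.choose_pos (show l + 1 ≤ a + (l + 1) + 1 by omega)
  have h3 := Nat.mul_le_mul_left (c * (G + 2)) (Nat.mul_pos h1 h2)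
  rw [pow_succ]
  nlinarith

section Real

variable {m k : ℕ} {ε : ℝ}

theorem succ_mul_floor_le (hε : 0 < ε) (hε1 : ε ≤ 1) :
    ((2 * (2 * (⌊48 / ε⌋₊ + 8) + 1) + 1 : ℕ) : ℝ) ≤ 227 / ε := by
  have h1 := Nat.floor_le (show 0 ≤ 48 / ε by positivity)
  have h2 : 1 ≤ 1 / ε := by rw [le_div_iff₀ hε]; linarith
  push_cast
  rw [show 227 / ε = 4 * (48 / ε) + 35 * (1 / ε) by ring]
  linarith

theorem leafBound_le (hk : 1 ≤ k) (hkm : k ≤ m) (hε : 0 < ε) (hε1 : ε ≤ 1) :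
    (leafBound (2 * (2 * (⌊48 / ε⌋₊ + 8) + 1)) (m - 1) k : ℝ) ≤ (1362 * (m / (k * ε))) ^ k := by
  have hk0 : (0 : ℝ) < k := by exact_mod_cast hk
  have h1 : ((m - 1 + k).choose k : ℝ) ≤ (6 * (m / k)) ^ k :=
    le_trans (by exact_mod_cast Nat.choose_le_choose k (by omega)) (choose_add_le_pow hk hkm)
  have h2 := succ_mul_floor_le hε hε1
  rw [leafBound, Nat.cast_mul, Nat.cast_pow]
  calc _ ≤ (227 / ε) ^ k * (6 * (m / k)) ^ k := by gcongr
    _ = (1362 * (m / (k * ε))) ^ k := by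
        rw [← mul_pow]
        congr 1
        field_simp
        ring

theorem workBound_le (c : ℕ) (hk : 1 ≤ k) (hkm : k ≤ m) (hε : 0 < ε) (hε1 : ε ≤ 1) :
    (workBound c (2 * (2 * (⌊48 / ε⌋₊ + 8) + 1)) (m - 1) k : ℝ) ≤
      c * (m * (2724 * (m / (k * ε))) ^ k) := by
  have hk0 : (0 : ℝ) < k := by exact_mod_cast hk
  have h1 : ((m - 1 + k + 1).choose (k + 1) : ℝ) ≤ m * (6 * (m / k)) ^ k := by
    rw [show m - 1 + k + 1 = m + k by omega]
    refine le_trans (b := ((m * (m + k).choose k : ℕ) : ℝ))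
      (by exact_mod_cast choose_add_succ_le m k) ?_
    rw [Nat.cast_mul]
    gcongr
    exact choose_add_le_pow hk hkm
  have h2 := succ_mul_floor_le hε hε1
  rw [workBound, Nat.cast_mul, Nat.cast_mul, Nat.cast_pow]
  refine mul_le_mul_of_nonneg_left ?_ (Nat.cast_nonneg c)
  calc _ ≤ (2 * (227 / ε)) ^ k * (m * (6 * (m / k)) ^ k) := by
        rw [Nat.cast_mul 2, Nat.cast_two]
        gcongr
    _ = m * (2724 * (m / (k * ε))) ^ k := by
        rw [mul_left_comm, ← mul_pow]
        congr 2
        field_simp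
        ring

end Real

/-! ### The search as a program -/

/-- The contents of a state of the search as a sequence of real numbers. -/
def SearchState.field (σ : SearchState) : ℕ → ℝ
  | 0 => σ.cur
  | 1 => σ.f
  | 2 => σ.v
  | 3 => σ.h
  | 4 => σ.mx
  | 5 => σ.mn
  | 6 => σ.D
  | 7 => σ.R
  | 8 => σ.len
  | _ => σ.key

namespace RealRAM

open _root_.RealRAM.Expr (reg load floor)
open _root_.RealRAM.Prog (store)

/-- The registers `x, …, x + 9` hold the state `σ` of the search. -/
def Held (x : ℕ) (σ : SearchState) (s : State) : Prop := ∀ j < 10, s.reg (x + j) = σ.field j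

/-- The arrays `10, …, 19` hold the list `q`, and register `15` holds its length. -/
def Queue (q : List SearchState) (s : State) : Prop :=
  (∀ i (hi : i < q.length), ∀ j < 10, s.arr (10 + j) i = q[i].field j) ∧ s.reg 15 = q.length

/-- Stores the first `N` of the registers `70, 71, …` at the end of the queue. -/
def pushFields : ℕ → Prog
  | 0 => .skip
  | j + 1 => pushFields j ;; store (10 + j) (reg 15) (reg (70 + j))

/-- Appends the state in the registers `70, …, 79` to the queue. -/
def push : Prog := pushFields 10 ;; 15 ≔ reg 15 + 1

/-- Loads the first `N` fields of the state at the head of the queue into the registers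
`20, 21, …`. -/
def loadFields : ℕ → Prog
  | 0 => .skip
  | j + 1 => loadFields j ;; (20 + j) ≔ load (10 + j) (reg 14)

theorem pushFields_loopFree (N : ℕ) : (pushFields N).LoopFree := by
  induction N with
  | zero => trivial
  | succ N ih => exact ⟨ih, trivial⟩

theorem loadFields_loopFree (N : ℕ) : (loadFields N).LoopFree := by
  induction N with
  | zero => trivial
  | succ N ih => exact ⟨ih, trivial⟩

theorem result_pushFields (N : ℕ) (s : State) :
    ((pushFields N).result s).reg = s.reg ∧
    ∀ a, ((pushFields N).result s).arr a =
      if 10 ≤ a ∧ a < 10 + N then Function.update (s.arr a) ⌊s.reg 15⌋₊ (s.reg (60 + a))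
      else s.arr a := by
  induction N with
  | zero => exact ⟨rfl, fun a => by rw [if_neg (by omega)]; rfl⟩
  | succ N ih =>
    obtain ⟨h1, h2⟩ := ih
    refine ⟨h1, fun a => ?_⟩
    simp only [pushFields, Prog.result, State.setCell_arr, Expr.eval_reg, h1, h2]
    split_ifs with i1 i2 i3 <;> first | omega | rfl | skip
    subst i1
    rw [show 60 + (10 + N) = 70 + N by omega]

theorem result_loadFields (N : ℕ) (s : State) :
    (∀ j < N, ((loadFields N).result s).reg (20 + j) = s.arr (10 + j) ⌊s.reg 14⌋₊) ∧
    (∀ x < 20, ((loadFields N).result s).reg x = s.reg x) ∧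
    ((loadFields N).result s).arr = s.arr := by
  induction N with
  | zero => exact ⟨fun j hj => by omega, fun _ _ => rfl, rfl⟩
  | succ N ih =>
    obtain ⟨h1, h2, h3⟩ := ih
    refine ⟨fun j hj => ?_, fun x hx => ?_, h3⟩
    · simp only [loadFields, Prog.result, State.setReg_reg, Expr.eval_load, Expr.eval_reg, h3,
        h2 14 (by omega)]
      split_ifs with h
      · rw [show j = N by omega]
      · exact h1 j (by omega)
    · simp only [loadFields, Prog.result, State.setReg_reg]
      rw [if_neg (by omega), h2 x hx]

theorem push_runs {q : List SearchState} {σ : SearchState} {s : State} (hq : Queue q s)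
    (hσ : Held 70 σ s) : Runs push s 40 (Queue (q ++ [σ])) := by
  refine Prog.LoopFree.runs ⟨pushFields_loopFree 10, trivial⟩ (by decide) ?_
  obtain ⟨h1, h2⟩ := result_pushFields 10 s
  refine ⟨fun i hi j hj => ?_, ?_⟩
  · simp only [push, Prog.result, State.setReg_arr, h2]
    rw [if_pos (by omega), hq.2, Nat.floor_natCast, Function.update_apply,
      show 60 + (10 + j) = 70 + j by omega, hσ j hj]
    split_ifs with h
    · subst h; simp
    · have hi' : i < q.length := by simp at hi; omega
      rw [hq.1 i hi' j hj, List.getElem_append_left hi']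
  · simp [push, Prog.result, h1, hq.2]

theorem loadFields_runs {q : List SearchState} {s : State} (hq : Queue q s) {i : ℕ}
    (hi : i < q.length) (h : s.reg 14 = i) : Runs (loadFields 10) s 40 (Held 20 q[i]) := by
  refine Prog.LoopFree.runs (loadFields_loopFree 10) (by decide) fun j hj => ?_
  rw [(result_loadFields 10 s).1 j hj, h, Nat.floor_natCast, hq.1 i hi j hj]

theorem Queue.of_frame {c : Prog} {q : List SearchState} {s s' : State} (h : Queue q s)
    (hf : Frame c s s') (hc : 15 ∉ c.writesReg ∧ ∀ j < 10, 10 + j ∉ c.writesArr) : Queue q s' :=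
  ⟨fun i hi j hj => by rw [hf.2 _ (hc.2 j hj), h.1 i hi j hj], by rw [hf.1 _ hc.1, h.2]⟩

theorem Held.of_frame {c : Prog} {x : ℕ} {σ : SearchState} {s s' : State} (h : Held x σ s)
    (hf : Frame c s s') (hc : ∀ j < 10, x + j ∉ c.writesReg) : Held x σ s' :=
  fun j hj => by rw [hf.1 _ (hc j hj), h j hj]

/-- The parameters of the search in their registers, and the scaled time series in array `1`: `K` is
the radius of the candidates, so that there are `2 * K + 1` of them for each end of an edge, and
`off` and `B` are the offset and the base of the codes. -/
structure Params (X : ℕ → ℕ → ℝ) (n m k K : ℕ) (ρ : ℝ) (B off : ℤ) (s : State) : Prop where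
  r1 : s.reg 1 = m
  r2 : s.reg 2 = k
  r6 : s.reg 6 = ρ
  r7 : s.reg 7 = K
  r8 : s.reg 8 = 2 * K + 1
  r9 : s.reg 9 = (2 * (2 * K + 1) : ℕ)
  r10 : s.reg 10 = off
  r11 : s.reg 11 = B
  r49 : s.reg 49 = n + 1
  data : ∀ i < n, ∀ p < m, s.arr 1 (i * m + p) = X i p

theorem Params.of_frame {X : ℕ → ℕ → ℝ} {n m k K : ℕ} {ρ : ℝ} {B off : ℤ} {c : Prog}
    {s s' : State} (h : Params X n m k K ρ B off s) (hf : Frame c s s')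
    (hc : (∀ x ∈ [1, 2, 6, 7, 8, 9, 10, 11, 49], x ∉ c.writesReg) ∧ 1 ∉ c.writesArr) :
    Params X n m k K ρ B off s' where
  r1 := by rw [hf.1 _ (hc.1 1 (by simp)), h.r1]
  r2 := by rw [hf.1 _ (hc.1 2 (by simp)), h.r2]
  r6 := by rw [hf.1 _ (hc.1 6 (by simp)), h.r6]
  r7 := by rw [hf.1 _ (hc.1 7 (by simp)), h.r7]
  r8 := by rw [hf.1 _ (hc.1 8 (by simp)), h.r8]
  r9 := by rw [hf.1 _ (hc.1 9 (by simp)), h.r9]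
  r10 := by rw [hf.1 _ (hc.1 10 (by simp)), h.r10]
  r11 := by rw [hf.1 _ (hc.1 11 (by simp)), h.r11]
  r49 := by rw [hf.1 _ (hc.1 49 (by simp)), h.r49]
  data i hi p hp := by rw [hf.2 _ hc.2, h.data i hi p hp]

/-- Computes `SearchState.advance` for the state in the registers `20, …, 29`, and leaves the result
in the registers `70, …, 79`, with the next vertex of the time series in register `31`. -/
def buildAdvance : Prog :=
  70 ≔ reg 20 ;; 71 ≔ reg 21 + 1 ;; 72 ≔ reg 22 ;; 73 ≔ reg 31 ;;
  74 ≔ reg 24 ;; setMax 74 (reg 31) ;;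
  75 ≔ reg 25 ;; setMin 75 (reg 31) ;;
  76 ≔ reg 26 ;; setMax 76 (reg 24 - reg 31) ;;
  77 ≔ reg 27 ;; setMax 77 (reg 31 - reg 25) ;;
  78 ≔ reg 28 ;; 79 ≔ reg 29

/-- Computes `SearchState.emit` for the state in the registers `20, …, 29`, and leaves the result in
the registers `70, …, 79`, with the end vertices of the current edge in the registers `30`
and `31`, and the new vertex in register `34`. -/
def buildEmit : Prog :=
  70 ≔ reg 20 ;; 71 ≔ reg 21 ;; 72 ≔ reg 34 ;; 73 ≔ reg 23 ;;
  .ite (.le (reg 30) (reg 31)) (setMax 73 (reg 34 - reg 6)) (setMin 73 (reg 34 + reg 6)) ;;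
  74 ≔ reg 34 ;; 75 ≔ reg 34 ;; 76 ≔ 0 ;; 77 ≔ 0 ;; 78 ≔ reg 28 + 1 ;;
  79 ≔ reg 29 * reg 11 + (reg 34 + reg 10)

/-- Computes `SearchState.cand` for the number in register `33`. -/
def candProg : Prog :=
  .ite (.lt (reg 33) (reg 8)) (34 ≔ floor (reg 30) - reg 7 + reg 33)
    (34 ≔ floor (reg 31) - reg 7 + (reg 33 - reg 8))

/-- The test `SegTest` on the registers `22`, `24`, …, `27`. -/
def segTest (w : Expr) : Test :=
  .or (.and (.le (reg 22) w) (.and (.le (reg 26) (2 * reg 6))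
      (.and (.le (reg 22 - reg 6) (reg 25)) (.le (reg 24) (w + reg 6)))))
    (.and (.le w (reg 22)) (.and (.le (reg 27) (2 * reg 6))
      (.and (.le (reg 24) (reg 22 + reg 6)) (.le (w - reg 6) (reg 25)))))

/-- The test `SearchState.CanEmit`. -/
def canEmitTest : Test :=
  .and (.or (.le 1 (reg 28)) (.and (.le (reg 30 - reg 6) (reg 34)) (.le (reg 34) (reg 30 + reg 6))))
    (.and (segTest (reg 34))
      (.or (.and (.le (reg 30) (reg 31))
          (.and (.le (reg 23) (reg 34 + reg 6)) (.le (reg 34 - reg 6) (reg 31))))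
        (.and (.lt (reg 31) (reg 30))
          (.and (.le (reg 34 - reg 6) (reg 23)) (.le (reg 31) (reg 34 + reg 6))))))

theorem cost_lt_reg (x y : ℕ) : (Test.lt (reg x) (reg y)).cost = 4 := rfl

section Specs

variable {X : ℕ → ℕ → ℝ} {n m k K : ℕ} {ρ : ℝ} {B off : ℤ} {s : State} {σ : SearchState}

theorem Held.regs (h : Held 20 σ s) : s.reg 20 = σ.cur ∧ s.reg 21 = σ.f ∧ s.reg 22 = σ.v ∧
    s.reg 23 = σ.h ∧ s.reg 24 = σ.mx ∧ s.reg 25 = σ.mn ∧ s.reg 26 = σ.D ∧ s.reg 27 = σ.R ∧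
    s.reg 28 = σ.len ∧ s.reg 29 = σ.key :=
  ⟨h 0 (by omega), h 1 (by omega), h 2 (by omega), h 3 (by omega), h 4 (by omega), h 5 (by omega),
    h 6 (by omega), h 7 (by omega), h 8 (by omega), h 9 (by omega)⟩

theorem buildAdvance_runs (h : Held 20 σ s) (h31 : s.reg 31 = X σ.cur (σ.f + 1)) :
    Runs buildAdvance s 80 (Held 70 (σ.advance X)) := by
  obtain ⟨h0, h1, h2, h3, h4, h5, h6, h7, h8, h9⟩ := h.regs
  refine Prog.LoopFree.runs (by simp [buildAdvance, Prog.LoopFree, setMax, setMin])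
    (by decide) fun j hj => ?_
  interval_cases j <;>
  simp [buildAdvance, Prog.result, result_setMax, result_setMin, SearchState.field,
    SearchState.advance, h0, h1, h2, h4, h5, h6, h7, h8, h9, h31]

theorem buildEmit_runs (hp : Params X n m k K ρ B off s) (h : Held 20 σ s)
    (h30 : s.reg 30 = X σ.cur σ.f) (h31 : s.reg 31 = X σ.cur (σ.f + 1)) {w : ℤ}
    (h34 : s.reg 34 = w) : Runs buildEmit s 80 (Held 70 (σ.emit X ρ B off w)) := by
  obtain ⟨h0, h1, h2, h3, h4, h5, h6, h7, h8, h9⟩ := h.regs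
  refine Prog.LoopFree.runs (by simp [buildEmit, Prog.LoopFree, setMax, setMin])
    (by decide) fun j hj => ?_
  by_cases hc : X σ.cur σ.f ≤ X σ.cur (σ.f + 1) <;> interval_cases j <;>
  simp [buildEmit, Prog.result, result_setMax, result_setMin, SearchState.field,
    SearchState.emit, h0, h1, h3, h8, h9, h30, h31, h34, hc, hp.r6, hp.r10, hp.r11]

theorem candProg_runs (hp : Params X n m k K ρ B off s)
    (h30 : s.reg 30 = X σ.cur σ.f) (h31 : s.reg 31 = X σ.cur (σ.f + 1)) {t : ℕ}
    (h33 : s.reg 33 = t) : Runs candProg s 40 fun s' => s'.reg 34 = σ.cand X K t := by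
  refine Prog.LoopFree.runs (by simp [candProg, Prog.LoopFree]) (by decide) ?_
  have : ((t : ℝ) < 2 * K + 1) ↔ t < 2 * K + 1 := by exact_mod_cast Iff.rfl
  by_cases ht : t < 2 * K + 1 <;>
  simp [candProg, Prog.result, SearchState.cand, hp.r7, hp.r8, h30, h31, h33, this, ht]

theorem holds_segTest {e : Expr} {w v mx mn D R : ℝ} (h6 : s.reg 6 = ρ) (h22 : s.reg 22 = v)
    (h24 : s.reg 24 = mx) (h25 : s.reg 25 = mn) (h26 : s.reg 26 = D) (h27 : s.reg 27 = R)
    (he : e.eval s = w) : (segTest e).holds s ↔ SegTest ρ v w mx mn D R := by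
  simp [segTest, SegTest, h6, h22, h24, h25, h26, h27, he]

theorem holds_canEmitTest (hp : Params X n m k K ρ B off s) (h : Held 20 σ s)
    (h30 : s.reg 30 = X σ.cur σ.f) (h31 : s.reg 31 = X σ.cur (σ.f + 1)) {w : ℝ}
    (h34 : s.reg 34 = w) : canEmitTest.holds s ↔ σ.CanEmit X ρ w := by
  obtain ⟨h0, h1, h2, h3, h4, h5, h6, h7, h8, h9⟩ := h.regs
  have e : (segTest (reg 34)).holds s ↔ SegTest ρ σ.v w σ.mx σ.mn σ.D σ.R :=
    holds_segTest hp.r6 h2 h4 h5 h6 h7 (by simpa using h34)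
  simp [canEmitTest, SearchState.CanEmit, e, h3, h8, h30, h31, h34, hp.r6]

/-- Appends the state for the candidate in register `33` to the queue, if it can be matched. -/
def candBody : Prog :=
  candProg ;; .ite canEmitTest (buildEmit ;; push) .skip ;; 33 ≔ reg 33 + 1

/-- Appends the states for all the candidates to the queue. -/
def expandCands : Prog := 33 ≔ 0 ;; .while (.lt (reg 33) (reg 9)) candBody

theorem expandCands_runs (hp : Params X n m k K ρ B off s) (h : Held 20 σ s)
    (h30 : s.reg 30 = X σ.cur σ.f) (h31 : s.reg 31 = X σ.cur (σ.f + 1)) {q : List SearchState}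
    (hq : Queue q s) :
    Runs expandCands s (2 * (2 * K + 1) * 410 + 10) fun s' => ∃ new, Queue (q ++ new) s' ∧
      new.length ≤ 2 * (2 * K + 1) ∧
      (∀ τ ∈ new, ∃ t < 2 * (2 * K + 1), σ.CanEmit X ρ (σ.cand X K t) ∧
        τ = σ.emit X ρ B off (σ.cand X K t)) ∧
      ∀ t < 2 * (2 * K + 1), σ.CanEmit X ρ (σ.cand X K t) →
        σ.emit X ρ B off (σ.cand X K t) ∈ new := by
  refine Runs.mono (T := 2 + (2 * (2 * K + 1) * (400 + 4) + 4)) (Q := fun s' => ∃ new,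
    Queue (q ++ new) s' ∧ new.length ≤ 2 * (2 * K + 1) ∧ (∀ τ ∈ new, ∃ t < 2 * (2 * K + 1),
      σ.CanEmit X ρ (σ.cand X K t) ∧ τ = σ.emit X ρ B off (σ.cand X K t)) ∧
      ∀ t < 2 * (2 * K + 1), σ.CanEmit X ρ (σ.cand X K t) →
        σ.emit X ρ B off (σ.cand X K t) ∈ new) ?_ (by omega) fun _ _ h => h
  refine Runs.seq (P := fun s' => s'.reg 33 = 0)
    (Prog.LoopFree.runs (by trivial) (by decide) (by simp [Prog.result])) fun s₁ f₁ e₁ => ?_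
  replace hp := hp.of_frame f₁ (by decide)
  replace h := h.of_frame f₁ (by decide)
  replace hq := hq.of_frame f₁ (by decide)
  have i30 : s₁.reg 30 = X σ.cur σ.f := (f₁.1 30 (by decide)).trans h30
  have i31 : s₁.reg 31 = X σ.cur (σ.f + 1) := (f₁.1 31 (by decide)).trans h31
  refine Runs.mono (Runs.for (T := 400) (2 * (2 * K + 1)) (fun t s' => s'.reg 33 = t ∧ ∃ new,
    Queue (q ++ new) s' ∧ new.length ≤ t ∧ (∀ τ ∈ new, ∃ t < 2 * (2 * K + 1),
      σ.CanEmit X ρ (σ.cand X K t) ∧ τ = σ.emit X ρ B off (σ.cand X K t)) ∧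
      ∀ t' < t, σ.CanEmit X ρ (σ.cand X K t') → σ.emit X ρ B off (σ.cand X K t') ∈ new) ?_ ?_ ?_)
      (by rw [cost_lt_reg]) fun _ _ h => h.2
  · exact ⟨by simpa using e₁, [], by simpa using hq, le_rfl, by simp, by simp⟩
  · intro t s' _ ht f
    replace hp := hp.of_frame f (by decide)
    simp only [Test.holds_lt, Expr.eval_reg, ht.1, hp.r9]
    exact Nat.cast_lt
  · rintro t s₂ htG ⟨ht, new, hq', hlen, hsound, hcomp⟩ f
    replace hp := hp.of_frame f (by decide)
    replace h := h.of_frame f (by decide)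
    replace i30 := (f.1 30 (by decide)).trans i30
    replace i31 := (f.1 31 (by decide)).trans i31
    refine Runs.mono (T := 40 + ((canEmitTest.cost + (80 + 40)) + 4)) (P := fun s' =>
      s'.reg 33 = (t + 1 : ℕ) ∧ ∃ new, Queue (q ++ new) s' ∧ new.length ≤ t + 1 ∧
      (∀ τ ∈ new, ∃ t < 2 * (2 * K + 1),
      σ.CanEmit X ρ (σ.cand X K t) ∧ τ = σ.emit X ρ B off (σ.cand X K t)) ∧
      ∀ t' < t + 1, σ.CanEmit X ρ (σ.cand X K t') → σ.emit X ρ B off (σ.cand X K t') ∈ new)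
      ?_ (by decide +kernel) fun _ _ h => h
    refine Runs.seq (candProg_runs hp i30 i31 ht) fun s₃ f₃ e₃ => ?_
    replace hp := hp.of_frame f₃ (by decide)
    replace h := h.of_frame f₃ (by decide)
    replace hq' := hq'.of_frame f₃ (by decide)
    replace i30 := (f₃.1 30 (by decide)).trans i30
    replace i31 := (f₃.1 31 (by decide)).trans i31
    replace ht := (f₃.1 33 (by decide)).trans ht
    have hiff := holds_canEmitTest hp h i30 i31 e₃
    refine Runs.seq (P := fun s' => s'.reg 33 = t ∧ ∃ new, Queue (q ++ new) s' ∧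
      new.length ≤ t + 1 ∧ (∀ τ ∈ new, ∃ t < 2 * (2 * K + 1),
      σ.CanEmit X ρ (σ.cand X K t) ∧ τ = σ.emit X ρ B off (σ.cand X K t)) ∧
      ∀ t' < t + 1, σ.CanEmit X ρ (σ.cand X K t') → σ.emit X ρ B off (σ.cand X K t') ∈ new)
      (Runs.ite (fun hc => ?_) fun hc => ?_) fun s₄ f₄ ⟨e₄, new', h₄⟩ => ?_
    · refine Runs.seq (buildEmit_runs hp h i30 i31 e₃) fun s₄ f₄ e₄ => ?_
      refine (push_runs (hq'.of_frame f₄ (by decide)) e₄).mono le_rfl fun s₅ f₅ e₅ => ?_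
      refine ⟨by rw [f₅.1 33 (by decide), f₄.1 33 (by decide), ht], new ++ [_],
        by rw [← List.append_assoc]; exact e₅, by simp; omega, ?_, ?_⟩
      · intro τ hτ
        rcases List.mem_append.1 hτ with hτ | hτ
        · exact hsound τ hτ
        · exact ⟨t, htG, hiff.1 hc, List.mem_singleton.1 hτ⟩
      · intro t' ht' hc'
        rw [List.mem_append, List.mem_singleton]
        rcases Nat.lt_succ_iff_lt_or_eq.1 ht' with h' | h'
        · exact Or.inl (hcomp t' h' hc')
        · exact Or.inr (by rw [h'])
    · refine Prog.LoopFree.runs trivial (by decide) ⟨ht, new, hq', by omega, hsound, ?_⟩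
      intro t' ht' hc'
      rcases Nat.lt_succ_iff_lt_or_eq.1 ht' with h' | h'
      · exact hcomp t' h' hc'
      · exact absurd (hiff.2 (h' ▸ hc')) hc
    · refine Runs.mono (P := fun s' => s'.reg 33 = t + 1)
        (Prog.LoopFree.runs trivial (by decide) (by simp [Prog.result, e₄])) le_rfl
        fun s₅ f₅ e₅ => ⟨by rw [e₅]; push_cast; rfl, new', h₄.1.of_frame f₅ (by decide), h₄.2⟩

end Specs

end RealRAM

namespace RealRAM

open _root_.RealRAM.Expr (reg load floor)
open _root_.RealRAM.Prog (store)

/-- The entry of the dictionary for a completed matching: the code of the matched curve and the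
index of the time series, as a number in base `n + 1`. -/
def _root_.SearchState.entry (n : ℕ) (σ : SearchState) : ℤ := σ.key * (n + 1) + σ.cur + 1

/-- Array `20` holds the entries `E`, register `16` their number, and register `43` the base, which
is larger than all the entries. -/
def Entries (E : List ℤ) (s : State) : Prop :=
  (∀ i (hi : i < E.length), s.arr 20 i = E[i]) ∧ s.reg 16 = E.length ∧
    s.reg 43 = (2 + E.sum : ℤ)

theorem Entries.of_frame {c : Prog} {E : List ℤ} {s s' : State} (h : Entries E s)
    (hf : Frame c s s') (hc : 16 ∉ c.writesReg ∧ 43 ∉ c.writesReg ∧ 20 ∉ c.writesArr) :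
    Entries E s' :=
  ⟨fun i hi => by rw [hf.2 _ hc.2.2, h.1 i hi], by rw [hf.1 _ hc.1, h.2.1],
    by rw [hf.1 _ hc.2.1, h.2.2]⟩

/-- Appends the entry of the current state to the list of entries, if the matching is complete. -/
def acceptProg : Prog :=
  .ite (.and (.le 1 (reg 28)) (.and (.le (reg 24) (reg 22 + reg 6)) (.le (reg 22 - reg 6) (reg 25))))
    (36 ≔ reg 29 * reg 49 + reg 20 + 1 ;; store 20 (reg 16) (reg 36) ;; 43 ≔ reg 43 + reg 36 ;;
      16 ≔ reg 16 + 1)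
    .skip

/-- Loads the end vertices of the current edge into the registers `30` and `31`, and then, at the
end of the time series, records a complete matching, and otherwise moves on to the next edge. -/
def moveProg : Prog :=
  30 ≔ load 1 (reg 20 * reg 1 + reg 21) ;;
  .ite (.le (reg 1) (reg 21 + 1)) (31 ≔ reg 30 ;; acceptProg)
    (31 ≔ load 1 (reg 20 * reg 1 + (reg 21 + 1)) ;;
      .ite (.le 1 (reg 28)) (buildAdvance ;; push) .skip)

/-- Processes the state at the head of the queue, whose position is in register `14`. The queue is
never shortened: the states before its head are those that have been processed. -/
def searchBody : Prog :=
  loadFields 10 ;; moveProg ;; .ite (.lt (reg 28) (reg 2)) expandCands .skip ;; 14 ≔ reg 14 + 1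

/-- Processes the queue until it is exhausted. -/
def search : Prog := .while (.lt (reg 14) (reg 15)) searchBody

section Specs

variable {X : ℕ → ℕ → ℝ} {n m k K : ℕ} {ρ : ℝ} {B off : ℤ} {s : State} {σ : SearchState}

open Classical in
theorem acceptProg_runs (hp : Params X n m k K ρ B off s) (h : Held 20 σ s) {E : List ℤ}
    (hE : Entries E s) (hf : m ≤ σ.f + 1) :
    Runs acceptProg s 60 (Entries (if σ.Accepts m ρ then E ++ [σ.entry n] else E)) := by
  obtain ⟨h0, h1, h2, h3, h4, h5, h6, h7, h8, h9⟩ := h.regs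
  refine Runs.mono (Runs.ite (T := 30) (fun hc => ?_) fun hc => ?_) (by decide) fun _ _ h => h
  · replace hc : σ.Accepts m ρ := by
      simp [h8, h4, h2, h5, hp.r6] at hc
      exact ⟨hf, hc.1, by linarith [hc.2.1], by linarith [hc.2.2]⟩
    rw [if_pos hc]
    refine Prog.LoopFree.runs (by simp [Prog.LoopFree]) (by decide) ⟨fun i hi => ?_, ?_, ?_⟩
    · simp only [Prog.result, State.setReg_arr, State.setCell_arr, if_true, Expr.eval_reg,
        State.setReg_reg, show ¬ (16 = 36) by decide, if_false, hE.2.1, Nat.floor_natCast,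
        Function.update_apply]
      split_ifs with h'
      · subst h'
        simp [SearchState.entry, h9, hp.r49, h0]
      · have hi' : i < E.length := by simp at hi; omega
        rw [hE.1 i hi', List.getElem_append_left hi']
    · simp [Prog.result, hE.2.1]
    · simp [Prog.result, hE.2.2, SearchState.entry, h9, hp.r49, h0]
      ring
  · replace hc : ¬ σ.Accepts m ρ := fun ha => hc (by
      simp [h8, h4, h2, h5, hp.r6]
      exact ⟨ha.2.1, by linarith [ha.2.2.1], by linarith [ha.2.2.2]⟩)
    rw [if_neg hc]
    exact Prog.LoopFree.runs trivial (by decide) hE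

theorem natFloor_mul_add (a b c : ℕ) : ⌊(a : ℝ) * b + c⌋₊ = a * b + c := by
  exact_mod_cast Nat.floor_natCast (a * b + c)

open Classical in
theorem moveProg_runs (hX : ∀ i, X i m = X i (m - 1)) (hp : Params X n m k K ρ B off s)
    (h : Held 20 σ s) (hv : σ.Valid X n m k ρ B off) {E : List ℤ} {q : List SearchState}
    (hE : Entries E s) (hq : Queue q s) :
    Runs moveProg s 200 fun s' => s'.reg 30 = X σ.cur σ.f ∧ s'.reg 31 = X σ.cur (σ.f + 1) ∧
      Entries (if σ.Accepts m ρ then E ++ [σ.entry n] else E) s' ∧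
      Queue (if σ.f + 1 < m ∧ 1 ≤ σ.len then q ++ [σ.advance X] else q) s' := by
  obtain ⟨h0, h1, -, -, -, -, -, -, h8, -⟩ := h.regs
  refine Runs.mono (T := 10 + (10 + 140)) (Q := fun s' => s'.reg 30 = X σ.cur σ.f ∧
    s'.reg 31 = X σ.cur (σ.f + 1) ∧
      Entries (if σ.Accepts m ρ then E ++ [σ.entry n] else E) s' ∧
      Queue (if σ.f + 1 < m ∧ 1 ≤ σ.len then q ++ [σ.advance X] else q) s')
    (Runs.seq (P := fun s' => s'.reg 30 = X σ.cur σ.f)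
    (Prog.LoopFree.runs trivial (by decide) ?_) fun s₁ f₁ e₁ => ?_) (by decide) fun _ _ h => h
  · simp only [Prog.result, State.setReg_reg, if_true, Expr.eval_load, Expr.eval_hadd,
      Expr.eval_hmul, Expr.eval_reg, h0, h1, hp.r1, natFloor_mul_add]
    exact hp.data _ hv.cur_lt _ hv.f_lt
  replace hp := hp.of_frame f₁ (by decide)
  replace h := h.of_frame f₁ (by decide)
  replace hq := hq.of_frame f₁ (by decide)
  replace hE := hE.of_frame f₁ (by decide)
  replace h0 := (f₁.1 20 (by decide)).trans h0
  replace h1 := (f₁.1 21 (by decide)).trans h1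
  replace h8 := (f₁.1 28 (by decide)).trans h8
  refine Runs.mono (Runs.ite (T := 140) (fun hc => ?_) fun hc => ?_) (by decide) fun _ _ h => h
  · have hc' : m ≤ σ.f + 1 := by
      simp only [Test.holds_le, Expr.eval_reg, Expr.eval_hadd, Expr.eval_one, hp.r1, h1] at hc
      exact_mod_cast hc
    have hf : σ.f + 1 = m := by have := hv.f_lt; omega
    rw [if_neg (show ¬ (σ.f + 1 < m ∧ 1 ≤ σ.len) by omega)]
    refine Runs.mono (Runs.seq (P := fun s' => s'.reg 31 = X σ.cur (σ.f + 1))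
      (Prog.LoopFree.runs (T := 10) trivial (by decide) ?_) fun s₂ f₂ e₂ => ?_) (T := 10 + 60)
      (by decide) fun _ _ h => h
    · rw [hf, hX, show m - 1 = σ.f by omega]
      simp [Prog.result, e₁]
    · refine (acceptProg_runs (hp.of_frame f₂ (by decide)) (h.of_frame f₂ (by decide))
        (hE.of_frame f₂ (by decide)) hc').mono le_rfl fun s₃ f₃ e₃ => ⟨?_, ?_, e₃, ?_⟩
      · rw [f₃.1 30 (by decide), f₂.1 30 (by decide), e₁]
      · rw [f₃.1 31 (by decide), e₂]
      · exact (hq.of_frame f₂ (by decide)).of_frame f₃ (by decide)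
  · have hc' : σ.f + 1 < m := by
      simp only [Test.holds_le, Expr.eval_reg, Expr.eval_hadd, Expr.eval_one, hp.r1, h1] at hc
      exact_mod_cast not_le.1 hc
    rw [if_neg fun ha => by have := ha.1; omega]
    refine Runs.mono (Runs.seq (P := fun s' => s'.reg 31 = X σ.cur (σ.f + 1))
      (Prog.LoopFree.runs (T := 11) trivial (by decide) ?_) fun s₂ f₂ e₂ => ?_)
      (T := 11 + (3 + (80 + 40))) (by decide) fun _ _ h => h
    · have := natFloor_mul_add σ.cur m (σ.f + 1)
      rw [Nat.cast_add, Nat.cast_one] at this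
      simp only [Prog.result, State.setReg_reg, if_true, Expr.eval_load, Expr.eval_hadd,
        Expr.eval_hmul, Expr.eval_reg, Expr.eval_one, h0, h1, hp.r1, this]
      exact hp.data _ hv.cur_lt _ hc'
    replace h := h.of_frame f₂ (by decide)
    replace hq := hq.of_frame f₂ (by decide)
    replace hE := hE.of_frame f₂ (by decide)
    replace h8 := (f₂.1 28 (by decide)).trans h8
    replace e₁ := (f₂.1 30 (by decide)).trans e₁
    refine Runs.mono (Runs.ite (T := 80 + 40) (fun hl => ?_) fun hl => ?_) (by decide)
      fun _ _ h => h
    · have hl' : 1 ≤ σ.len := by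
        simp only [Test.holds_le, Expr.eval_reg, Expr.eval_one, h8] at hl
        exact_mod_cast hl
      rw [if_pos ⟨hc', hl'⟩]
      refine Runs.seq (buildAdvance_runs h e₂) fun s₃ f₃ e₃ => ?_
      refine (push_runs (hq.of_frame f₃ (by decide)) e₃).mono le_rfl
        fun s₄ f₄ e₄ => ⟨?_, ?_, ?_, e₄⟩
      · rw [f₄.1 30 (by decide), f₃.1 30 (by decide), e₁]
      · rw [f₄.1 31 (by decide), f₃.1 31 (by decide), e₂]
      · exact (hE.of_frame f₃ (by decide)).of_frame f₄ (by decide)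
    · have hl' : ¬ 1 ≤ σ.len := by
        simp only [Test.holds_le, Expr.eval_reg, Expr.eval_one, h8] at hl
        exact_mod_cast hl
      rw [if_neg fun h => hl' h.2]
      exact Prog.LoopFree.runs trivial (by decide) ⟨e₁, e₂, hE, hq⟩

/-- The work bound for a state. A state costs at most `1000`, and so does a candidate. -/
def work (m k K : ℕ) (σ : SearchState) : ℕ :=
  workBound 1000 (2 * (2 * K + 1)) (m - 1 - σ.f) (k - σ.len)

/-- The bound for the number of entries that arise from a state. -/
def leaves (m k K : ℕ) (σ : SearchState) : ℕ :=
  leafBound (2 * (2 * K + 1)) (m - 1 - σ.f) (k - σ.len)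

/-- The effect of processing the state `σ`: the states `new` are appended to the queue. -/
structure Expansion (X : ℕ → ℕ → ℝ) (m k K : ℕ) (ρ : ℝ) (B off : ℤ) (σ : SearchState)
    (new : List SearchState) : Prop where
  advance : σ.f + 1 < m → 1 ≤ σ.len → σ.advance X ∈ new
  emit : σ.len < k → ∀ t < 2 * (2 * K + 1), σ.CanEmit X ρ (σ.cand X K t) →
    σ.emit X ρ B off (σ.cand X K t) ∈ new
  sound : ∀ τ ∈ new, (σ.f + 1 < m ∧ 1 ≤ σ.len ∧ τ = σ.advance X) ∨
    (σ.len < k ∧ ∃ t < 2 * (2 * K + 1), σ.CanEmit X ρ (σ.cand X K t) ∧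
      τ = σ.emit X ρ B off (σ.cand X K t))

open Classical in
/-- Processing a state takes at most the time by which its work bound exceeds those of the new
states, and likewise for the number of entries. -/
theorem searchBody_runs (hX : ∀ i, X i m = X i (m - 1)) (hp : Params X n m k K ρ B off s)
    {E : List ℤ} {q : List SearchState} (hE : Entries E s) (hq : Queue q s) {i : ℕ}
    (hi : i < q.length) (h14 : s.reg 14 = i) (hv : q[i].Valid X n m k ρ B off) :
    ∃ T new, Expansion X m k K ρ B off q[i] new ∧ 4 + T + (new.map (work m k K)).sum ≤
        work m k K q[i] ∧
      (if q[i].Accepts m ρ then 1 else 0) + (new.map (leaves m k K)).sum ≤ leaves m k K q[i] ∧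
      Runs searchBody s T fun s' => s'.reg 14 = (i + 1 : ℕ) ∧
        Entries (if q[i].Accepts m ρ then E ++ [q[i].entry n] else E) s' ∧ Queue (q ++ new) s' := by
  set σ := q[i] with hσ
  have hf := hv.f_lt
  set adv : List SearchState := if σ.f + 1 < m ∧ 1 ≤ σ.len then [σ.advance X] else [] with hadv
  have hqadv : (if σ.f + 1 < m ∧ 1 ≤ σ.len then q ++ [σ.advance X] else q) = q ++ adv := by
    rw [hadv]; split_ifs <;> simp
  have advSound : ∀ τ ∈ adv, σ.f + 1 < m ∧ 1 ≤ σ.len ∧ τ = σ.advance X := by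
    intro τ hτ
    rw [hadv] at hτ
    split_ifs at hτ with h'
    · exact ⟨h'.1, h'.2, List.mem_singleton.1 hτ⟩
    · simp at hτ
  have advComp : σ.f + 1 < m → 1 ≤ σ.len → σ.advance X ∈ adv := fun h1 h2 => by
    rw [hadv, if_pos ⟨h1, h2⟩]; simp
  -- everything up to the loop over the candidates
  have h1 : Runs (loadFields 10 ;; moveProg) s (40 + 200) fun s' => Held 20 σ s' ∧
      s'.reg 30 = X σ.cur σ.f ∧ s'.reg 31 = X σ.cur (σ.f + 1) ∧
      Entries (if σ.Accepts m ρ then E ++ [σ.entry n] else E) s' ∧ Queue (q ++ adv) s' := by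
    refine Runs.seq (loadFields_runs hq hi h14) fun s₁ f₁ e₁ => ?_
    refine (moveProg_runs hX (hp.of_frame f₁ (by decide)) e₁ hv (hE.of_frame f₁ (by decide))
      (hq.of_frame f₁ (by decide))).mono le_rfl fun s₂ f₂ e₂ => ⟨e₁.of_frame f₂ (by decide), ?_⟩
    rw [hqadv] at e₂
    exact e₂
  obtain ⟨t₁, s₁, ht₁, he₁, hs₁, e30, e31, hE₁, hq₁⟩ := h1
  replace hp := hp.of_frame he₁.frame (by decide)
  have k14 : s₁.reg 14 = i := (he₁.frame.1 14 (by decide)).trans h14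
  cases he₁ with
  | @seq _ _ _ s₀ _ u₁ u₂ x₁ x₂ =>
  have htest : (Test.lt (reg 28) (reg 2)).holds s₁ ↔ σ.len < k := by
    simp only [Test.holds_lt, Expr.eval_reg, hp.r2, hs₁.regs.2.2.2.2.2.2.2.2.1]
    exact Nat.cast_lt
  -- it remains to compare the bounds in all the cases
  by_cases hl : σ.len < k
  · obtain ⟨t₂, s₂, ht₂, he₂, new, hq₂, hlen, hsound, hcomp⟩ :=
      expandCands_runs hp hs₁ e30 e31 hq₁
    have hlast : Runs (14 ≔ reg 14 + 1) s₂ 4 fun s' => s'.reg 14 = (i + 1 : ℕ) :=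
      Prog.LoopFree.runs trivial (by decide) (by
        simp [Prog.result, he₂.frame.1 14 (by decide), k14])
    obtain ⟨t₃, s₃, ht₃, he₃, hs₃⟩ := hlast
    have hfr : ∀ τ ∈ new, τ.f = σ.f ∧ τ.len = σ.len + 1 := by
      intro τ hτ
      obtain ⟨t, -, -, rfl⟩ := hsound τ hτ
      exact ⟨rfl, rfl⟩
    have hsum : ∀ (F : ℕ → ℕ → ℕ), (new.map fun τ => F τ.f τ.len).sum ≤
        2 * (2 * K + 1) * F σ.f (σ.len + 1) := by
      intro F
      calc (new.map fun τ => F τ.f τ.len).sum ≤ new.length • F σ.f (σ.len + 1) := by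
            rw [← List.length_map (f := fun τ : SearchState => F τ.f τ.len)]
            refine List.sum_le_card_nsmul _ _ ?_
            intro x hx
            obtain ⟨τ, hτ, rfl⟩ := List.mem_map.1 hx
            rw [(hfr τ hτ).1, (hfr τ hτ).2]
        _ ≤ _ := by
            rw [smul_eq_mul]
            exact Nat.mul_le_mul_right _ hlen
    refine ⟨40 + 200 + (4 + (2 * (2 * K + 1) * 410 + 10) + 4), adv ++ new,
      ⟨fun a b => List.mem_append_left _ (advComp a b),
        fun _ t ht hc => List.mem_append_right _ (hcomp t ht hc), fun τ hτ => ?_⟩, ?_, ?_, ?_⟩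
    · rcases List.mem_append.1 hτ with hτ | hτ
      · exact Or.inl (advSound τ hτ)
      · exact Or.inr ⟨hl, hsound τ hτ⟩
    · rw [List.map_append, List.sum_append]
      have := hsum fun f len => workBound 1000 (2 * (2 * K + 1)) (m - 1 - f) (k - len)
      refine le_trans (Nat.add_le_add_left (Nat.add_le_add_left this _) _) ?_
      simp only [work]
      obtain ⟨d, hd⟩ := Nat.exists_eq_add_of_lt hl
      rw [show k - σ.len = d + 1 by omega, show k - (σ.len + 1) = d by omega]
      by_cases hfm : σ.f + 1 < m
      · obtain ⟨a, ha⟩ : ∃ a, m - 1 - σ.f = a + 1 := ⟨m - 2 - σ.f, by omega⟩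
        have hadvsum : (adv.map (work m k K)).sum ≤ workBound 1000 (2 * (2 * K + 1)) a (d + 1) := by
          rw [hadv]
          split_ifs
          · simp only [work, SearchState.advance, List.map_cons, List.map_nil, List.sum_cons,
              List.sum_nil, add_zero]
            rw [show m - 1 - (σ.f + 1) = a by omega, show k - σ.len = d + 1 by omega]
          · simp
        rw [ha]
        have := workBound_advance_emit 1000 (2 * (2 * K + 1)) a d
        omega
      · have : adv = [] := by rw [hadv, if_neg fun h => hfm h.1]
        rw [this, show m - 1 - σ.f = 0 by omega]
        have := workBound_emit 1000 (2 * (2 * K + 1)) d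
        simp only [List.map_nil, List.sum_nil]
        omega
    · rw [List.map_append, List.sum_append]
      have := hsum fun f len => leafBound (2 * (2 * K + 1)) (m - 1 - f) (k - len)
      refine le_trans (Nat.add_le_add_left (Nat.add_le_add_left this _) _) ?_
      simp only [leaves]
      obtain ⟨d, hd⟩ := Nat.exists_eq_add_of_lt hl
      rw [show k - σ.len = d + 1 by omega, show k - (σ.len + 1) = d by omega]
      by_cases hfm : σ.f + 1 < m
      · obtain ⟨a, ha⟩ : ∃ a, m - 1 - σ.f = a + 1 := ⟨m - 2 - σ.f, by omega⟩
        have hadvsum : (adv.map (leaves m k K)).sum ≤ leafBound (2 * (2 * K + 1)) a (d + 1) := by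
          rw [hadv]
          split_ifs
          · simp only [leaves, SearchState.advance, List.map_cons, List.map_nil, List.sum_cons,
              List.sum_nil, add_zero]
            rw [show m - 1 - (σ.f + 1) = a by omega, show k - σ.len = d + 1 by omega]
          · simp
        rw [ha, if_neg fun h => by have := h.1; omega]
        have := leafBound_advance_emit (2 * (2 * K + 1)) a d
        omega
      · have : adv = [] := by rw [hadv, if_neg fun h => hfm h.1]
        rw [this, show m - 1 - σ.f = 0 by omega]
        have := leafBound_emit (2 * (2 * K + 1)) d
        simp only [List.map_nil, List.sum_nil]
        split_ifs <;> omega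
    · have hx : Exec (.ite (.lt (reg 28) (reg 2)) expandCands .skip) s₁ (4 + t₂) s₂ :=
        .iteTrue (htest.2 hl) he₂
      refine ⟨_, s₃, ?_, .seq x₁ (.seq x₂ (.seq hx he₃)), hs₃, ?_, ?_⟩
      · omega
      · exact (hE₁.of_frame he₂.frame (by decide)).of_frame he₃.frame (by decide)
      · rw [← List.append_assoc]
        exact hq₂.of_frame he₃.frame (by decide)
  · have hlast : Runs (14 ≔ reg 14 + 1) s₁ 4 fun s' => s'.reg 14 = (i + 1 : ℕ) :=
      Prog.LoopFree.runs trivial (by decide) (by simp [Prog.result, k14])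
    obtain ⟨t₃, s₃, ht₃, he₃, hs₃⟩ := hlast
    have hlen : k - σ.len = 0 := by omega
    refine ⟨40 + 200 + (4 + 1 + 4), adv, ⟨advComp, fun h => absurd h hl,
      fun τ hτ => Or.inl (advSound τ hτ)⟩, ?_, ?_, ?_⟩
    · simp only [work]
      rw [hlen]
      by_cases hfm : σ.f + 1 < m
      · obtain ⟨a, ha⟩ : ∃ a, m - 1 - σ.f = a + 1 := ⟨m - 2 - σ.f, by omega⟩
        have hadvsum : (adv.map (work m k K)).sum ≤ workBound 1000 (2 * (2 * K + 1)) a 0 := by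
          rw [hadv]
          split_ifs
          · simp only [work, SearchState.advance, List.map_cons, List.map_nil, List.sum_cons,
              List.sum_nil, add_zero]
            rw [show m - 1 - (σ.f + 1) = a by omega, hlen]
          · simp
        rw [ha]
        have := workBound_advance 1000 (2 * (2 * K + 1)) a
        omega
      · have : adv = [] := by rw [hadv, if_neg fun h => hfm h.1]
        rw [this, show m - 1 - σ.f = 0 by omega]
        have := workBound_zero 1000 (2 * (2 * K + 1))
        simp only [List.map_nil, List.sum_nil]
        omega
    · simp only [leaves]
      rw [hlen]
      by_cases hfm : σ.f + 1 < m
      · obtain ⟨a, ha⟩ : ∃ a, m - 1 - σ.f = a + 1 := ⟨m - 2 - σ.f, by omega⟩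
        have hadvsum : (adv.map (leaves m k K)).sum ≤ leafBound (2 * (2 * K + 1)) a 0 := by
          rw [hadv]
          split_ifs
          · simp only [leaves, SearchState.advance, List.map_cons, List.map_nil, List.sum_cons,
              List.sum_nil, add_zero]
            rw [show m - 1 - (σ.f + 1) = a by omega, hlen]
          · simp
        rw [ha, if_neg fun h => by have := h.1; omega]
        have := leafBound_advance (2 * (2 * K + 1)) a 0
        omega
      · have : adv = [] := by rw [hadv, if_neg fun h => hfm h.1]
        rw [this, show m - 1 - σ.f = 0 by omega]
        have := leafBound_pos (2 * (2 * K + 1)) 0 0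
        simp only [List.map_nil, List.sum_nil]
        split_ifs <;> omega
    · have hx : Exec (.ite (.lt (reg 28) (reg 2)) expandCands .skip) s₁ (4 + 1) s₁ :=
        .iteFalse (fun h => hl (htest.1 h)) (.skip _)
      refine ⟨_, s₃, ?_, .seq x₁ (.seq x₂ (.seq hx he₃)), hs₃, ?_, ?_⟩
      · omega
      · exact hE₁.of_frame he₃.frame (by decide)
      · exact hq₁.of_frame he₃.frame (by decide)

end Specs

end RealRAM

theorem VReach.last_mem {ι : Type*} {c : ι → ℝ} {X : ℕ → ℝ} {ρ : ℝ} {N : ℕ → ι → Prop} {a : ι}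
    {l : List ι} {f : ℕ} {h : ℝ} (H : VReach c X ρ N (a :: l) f h) : N f a := by
  cases H <;> assumption

theorem VReach.exists_of_mem {ι : Type*} {c : ι → ℝ} {X : ℕ → ℝ} {ρ : ℝ} {N : ℕ → ι → Prop}
    {l : List ι} {f : ℕ} {h : ℝ} (H : VReach c X ρ N l f h) : ∀ a ∈ l, ∃ f, N f a := by
  induction H with
  | init _ h =>
    intro b hb
    rw [List.mem_singleton.1 hb]
    exact ⟨_, h⟩
  | next _ _ _ _ h ih =>
    intro b hb
    rcases List.mem_cons.1 hb with hb | hb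
    · rw [hb]
      exact ⟨_, h⟩
    · exact ih b hb

/-- The list `E` consists of entries for matchings of curves with at most `k` vertices to time
series `X i`, and has all those whose vertices are within `δ` of those of `X i`. -/
structure IsEntryList (X : ℕ → ℕ → ℝ) (n m k : ℕ) (ρ δ : ℝ) (B off : ℤ) (E : List ℤ) : Prop where
  sound : ∀ e ∈ E, ∃ i < n, ∃ a l f h, e = encode B off (a :: l) * (n + 1) + i + 1 ∧
    VReach (fun z : ℤ => (z : ℝ)) (X i) ρ (SearchState.Allowed m B off) (a :: l) f h ∧
    ∀ p, f < p → p < m → |X i p - a| ≤ ρ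
  complete : ∀ i < n, ∀ a l f h, (a :: l).length ≤ k →
    VReach (fun z : ℤ => (z : ℝ)) (X i) ρ (NearEdge (X i) m δ) (a :: l) f h →
    (∀ p, f < p → p < m → |X i p - a| ≤ ρ) → encode B off (a :: l) * (n + 1) + i + 1 ∈ E
  range : ∀ i < n, ∀ f a, NearEdge (X i) m δ f a → 1 ≤ a + off ∧ a + off < B

namespace RealRAM

open _root_.RealRAM.Expr (reg load floor)
open _root_.RealRAM.Prog (store)

variable {X : ℕ → ℕ → ℝ} {n m k K : ℕ} {ρ δ : ℝ} {B off : ℤ} {s : State}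

open Classical in
/-- The queue splits into the states `d` that have been processed and the pending states `p`. The
sum of the work bounds of the pending states decreases by at least the time that is spent. -/
theorem search_runs (hρ : 0 ≤ ρ) (hm : 0 < m) (hX : ∀ i, X i m = X i (m - 1))
    (hB : ∀ σ : SearchState, σ.cur < n → σ.f < m → ∀ t < 2 * (2 * K + 1),
      1 ≤ σ.cand X K t + off ∧ σ.cand X K t + off < B) (hδ : δ + 1 ≤ K)
    (hp : Params X n m k K ρ B off s) (hE : Entries [] s)
    (hq : Queue ((List.range n).map (SearchState.init X)) s) (h14 : s.reg 14 = 0) :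
    Runs search s (n * workBound 1000 (2 * (2 * K + 1)) (m - 1) k + 4) fun s' =>
      ∃ E, Entries E s' ∧ IsEntryList X n m k ρ δ B off E ∧
        E.length ≤ n * leafBound (2 * (2 * K + 1)) (m - 1) k := by
  set q₀ := (List.range n).map (SearchState.init X) with hq₀
  have hinit : ∀ σ ∈ q₀, σ.Valid X n m k ρ B off := by
    intro σ hσ
    obtain ⟨i, hi, rfl⟩ := List.mem_map.1 hσ
    exact SearchState.valid_init (List.mem_range.1 hi) hm
  obtain ⟨t, s', φ', h1, h2, ⟨d, p, E, hQ, h14, hE, hv, hd, hsub, hEs, hEc, hW, hL⟩, h4⟩ :=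
    exec_while (b := .lt (reg 14) (reg 15)) (c := searchBody) (fun φ s' => ∃ d p E,
      Queue (d ++ p) s' ∧ s'.reg 14 = d.length ∧ Entries E s' ∧
      (∀ σ ∈ d ++ p, σ.Valid X n m k ρ B off) ∧
      (∀ σ ∈ d, (σ.f + 1 < m → 1 ≤ σ.len → σ.advance X ∈ d ++ p) ∧
        (σ.len < k → ∀ t < 2 * (2 * K + 1), σ.CanEmit X ρ (σ.cand X K t) →
          σ.emit X ρ B off (σ.cand X K t) ∈ d ++ p)) ∧
      (∀ σ ∈ q₀, σ ∈ d ++ p) ∧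
      (∀ e ∈ E, ∃ σ ∈ d, σ.Accepts m ρ ∧ e = σ.entry n) ∧
      (∀ σ ∈ d, σ.Accepts m ρ → σ.entry n ∈ E) ∧
      (Params X n m k K ρ B off s' ∧ (p.map (work m k K)).sum ≤ φ) ∧
      E.length + (p.map (leaves m k K)).sum ≤ (q₀.map (leaves m k K)).sum) (by
    rintro φ s ⟨d, p, E, hQ, h14, hE, hv, hd, hsub, hEs, hEc, ⟨hp, hW⟩, hL⟩ hb
    have hlt : d.length < (d ++ p).length := by
      simp only [Test.holds_lt, Expr.eval_reg, h14, hQ.2] at hb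
      exact_mod_cast hb
    obtain ⟨σ, p, rfl⟩ : ∃ σ p', p = σ :: p' := by
      cases p with
      | nil => simp at hlt
      | cons σ p' => exact ⟨σ, p', rfl⟩
    have hσ : (d ++ σ :: p)[d.length] = σ := by simp
    obtain ⟨T, new, hexp, hT, hl, t, s', ht, he, h14', hE', hQ'⟩ := searchBody_runs hX hp hE hQ hlt
      h14 (by rw [hσ]; exact hv σ (by simp))
    rw [hσ] at hexp hT hl hE'
    have hVσ := hv σ (by simp)
    rw [List.map_cons, List.sum_cons] at hW hL
    have eapp : d ++ σ :: p ++ new = (d ++ [σ]) ++ (p ++ new) := by simp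
    refine ⟨t, s', _, he, ⟨d ++ [σ], p ++ new,
      if σ.Accepts m ρ then E ++ [σ.entry n] else E, ?_, ?_, hE', ?_, ?_, ?_, ?_, ?_,
      ⟨hp.of_frame he.frame (by decide), le_rfl⟩, ?_⟩, ?_⟩
    · rw [← eapp]; exact hQ'
    · rw [h14']; simp
    · intro τ hτ
      rw [← eapp] at hτ
      rcases List.mem_append.1 hτ with hτ | hτ
      · exact hv τ hτ
      · rcases hexp.sound τ hτ with ⟨i1, i2, rfl⟩ | ⟨i1, t, i2, i3, rfl⟩
        · exact hVσ.advance i1 i2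
        · exact hVσ.emit hρ i1 (hB σ hVσ.cur_lt hVσ.f_lt t i2) i3
    · rw [← eapp]
      intro τ hτ
      rcases List.mem_append.1 hτ with hτ | hτ
      · exact ⟨fun i1 i2 => List.mem_append_left _ ((hd τ hτ).1 i1 i2),
          fun i1 t i2 i3 => List.mem_append_left _ ((hd τ hτ).2 i1 t i2 i3)⟩
      · rw [List.mem_singleton.1 hτ]
        exact ⟨fun i1 i2 => List.mem_append_right _ (hexp.advance i1 i2),
          fun i1 t i2 i3 => List.mem_append_right _ (hexp.emit i1 t i2 i3)⟩
    · rw [← eapp]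
      exact fun τ hτ => List.mem_append_left _ (hsub τ hτ)
    · intro e he
      have hold : ∀ e ∈ E, ∃ τ ∈ d ++ [σ], τ.Accepts m ρ ∧ e = τ.entry n := fun e he => by
        obtain ⟨τ, h1, h2⟩ := hEs e he
        exact ⟨τ, List.mem_append_left _ h1, h2⟩
      split_ifs at he with ha
      · rcases List.mem_append.1 he with he | he
        · exact hold e he
        · exact ⟨σ, by simp, ha, List.mem_singleton.1 he⟩
      · exact hold e he
    · intro τ hτ ha
      rcases List.mem_append.1 hτ with hτ | hτ
      · have := hEc τ hτ ha
        split_ifs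
        · exact List.mem_append_left _ this
        · exact this
      · rw [List.mem_singleton.1 hτ] at ha ⊢
        rw [if_pos ha]
        simp
    · rw [List.map_append, List.sum_append]
      split_ifs at hl ⊢
      · rw [List.length_append, List.length_singleton]
        omega
      · omega
    · rw [List.map_append, List.sum_append, cost_lt_reg]
      omega) (q₀.map (work m k K)).sum s
    ⟨[], q₀, [], hq, by simpa using h14, hE, hinit, by simp, by simp, by simp, by simp,
      ⟨hp, le_rfl⟩, by simp⟩
  have hsumW : ∀ F : SearchState → ℕ, ∀ c, (∀ i, F (SearchState.init X i) = c) →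
      (q₀.map F).sum = n * c := by
    intro F c hc
    rw [hq₀, List.map_map, List.map_congr_left (f := F ∘ SearchState.init X) (g := fun _ => c)
      fun i _ => hc i]
    simp
  rw [hsumW (work m k K) (workBound 1000 (2 * (2 * K + 1)) (m - 1) k) fun i => rfl,
    cost_lt_reg] at h2
  rw [hsumW (leaves m k K) (leafBound (2 * (2 * K + 1)) (m - 1) k) fun i => rfl] at hL
  have hp0 : p = [] := by
    simp only [Test.holds_lt, Expr.eval_reg, h14, hQ.2, List.length_append, Nat.cast_lt] at h4
    exact List.eq_nil_of_length_eq_zero (by omega)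
  subst hp0
  simp only [List.append_nil, List.map_nil, List.sum_nil, add_zero] at hQ hv hd hsub hL
  refine ⟨t, s', h2, h1, E, hE, ⟨fun e he => ?_, ?_, ?_⟩, hL⟩
  · obtain ⟨σ, hσ, ha, rfl⟩ := hEs e he
    obtain ⟨a, l, f, h, i1, i2, i3⟩ := (hv σ hσ).abs_sub_le ha
    exact ⟨σ.cur, (hv σ hσ).cur_lt, a, l, f, h, by rw [SearchState.entry, i1], i2, i3⟩
  · intro i hi a l f h hlen hv' hlast
    have hf := hv'.last_mem.1
    obtain ⟨σ, hσ, j1, j2, j3, j4, j5, -, j6⟩ := SearchState.exists_state_of_vreach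
      (Q := {σ | σ ∈ d}) (n := n) hρ hδ
      (fun i hi => hsub _ (List.mem_map.2 ⟨i, List.mem_range.2 hi, rfl⟩))
      (fun σ hσ => (hd σ hσ).1) (fun σ hσ => (hd σ hσ).2) hi hv' hlen (m - 1) (by omega) (by omega)
    have : σ.entry n = encode B off (a :: l) * (n + 1) + i + 1 := by
      rw [SearchState.entry, j5, j1]
    rw [← this]
    refine hEc σ hσ ⟨by omega, by rw [j4]; simp, ?_, ?_⟩
    · rw [j3, j6.mx_le_iff]
      exact ⟨by linarith, fun p hp hp' => by linarith [(abs_le.1 (hlast p hp (by omega))).2]⟩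
    · rw [j3, j6.le_mn_iff]
      exact ⟨by linarith, fun p hp hp' => by linarith [(abs_le.1 (hlast p hp (by omega))).1]⟩
  · intro i hi f a ha
    let σ : SearchState := { SearchState.init X i with f := f }
    obtain ⟨t, ht, e⟩ := SearchState.exists_cand (X := X) (s := σ) hδ ha
    rw [← e]
    exact hB σ hi ha.1 t ht

end RealRAM

namespace RealRAM

open _root_.RealRAM.Expr (reg load floor)
open _root_.RealRAM.Prog (store)

/-- The time series `Y` with `m` vertices, in units of `g`, and continued with its last vertex. -/
noncomputable def scaled (m : ℕ) (g : ℝ) (Y : ℕ → ℕ → ℝ) (i p : ℕ) : ℝ := Y i (min p (m - 1)) / g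

/-- Computes the parameters of the search: `49` is the base `n + 1` of the entries, `5` is the unit
`g`, `6` is `ρ`, `7` is the radius `K` of the candidates, and `8` and `9` are their numbers for one
end and for both ends of an edge. -/
def setParams : Prog :=
  49 ≔ reg 0 + 1 ;; 5 ≔ reg 3 * reg 4 / 16 ;; 6 ≔ 16 / reg 3 + 2 ;; 7 ≔ floor (48 / reg 3) + 8 ;;
  8 ≔ 2 * reg 7 + 1 ;; 9 ≔ 2 * reg 8 ;; 10 ≔ 0 ;; 12 ≔ 0 ;; 13 ≔ reg 0 * reg 1

/-- Scales one value, and adds its square to register `10`. -/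
def scaleBody : Prog :=
  36 ≔ load 0 (reg 12) / reg 5 ;; store 1 (reg 12) (reg 36) ;; 10 ≔ reg 10 + reg 36 * reg 36 ;;
  12 ≔ reg 12 + 1

/-- Computes the offset and the base of the codes from the sum of the squares of all the vertices,
which bounds all of them without comparisons, and initializes the queue, the list of entries and the
base of the dictionary. -/
def setBase : Prog :=
  10 ≔ floor (reg 10) + reg 7 + 4 ;; 11 ≔ 2 * reg 10 ;; 12 ≔ 0 ;; 14 ≔ 0 ;; 15 ≔ 0 ;; 16 ≔ 0 ;;
  43 ≔ 2

/-- Computes the initial state for the time series whose index is in register `12`. -/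
def buildInit : Prog :=
  30 ≔ load 1 (reg 12 * reg 1) ;; 70 ≔ reg 12 ;; 71 ≔ 0 ;; 72 ≔ reg 30 ;; 73 ≔ reg 30 ;;
  74 ≔ reg 30 ;; 75 ≔ reg 30 ;; 76 ≔ 0 ;; 77 ≔ 0 ;; 78 ≔ 0 ;; 79 ≔ 0

/-- Prepares the search. -/
def setup : Prog :=
  setParams ;; .while (.lt (reg 12) (reg 13)) scaleBody ;; setBase ;;
  .while (.lt (reg 12) (reg 0)) (buildInit ;; push ;; 12 ≔ reg 12 + 1)

theorem abs_le_sq_add_one (x : ℝ) : |x| ≤ x ^ 2 + 1 := by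
  nlinarith [sq_nonneg (|x| - 1), sq_abs x, abs_nonneg x]

theorem cand_bounds {X : ℕ → ℕ → ℝ} {K : ℕ} {A : ℝ} {σ : SearchState}
    (hA : ∀ p, |X σ.cur p| ≤ A + 1) {t : ℕ} (ht : t < 2 * (2 * K + 1)) :
    1 ≤ σ.cand X K t + (⌊A⌋ + K + 4) ∧ σ.cand X K t + (⌊A⌋ + K + 4) < 2 * (⌊A⌋ + K + 4) := by
  have aux : ∀ p, -⌊A⌋ - 2 ≤ ⌊X σ.cur p⌋ ∧ ⌊X σ.cur p⌋ ≤ ⌊A⌋ + 2 := by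
    intro p
    have h1 := abs_le.1 (hA p)
    have h2 := Int.lt_floor_add_one A
    constructor
    · rw [Int.le_floor]
      push_cast
      linarith
    · have : ⌊X σ.cur p⌋ < ⌊A⌋ + 3 := by
        rw [Int.floor_lt]
        push_cast
        linarith
      omega
  have h1 := aux σ.f
  have h2 := aux (σ.f + 1)
  unfold SearchState.cand
  split_ifs with h
  · omega
  · omega

theorem natCast_mul_add_lt {n m i p : ℕ} (hi : i < n) (hp : p < m) : i * m + p < n * m :=
  calc i * m + p < i * m + m := by omega
    _ = (i + 1) * m := by ring
    _ ≤ n * m := Nat.mul_le_mul_right m hi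

theorem setup_runs {n m k : ℕ} {ε r : ℝ} {Y : ℕ → ℕ → ℝ} {s : State} (hm : 0 < m) (hε : 0 < ε)
    (h0 : s.reg 0 = n) (h1 : s.reg 1 = m) (h2 : s.reg 2 = k) (h3 : s.reg 3 = ε) (h4 : s.reg 4 = r)
    (hY : ∀ i < n, ∀ p < m, s.arr 0 (i * m + p) = Y i p) :
    Runs setup s (n * m * 40 + n * 140 + 200) fun s' => ∃ off : ℤ,
      Params (scaled m (ε * r / 16) Y) n m k (⌊48 / ε⌋₊ + 8) (16 / ε + 2) (2 * off) off s' ∧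
      Entries [] s' ∧
      Queue ((List.range n).map (SearchState.init (scaled m (ε * r / 16) Y))) s' ∧
      s'.reg 14 = 0 ∧ s'.reg 5 = ε * r / 16 ∧
      ∀ σ : SearchState, σ.cur < n → σ.f < m → ∀ t < 2 * (2 * (⌊48 / ε⌋₊ + 8) + 1),
        1 ≤ σ.cand (scaled m (ε * r / 16) Y) (⌊48 / ε⌋₊ + 8) t + off ∧
        σ.cand (scaled m (ε * r / 16) Y) (⌊48 / ε⌋₊ + 8) t + off < 2 * off := by
  set g := ε * r / 16 with hg
  set K := ⌊48 / ε⌋₊ + 8 with hK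
  set X := scaled m g Y with hX
  have hfl : (⌊48 / ε⌋ : ℤ) = (⌊48 / ε⌋₊ : ℕ) := (Int.natCast_floor_eq_floor (by positivity)).symm
  refine Runs.mono (T := 80 + ((n * m * (30 + 4) + 4) + (40 + (n * (40 + (40 + 10) + 4) + 4))))
    (Q := _) ?_ (by omega) fun _ _ h => h
  refine Runs.seq (P := fun s' => s'.reg 49 = n + 1 ∧ s'.reg 5 = g ∧ s'.reg 6 = 16 / ε + 2 ∧
    s'.reg 7 = K ∧ s'.reg 8 = 2 * K + 1 ∧ s'.reg 9 = (2 * (2 * K + 1) : ℕ) ∧ s'.reg 10 = 0 ∧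
    s'.reg 12 = 0 ∧ s'.reg 13 = (n * m : ℕ))
    (Prog.LoopFree.runs (by simp [setParams, Prog.LoopFree]) (by decide) ?_)
    fun s₁ f₁ ⟨a49, a5, a6, a7, a8, a9, a10, a12, a13⟩ => ?_
  · simp [setParams, Prog.result, h0, h1, h3, h4, hg, hfl, hK]
  set A : ℝ := ∑ l ∈ Finset.range (n * m), (s.arr 0 l / g) ^ 2 with hA
  refine Runs.seq (Runs.for (T := 30) (n * m) (fun l s' => s'.reg 12 = l ∧
    (∀ l' < l, s'.arr 1 l' = s.arr 0 l' / g) ∧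
    s'.reg 10 = ∑ l' ∈ Finset.range l, (s.arr 0 l' / g) ^ 2) ?_ ?_ ?_)
    fun s₂ f₂ ⟨b12, b1, b10⟩ => ?_
  · exact ⟨by simpa using a12, by simp, by simpa using a10⟩
  · intro l s' _ hl f
    simp only [Test.holds_lt, Expr.eval_reg, hl.1, f.1 13 (by decide), a13]
    exact Nat.cast_lt
  · rintro l s' hl ⟨c12, c1, c10⟩ f
    have c5 : s'.reg 5 = g := (f.1 5 (by decide)).trans a5
    have c0 : s'.arr 0 = s.arr 0 := (f.2 0 (by decide)).trans (f₁.2 0 (by decide))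
    refine Prog.LoopFree.runs (by simp [scaleBody, Prog.LoopFree]) (by decide) ⟨?_, ?_, ?_⟩
    · simp [scaleBody, Prog.result, c12]
    · intro l' hl'
      simp only [scaleBody, Prog.result, State.setReg_arr, State.setCell_arr, if_true,
        Expr.eval_reg, State.setReg_reg, c12, show ¬ (12 = 36) by decide, if_false,
        Nat.floor_natCast, Function.update_apply, Expr.eval_hdiv, Expr.eval_load, c5, c0]
      split_ifs with h
      · rw [h]
      · exact c1 l' (by omega)
    · rw [Finset.sum_range_succ, ← c10]
      simp [scaleBody, Prog.result, c12, c5, c0, pow_two]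
  set off : ℤ := ⌊A⌋ + K + 4 with hoff
  refine Runs.seq (P := fun s' => s'.reg 10 = off ∧ s'.reg 11 = (2 * off : ℤ) ∧ s'.reg 12 = 0 ∧
    s'.reg 14 = 0 ∧ s'.reg 15 = 0 ∧ s'.reg 16 = 0 ∧ s'.reg 43 = 2)
    (Prog.LoopFree.runs (by simp [setBase, Prog.LoopFree]) (by decide) ?_)
    fun s₃ f₃ ⟨d10, d11, d12, d14, d15, d16, d43⟩ => ?_
  · have b7 : s₂.reg 7 = K := (f₂.1 7 (by decide)).trans a7
    simp only [Finset.sum_range] at b10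
    simp [setBase, Prog.result, b10, b7, hoff, hA, Finset.sum_range]
  have hscale : ∀ i < n, ∀ p < m, s.arr 0 (i * m + p) / g = X i p := by
    intro i hi p hp
    rw [hY i hi p hp, hX, scaled, min_eq_left (by omega)]
  have hp : Params X n m k K (16 / ε + 2) (2 * off) off s₃ :=
    { r1 := by rw [f₃.1 1 (by decide), f₂.1 1 (by decide), f₁.1 1 (by decide), h1]
      r2 := by rw [f₃.1 2 (by decide), f₂.1 2 (by decide), f₁.1 2 (by decide), h2]
      r6 := by rw [f₃.1 6 (by decide), f₂.1 6 (by decide), a6]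
      r7 := by rw [f₃.1 7 (by decide), f₂.1 7 (by decide), a7]
      r8 := by rw [f₃.1 8 (by decide), f₂.1 8 (by decide), a8]
      r9 := by rw [f₃.1 9 (by decide), f₂.1 9 (by decide), a9]
      r10 := d10
      r11 := d11
      r49 := by rw [f₃.1 49 (by decide), f₂.1 49 (by decide), a49]
      data := fun i hi p hp => by
        rw [f₃.2 1 (by decide), b1 _ (natCast_mul_add_lt hi hp), hscale i hi p hp] }
  have e0 : s₃.reg 0 = n := by
    rw [f₃.1 0 (by decide), f₂.1 0 (by decide), f₁.1 0 (by decide), h0]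
  have e5 : s₃.reg 5 = g := by rw [f₃.1 5 (by decide), f₂.1 5 (by decide), a5]
  refine Runs.mono (Runs.for (T := 40 + (40 + 10)) n (fun i s' => s'.reg 12 = i ∧
    Queue ((List.range i).map (SearchState.init X)) s') ?_ ?_ ?_)
    (by rw [cost_lt_reg]) fun s₄ f₄ h₄ => ⟨off, hp.of_frame f₄ (by decide), ?_, h₄.2, ?_, ?_, ?_⟩
  · exact ⟨by simpa using d12, by simp, by simpa using d15⟩
  · intro i s' _ hi f
    simp only [Test.holds_lt, Expr.eval_reg, hi.1, f.1 0 (by decide), e0]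
    exact Nat.cast_lt
  · rintro i s' hi ⟨c12, cq⟩ f
    replace hp := hp.of_frame f (by decide)
    have hd := hp.data i hi 0 hm
    refine Runs.seq (P := Held 70 (SearchState.init X i)) (Prog.LoopFree.runs
      (by simp [buildInit, Prog.LoopFree]) (by decide) fun j hj => ?_) fun s₄ f₄ e₄ => ?_
    · have := natFloor_mul_add i m 0
      rw [Nat.cast_zero, add_zero] at this
      interval_cases j <;>
      simp [buildInit, Prog.result, SearchState.field, SearchState.init, c12, hp.r1, this] <;>
      simpa using hd
    · refine Runs.seq (push_runs (cq.of_frame f₄ (by decide)) e₄) fun s₅ f₅ e₅ => ?_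
      have c12' : s₅.reg 12 = i := by rw [f₅.1 12 (by decide), f₄.1 12 (by decide), c12]
      refine (Prog.LoopFree.runs (c := 12 ≔ reg 12 + 1) (P := fun s' => s'.reg 12 = (i + 1 : ℕ))
        trivial (by decide)
        (by simp [Prog.result, c12'])).mono le_rfl fun s₆ f₆ e₆ => ⟨e₆, ?_⟩
      rw [List.range_succ, List.map_append]
      exact e₅.of_frame f₆ (by decide)
  · exact ⟨by simp, by rw [f₄.1 16 (by decide), d16]; simp, by rw [f₄.1 43 (by decide), d43]; simp⟩
  · rw [f₄.1 14 (by decide), d14]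
  · rw [f₄.1 5 (by decide), e5]
  · intro σ hσ _ t ht
    suffices hb : ∀ p, |X σ.cur p| ≤ A + 1 from cand_bounds hb ht
    intro p
    have hle : (X σ.cur p) ^ 2 ≤ A := by
      have hmin : min p (m - 1) < m := by omega
      have e : X σ.cur p = X σ.cur (min p (m - 1)) := by
        rw [hX, scaled, scaled, min_assoc, min_self]
      rw [e, ← hscale _ hσ _ hmin]
      exact Finset.single_le_sum (f := fun l => (s.arr 0 l / g) ^ 2) (fun _ _ => sq_nonneg _)
        (Finset.mem_range.2 (natCast_mul_add_lt hσ hmin))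
    linarith [abs_le_sq_add_one (X σ.cur p)]

end RealRAM

/-! ### Building the dictionary -/

namespace RealRAM

open _root_.RealRAM.Expr (reg load floor)
open _root_.RealRAM.Prog (store)

/-- The powers of the base `b` that are needed for a table with `L * L` places. -/
def PowerTables (b : ℤ) (L : ℕ) (s : State) : Prop :=
  ∀ c < L, s.arr 0 (10 + c) = (b : ℝ) ^ c ∧ s.arr 0 (10 + L + c) = (b : ℝ) ^ (L * c)

theorem PowerTables.of_frame {c : Prog} {b : ℤ} {L : ℕ} {s s' : State} (h : PowerTables b L s)
    (hf : Frame c s s') (hc : 0 ∉ c.writesArr) : PowerTables b L s' :=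
  fun i hi => by rw [hf.2 0 hc]; exact h i hi

/-- Computes the table of powers, with the base in register `43`, for `4 * (N + 1)` rows and
columns, where `N` is the number of entries. -/
def powerProg : Prog :=
  (44 ≔ 4 * (reg 16 + 1) ;; 47 ≔ 1 ;; 12 ≔ 0) ;;
  .while (.lt (reg 12) (reg 44))
    (store 0 (10 + reg 12) (reg 47) ;; 47 ≔ reg 47 * reg 43 ;; 12 ≔ reg 12 + 1) ;;
  (48 ≔ 1 ;; 12 ≔ 0) ;;
  .while (.lt (reg 12) (reg 44))
    (store 0 (10 + reg 44 + reg 12) (reg 48) ;; 48 ≔ reg 48 * reg 47 ;; 12 ≔ reg 12 + 1)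

theorem natFloor_ofNat_add (a b : ℕ) [a.AtLeastTwo] : ⌊(ofNat(a) : ℝ) + b⌋₊ = a + b := by
  have := Nat.floor_natCast (R := ℝ) (a + b)
  rw [Nat.cast_add] at this
  exact this

theorem powerProg_runs {b : ℤ} {N : ℕ} {s : State} (h16 : s.reg 16 = N) (h43 : s.reg 43 = b) :
    Runs powerProg s (4 * (N + 1) * 60 + 60) fun s' => s'.reg 44 = (4 * (N + 1) : ℕ) ∧
      PowerTables b (4 * (N + 1)) s' := by
  set L := 4 * (N + 1) with hL
  refine Runs.mono (T := 20 + ((L * (26 + 4) + 4) + (20 + (L * (26 + 4) + 4)))) ?_ (by omega)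
    fun _ _ h => h
  refine Runs.seq (P := fun s' => s'.reg 44 = L ∧ s'.reg 47 = 1 ∧ s'.reg 12 = 0)
    (Prog.LoopFree.runs (by simp [Prog.LoopFree]) (by decide) (by simp [Prog.result, h16, hL]))
    fun s₁ f₁ ⟨a44, a47, a12⟩ => ?_
  have a43 : s₁.reg 43 = b := (f₁.1 43 (by decide)).trans h43
  refine Runs.seq (Runs.for (T := 26) L (fun c s' => s'.reg 12 = c ∧ s'.reg 47 = (b : ℝ) ^ c ∧
    ∀ c' < c, s'.arr 0 (10 + c') = (b : ℝ) ^ c') ?_ ?_ ?_) fun s₂ f₂ ⟨b12, b47, b0⟩ => ?_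
  · exact ⟨by simpa using a12, by simpa using a47, by simp⟩
  · intro c s' _ hc f
    simp only [Test.holds_lt, Expr.eval_reg, hc.1, f.1 44 (by decide), a44]
    exact Nat.cast_lt
  · rintro c s' hc ⟨c12, c47, c0⟩ f
    have c43 : s'.reg 43 = b := (f.1 43 (by decide)).trans a43
    refine Prog.LoopFree.runs (by simp [Prog.LoopFree]) (by decide) ⟨?_, ?_, ?_⟩
    · simp [Prog.result, c12]
    · simp [Prog.result, c47, c43, pow_succ]
    · intro c' hc'
      simp only [Prog.result, State.setReg_arr, State.setCell_arr, if_true, Expr.eval_hadd,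
        Expr.eval_reg, Expr.eval_ofNat, c12, natFloor_ofNat_add, Function.update_apply, c47]
      split_ifs with h
      · rw [Nat.add_left_cancel h]
      · exact c0 c' (by omega)
  have b44 : s₂.reg 44 = L := (f₂.1 44 (by decide)).trans a44
  refine Runs.seq (P := fun s' => s'.reg 48 = 1 ∧ s'.reg 12 = 0)
    (Prog.LoopFree.runs (by simp [Prog.LoopFree]) (by decide) (by simp [Prog.result]))
    fun s₃ f₃ ⟨d48, d12⟩ => ?_
  have d44 : s₃.reg 44 = L := (f₃.1 44 (by decide)).trans b44
  have d47 : s₃.reg 47 = (b : ℝ) ^ L := (f₃.1 47 (by decide)).trans b47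
  have d0 : s₃.arr 0 = s₂.arr 0 := f₃.2 0 (by decide)
  refine Runs.mono (Runs.for (T := 26) L (fun c s' => s'.reg 12 = c ∧
    s'.reg 48 = (b : ℝ) ^ (L * c) ∧ (∀ c' < L, s'.arr 0 (10 + c') = (b : ℝ) ^ c') ∧
    ∀ c' < c, s'.arr 0 (10 + L + c') = (b : ℝ) ^ (L * c')) ?_ ?_ ?_) le_rfl
    fun s₄ f₄ h₄ => ⟨(f₄.1 44 (by decide)).trans d44, fun c hc => ⟨h₄.2.2.1 c hc, h₄.2.2.2 c hc⟩⟩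
  · exact ⟨by simpa using d12, by simpa using d48, by rwa [d0], by simp⟩
  · intro c s' _ hc f
    simp only [Test.holds_lt, Expr.eval_reg, hc.1, f.1 44 (by decide), d44]
    exact Nat.cast_lt
  · rintro c s' hc ⟨c12, c48, c0, c1⟩ f
    have c47 : s'.reg 47 = (b : ℝ) ^ L := (f.1 47 (by decide)).trans d47
    have c44 : s'.reg 44 = L := (f.1 44 (by decide)).trans d44
    have hidx : ⌊(10 : ℝ) + L + c⌋₊ = 10 + L + c := by
      rw [add_assoc, ← Nat.cast_add, natFloor_ofNat_add, add_assoc]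
    refine Prog.LoopFree.runs (by simp [Prog.LoopFree]) (by decide) ⟨?_, ?_, ?_, ?_⟩
    · simp [Prog.result, c12]
    · simp [Prog.result, c47, c48, ← pow_add, mul_add]
    · intro c' hc'
      simp only [Prog.result, State.setReg_arr, State.setCell_arr, if_true, Expr.eval_hadd,
        Expr.eval_reg, Expr.eval_ofNat, c12, c44, hidx, Function.update_apply, c48]
      rw [if_neg (by omega), c0 c' hc']
    · intro c' hc'
      simp only [Prog.result, State.setReg_arr, State.setCell_arr, if_true, Expr.eval_hadd,
        Expr.eval_reg, Expr.eval_ofNat, c12, c44, hidx, Function.update_apply, c48]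
      split_ifs with h
      · rw [Nat.add_left_cancel h]
      · exact c1 c' (by omega)

/-- A hash function `a` and a table `W` in base `b` in the registers, along with the tables of
powers. -/
structure DictRegs (b : ℤ) (L : ℕ) (a : ℝ) (W : ℤ) (s : State) : Prop where
  r41 : s.reg 41 = a
  r42 : s.reg 42 = W
  r43 : s.reg 43 = b
  r44 : s.reg 44 = L
  tables : PowerTables b L s

/-- Finds the entry at the place of the key in register `40`, and writes it to register `45`, and
the power of the base for this place to register `52`. -/
def lookup : Prog :=
  (46 ≔ reg 44 * (reg 41 * reg 40 - floor (reg 41 * reg 40)) ;; 47 ≔ floor (reg 46) ;;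
    48 ≔ floor (reg 44 * (reg 46 - reg 47))) ;;
  52 ≔ load 0 (10 + reg 48) * load 0 (10 + (reg 44 + reg 47)) ;;
  45 ≔ floor (reg 42 / reg 52) - reg 43 * floor (reg 42 / (reg 52 * reg 43))

theorem lookup_runs {b : ℤ} {L : ℕ} {a : ℝ} {W x : ℤ} {s : State} (hb : 0 < b) (hL : 0 < L)
    (h : DictRegs b L a W s) (h40 : s.reg 40 = x) :
    Runs lookup s 80 fun s' => s'.reg 52 = (b : ℝ) ^ bucket L a x ∧
      s'.reg 45 = digit b W (bucket L a x) := by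
  have hL' : (0 : ℝ) ≤ L := Nat.cast_nonneg L
  set z := (L : ℝ) * Int.fract (a * x) with hz
  have hz0 : 0 ≤ z := mul_nonneg hL' (Int.fract_nonneg _)
  have hy0 : 0 ≤ (L : ℝ) * Int.fract z := mul_nonneg hL' (Int.fract_nonneg _)
  refine Runs.mono (T := 30 + (20 + 20)) (Q := _) ?_ (by decide) fun _ _ h => h
  refine Runs.seq (P := fun s' => s'.reg 47 = ⌊z⌋₊ ∧ s'.reg 48 = ⌊(L : ℝ) * Int.fract z⌋₊)
    (Prog.LoopFree.runs (by simp [Prog.LoopFree]) (by decide) ?_) fun s₁ f₁ ⟨a47, a48⟩ => ?_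
  · rw [natCast_floor_eq_intCast_floor hz0, natCast_floor_eq_intCast_floor hy0]
    simp [Prog.result, h.r44, h.r41, h40, hz]
  have a0 : s₁.arr 0 = s.arr 0 := f₁.2 0 (by decide)
  have a44 : s₁.reg 44 = L := (f₁.1 44 (by decide)).trans h.r44
  refine Runs.seq (P := fun s' => s'.reg 52 = (b : ℝ) ^ bucket L a x)
    (Prog.LoopFree.runs (by simp [Prog.LoopFree]) (by decide) ?_) fun s₂ f₂ a52 => ?_
  · have hcol := floor_mul_fract_lt hL z
    have hrow : ⌊z⌋₊ < L := floor_mul_fract_lt hL (a * x)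
    have e1 := (h.tables _ hcol).1
    have e2 := (h.tables _ hrow).2
    simp only [Prog.result, State.setReg_reg, if_true, Expr.eval_hmul, Expr.eval_load,
      Expr.eval_hadd, Expr.eval_ofNat, Expr.eval_reg, a47, a48, a44, a0, ← Nat.cast_add,
      natFloor_ofNat_add, e1]
    rw [← add_assoc, e2, ← pow_add, bucket]
  · have a42 : s₂.reg 42 = W := by rw [f₂.1 42 (by decide), f₁.1 42 (by decide), h.r42]
    have a43 : s₂.reg 43 = b := by rw [f₂.1 43 (by decide), f₁.1 43 (by decide), h.r43]
    refine Prog.LoopFree.runs (by simp [Prog.LoopFree]) (by decide) ⟨?_, ?_⟩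
    · simpa [Prog.result] using a52
    · simp only [Prog.result, State.setReg_reg, if_true, Expr.eval_hmul, Expr.eval_hsub,
        Expr.eval_floor, Expr.eval_hdiv, Expr.eval_reg, a52, a42, a43]
      exact floor_sub_mul_floor_eq_digit W hb _

/-- Inserts the entry number `reg 51` into the table, unless there is already an entry with the same
key. Register `50` is set if there is a
collision. -/
def insertBody : Prog :=
  (36 ≔ load 20 (reg 51) ;; 40 ≔ floor (reg 36 / reg 49)) ;; lookup ;;
  .ite (.le (reg 45) 0) (42 ≔ reg 42 + reg 36 * reg 52)
    (.ite (.and (.le (floor (reg 45 / reg 49)) (reg 40)) (.le (reg 40) (floor (reg 45 / reg 49))))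
      .skip (50 ≔ 1)) ;;
  51 ≔ reg 51 + 1

/-- Draws a hash function and builds the table. -/
def attempt : Prog :=
  .rand 41 ;; (42 ≔ 0 ;; 50 ≔ 0 ;; 51 ≔ 0) ;; .while (.lt (reg 51) (reg 16)) insertBody

/-- Draws hash functions until there are no collisions. -/
def attempts : Prog := .while (.le 1 (reg 50)) attempt

/-- The set-up for the construction of the table. -/
structure Ready (n : ℕ) (E : List ℤ) (s : State) : Prop where
  entries : Entries E s
  r44 : s.reg 44 = (4 * (E.length + 1) : ℕ)
  r49 : s.reg 49 = n + 1
  tables : PowerTables (2 + E.sum) (4 * (E.length + 1)) s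

theorem Ready.of_frame {c : Prog} {n : ℕ} {E : List ℤ} {s s' : State} (h : Ready n E s)
    (hf : Frame c s s') (hc : (∀ x ∈ [16, 43, 44, 49], x ∉ c.writesReg) ∧
      ∀ a ∈ [0, 20], a ∉ c.writesArr) : Ready n E s' where
  entries := h.entries.of_frame hf
    ⟨hc.1 16 (by simp), hc.1 43 (by simp), hc.2 20 (by simp)⟩
  r44 := by rw [hf.1 _ (hc.1 44 (by simp)), h.r44]
  r49 := by rw [hf.1 _ (hc.1 49 (by simp)), h.r49]
  tables := h.tables.of_frame hf (hc.2 0 (by simp))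

theorem floor_natCast_succ_div {n : ℕ} (d : ℤ) : ⌊(d : ℝ) / ((n : ℝ) + 1)⌋ = d / (n + 1) := by
  have := floor_intCast_div_intCast d (show (0 : ℤ) < n + 1 by omega)
  push_cast at this
  exact this

/-- The outcome of an attempt with the hash function `a`. -/
def Built (n : ℕ) (E : List ℤ) (a : ℝ) (s : State) : Prop :=
  ∃ W, s.reg 41 = a ∧ s.reg 42 = (W : ℤ) ∧ (s.reg 50 = 0 ∨ s.reg 50 = 1) ∧
    IsTable (n + 1) (2 + E.sum) (4 * (E.length + 1)) a {e | e ∈ E} W (s.reg 50 = 1)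

theorem insertBody_runs {n : ℕ} {E : List ℤ} {s : State} (hpos : ∀ e ∈ E, 1 ≤ e)
    (h : Ready n E s) {i : ℕ} (hi : i < E.length) (h51 : s.reg 51 = i) {a : ℝ} {W : ℤ}
    (h41 : s.reg 41 = a) (h42 : s.reg 42 = W) (h50 : s.reg 50 = 0 ∨ s.reg 50 = 1) {S : Set ℤ}
    (hT : IsTable (n + 1) (2 + E.sum) (4 * (E.length + 1)) a S W (s.reg 50 = 1)) :
    Runs insertBody s 150 fun s' => s'.reg 51 = (i + 1 : ℕ) ∧ ∃ W : ℤ, s'.reg 42 = W ∧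
      (s'.reg 50 = 0 ∨ s'.reg 50 = 1) ∧
      IsTable (n + 1) (2 + E.sum) (4 * (E.length + 1)) a (insert E[i] S) W (s'.reg 50 = 1) := by
  have hsum : 0 ≤ E.sum := List.sum_nonneg fun e he => by have := hpos e he; omega
  have hle : ∀ e ∈ E, e ≤ E.sum := fun e he =>
    List.single_le_sum (fun e he => by have := hpos e he; omega) e he
  have hd := hpos _ (List.getElem_mem hi)
  have hdb := hle _ (List.getElem_mem hi)
  set d := E[i] with hd'
  set b := 2 + E.sum with hb
  set L := 4 * (E.length + 1) with hL
  refine Runs.mono (T := 12 + (80 + (50 + 4))) (Q := _) ?_ (by decide) fun _ _ h => h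
  refine Runs.seq (P := fun s' => s'.reg 36 = d ∧ s'.reg 40 = (d / (n + 1) : ℤ))
    (Prog.LoopFree.runs (by simp [Prog.LoopFree]) (by decide) ?_) fun s₁ f₁ ⟨a36, a40⟩ => ?_
  · simp only [Prog.result, State.setReg_reg, if_true, Expr.eval_floor, Expr.eval_hdiv,
      Expr.eval_load, Expr.eval_reg, h51, Nat.floor_natCast, h.entries.1 i hi, h.r49,
      show ¬ (49 = 36) by decide, show ¬ (36 = 40) by decide, if_false]
    exact ⟨rfl, by rw [floor_natCast_succ_div]⟩
  have hdr : DictRegs b L a W s₁ :=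
    { r41 := (f₁.1 41 (by decide)).trans h41
      r42 := (f₁.1 42 (by decide)).trans h42
      r43 := (f₁.1 43 (by decide)).trans h.entries.2.2
      r44 := (f₁.1 44 (by decide)).trans h.r44
      tables := h.tables.of_frame f₁ (by decide) }
  refine Runs.seq (lookup_runs (by omega) (by omega) hdr a40) fun s₂ f₂ ⟨a52, a45⟩ => ?_
  replace a36 := (f₂.1 36 (by decide)).trans a36
  replace a40 := (f₂.1 40 (by decide)).trans a40
  have a42 := (f₂.1 42 (by decide)).trans hdr.r42
  have a50 : s₂.reg 50 = s.reg 50 := (f₂.1 50 (by decide)).trans (f₁.1 50 (by decide))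
  have a49 : s₂.reg 49 = n + 1 := by rw [f₂.1 49 (by decide), f₁.1 49 (by decide), h.r49]
  have a51 : s₂.reg 51 = i := by rw [f₂.1 51 (by decide), f₁.1 51 (by decide), h51]
  set u := bucket L a (d / (n + 1) : ℤ) with hu
  have hdig : 0 ≤ digit b W u := digit_nonneg (by omega) W u
  refine Runs.seq (P := fun s' => s'.reg 51 = i ∧ ∃ W : ℤ, s'.reg 42 = W ∧
      (s'.reg 50 = 0 ∨ s'.reg 50 = 1) ∧ IsTable (n + 1) b L a (insert d S) W (s'.reg 50 = 1))
    (Runs.mono (Runs.ite (T := 30) (fun hc => ?_) fun hc => ?_) (by decide) fun _ _ h => h)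
    fun s₃ f₃ ⟨c51, W', c42, c50, cT⟩ => ?_
  · have h0 : digit b W u = 0 := by
      simp only [Test.holds_le, Expr.eval_reg, Expr.eval_zero, a45] at hc
      have : digit b W u ≤ 0 := by exact_mod_cast hc
      omega
    refine Prog.LoopFree.runs (by simp [Prog.LoopFree]) (by decide) ⟨?_, W + d * b ^ u, ?_, ?_, ?_⟩
    · simpa [Prog.result] using a51
    · simp [Prog.result, a42, a36, a52]
    · simpa [Prog.result, a50] using h50
    · have := hT.insert_new hd (by omega) h0
      simpa [Prog.result, a50] using this
  · have h0 : digit b W u ≠ 0 := by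
      intro h0
      simp only [Test.holds_le, Expr.eval_reg, Expr.eval_zero, a45, h0] at hc
      simp at hc
    refine Runs.mono (Runs.ite (T := 3) (fun hc => ?_) fun hc => ?_) (by decide) fun _ _ h => h
    · have h1 : digit b W u / (n + 1) = d / (n + 1) := by
        simp only [Test.holds_le, Test.holds_and, Expr.eval_reg, Expr.eval_floor, Expr.eval_hdiv,
          a45, a40, a49, floor_natCast_succ_div] at hc
        exact le_antisymm (by exact_mod_cast hc.1) (by exact_mod_cast hc.2)
      exact Prog.LoopFree.runs trivial (by decide)
        ⟨a51, W, a42, by rw [Prog.result, a50]; exact h50, by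
          rw [Prog.result, a50]; exact hT.insert_old h0 h1⟩
    · have h1 : digit b W u / (n + 1) ≠ d / (n + 1) := by
        intro h1
        simp only [Test.holds_le, Test.holds_and, Expr.eval_reg, Expr.eval_floor, Expr.eval_hdiv,
          a45, a40, a49, floor_natCast_succ_div, h1] at hc
        simp at hc
      refine Prog.LoopFree.runs trivial (by decide) ⟨?_, W, ?_, ?_, ?_⟩
      · simpa [Prog.result] using a51
      · simpa [Prog.result] using a42
      · simp [Prog.result]
      · have := hT.insert_collision h0 h1
        simpa [Prog.result] using this
  · refine (Prog.LoopFree.runs (c := 51 ≔ reg 51 + 1) (P := fun s' => s'.reg 51 = (i + 1 : ℕ))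
      trivial (by decide) (by simp [Prog.result, c51])).mono le_rfl fun s₄ f₄ e₄ => ⟨e₄, W', ?_⟩
    rw [f₄.1 42 (by decide), f₄.1 50 (by decide)]
    exact ⟨c42, c50, cT⟩

theorem attempt_runs {n : ℕ} {E : List ℤ} {s : State} (hpos : ∀ e ∈ E, 1 ≤ e)
    (h : Ready n E s) :
    Runs attempt s (E.length * 160 + 20) fun s' => Ready n E s' ∧ Built n E (s.tape 0) s' ∧
      ∀ i, s'.tape i = s.tape (i + 1) := by
  have hr := h.of_frame (Exec.rand s 41).frame (by decide)
  have hmain : Runs ((42 ≔ 0 ;; 50 ≔ 0 ;; 51 ≔ 0) ;; .while (.lt (reg 51) (reg 16)) insertBody)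
      (s.draw 41) (6 + (E.length * (150 + 4) + 4)) (Built n E (s.tape 0)) := by
    refine Runs.seq (P := fun s' => s'.reg 41 = s.tape 0 ∧ s'.reg 42 = 0 ∧ s'.reg 50 = 0 ∧
      s'.reg 51 = 0) (Prog.LoopFree.runs (by simp [Prog.LoopFree]) (by decide)
      (by simp [Prog.result])) fun s₁ f₁ ⟨a41, a42, a50, a51⟩ => ?_
    replace hr := hr.of_frame f₁ (by decide)
    refine Runs.mono (Runs.for (T := 150) E.length (fun i s' => s'.reg 51 = i ∧
      ∃ W : ℤ, s'.reg 42 = W ∧ (s'.reg 50 = 0 ∨ s'.reg 50 = 1) ∧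
      IsTable (n + 1) (2 + E.sum) (4 * (E.length + 1)) (s.tape 0) {e | e ∈ E.take i} W
        (s'.reg 50 = 1)) ?_ ?_ ?_) (by rw [cost_lt_reg]) fun s₂ f₂ ⟨_, W, b42, b50, bT⟩ => ?_
    · refine ⟨by simpa using a51, 0, by simpa using a42, Or.inl a50, ?_⟩
      have := isTable_empty (n + 1) (2 + E.sum) (4 * (E.length + 1)) (s.tape 0)
      simpa [a50] using this
    · intro i s' _ hi f
      simp only [Test.holds_lt, Expr.eval_reg, hi.1, f.1 16 (by decide), hr.entries.2.1]
      exact Nat.cast_lt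
    · rintro i s' hi ⟨c51, W, c42, c50, cT⟩ f
      have c41 := (f.1 41 (by decide)).trans a41
      refine (insertBody_runs hpos (hr.of_frame f (by decide)) hi c51 c41 c42 c50 cT).mono le_rfl
        fun s₃ _ ⟨d51, W', d42, d50, dT⟩ => ⟨d51, W', d42, d50, ?_⟩
      have : {e | e ∈ E.take (i + 1)} = insert E[i] {e | e ∈ E.take i} := by
        ext e
        change e ∈ E.take (i + 1) ↔ e = E[i] ∨ e ∈ E.take i
        rw [List.take_succ_eq_append_getElem hi, List.mem_append, List.mem_singleton, or_comm]
      rwa [this]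
    · rw [List.take_length] at bT
      exact ⟨W, (f₂.1 41 (by decide)).trans a41, b42, b50, bT⟩
  obtain ⟨t, s', ht, he, hb⟩ := hmain
  refine ⟨1 + t, s', by omega, .seq (.rand s 41) he, hr.of_frame he.frame (by decide), hb,
    fun i => ?_⟩
  rw [he.tape_eq (by simp [Prog.NoRand, insertBody, lookup]), State.draw_tape]

/-- The hash functions with which an attempt may fail. The keys of the entries are hashed, without
the indices of the time series. -/
noncomputable def failSet (n : ℕ) (E : List ℤ) : Set unitInterval :=
  badSet (4 * (E.length + 1)) E.length fun i => E.getD i 0 / (n + 1)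

theorem Built.reg_eq_zero {n : ℕ} {E : List ℤ} {a : unitInterval} {s : State} (h : Built n E a s)
    (ha : a ∉ failSet n E) : s.reg 50 = 0 := by
  obtain ⟨W, -, -, h50, hT⟩ := h
  refine h50.resolve_right (hT.not_fail ((injOn_bucket (by omega) ha).mono ?_))
  rintro _ ⟨e, he, rfl⟩
  obtain ⟨i, hi, rfl⟩ := List.getElem_of_mem he
  refine ⟨i, hi, ?_⟩
  change E.getD i 0 / _ = _
  rw [List.getD_eq_getElem _ _ hi]

/-- The time for the attempts until one of them uses the random number `j`, which is good. -/
theorem attempts_runs {n : ℕ} {E : List ℤ} (hpos : ∀ e ∈ E, 1 ≤ e) (j : ℕ) {s : State}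
    (h : Ready n E s) (hj : s.tape j ∉ failSet n E) :
    Runs attempts s ((j + 1) * (E.length * 160 + 30) + 10) fun _ => True := by
  induction j generalizing s with
  | zero =>
    by_cases hb : (Test.le 1 (reg 50)).holds s
    · obtain ⟨t, s', ht, he, -, hB, -⟩ := attempt_runs hpos h
      have h0 := hB.reg_eq_zero hj
      have hb' : ¬ (Test.le 1 (reg 50)).holds s' := by simp [h0]
      refine ⟨_, s', ?_, .whileTrue hb he (.whileFalse hb'), trivial⟩
      simp only [Test.cost, Expr.cost]
      omega
    · refine ⟨_, s, ?_, .whileFalse hb, trivial⟩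
      simp only [Test.cost, Expr.cost]
      omega
  | succ j ih =>
    by_cases hb : (Test.le 1 (reg 50)).holds s
    · obtain ⟨t, s', ht, he, hR, hB, htape⟩ := attempt_runs hpos h
      obtain ⟨t', s'', ht', he', -⟩ := ih hR (by rwa [htape])
      refine ⟨_, s'', ?_, .whileTrue hb he he', trivial⟩
      simp only [Test.cost, Expr.cost]
      rw [Nat.add_mul (j + 1) 1]
      omega
    · refine ⟨_, s, ?_, .whileFalse hb, trivial⟩
      simp only [Test.cost, Expr.cost]
      omega

theorem Exec.attempts_built {n : ℕ} {E : List ℤ} (hpos : ∀ e ∈ E, 1 ≤ e) {s s' : State} {t : ℕ}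
    (h : Ready n E s) (h50 : s.reg 50 = 1) (he : Exec attempts s t s') :
    Ready n E s' ∧ ∃ a, Built n E a s' ∧ s'.reg 50 = 0 := by
  obtain ⟨⟨h1, h2⟩, h3⟩ := Exec.while_invariant
    (fun s => Ready n E s ∧ (s.reg 50 = 1 ∨ ∃ a, Built n E a s)) (by
      rintro s t s' ⟨h, -⟩ _ he
      obtain ⟨t', s'', -, he', h1, h2, -⟩ := attempt_runs hpos h
      obtain ⟨-, rfl⟩ := he.deterministic he'
      exact ⟨h1, Or.inr ⟨_, h2⟩⟩) he ⟨h, Or.inl h50⟩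
  simp only [Test.holds_le, Expr.eval_reg, Expr.eval_one, not_le] at h3
  rcases h2 with h2 | ⟨a, h2⟩
  · linarith
  · refine ⟨h1, a, h2, ?_⟩
    obtain ⟨W, -, -, h50, -⟩ := h2
    rcases h50 with h50 | h50 <;> linarith

end RealRAM

theorem IsEntryList.one_le {X : ℕ → ℕ → ℝ} {n m k : ℕ} {ρ δ : ℝ} {B off : ℤ} {E : List ℤ}
    (H : IsEntryList X n m k ρ δ B off E) : ∀ e ∈ E, 1 ≤ e := by
  intro e he
  obtain ⟨i, -, a, l, f, h, rfl, hv, -⟩ := H.sound e he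
  have hB : 0 ≤ B := by
    obtain ⟨-, h1, h2⟩ := hv.last_mem
    omega
  have h0 : 0 ≤ encode B off (a :: l) := encode_nonneg hB fun b hb => by
    obtain ⟨f, -, h1, -⟩ := hv.exists_of_mem b hb
    exact h1
  have := mul_nonneg h0 (show (0 : ℤ) ≤ n + 1 by omega)
  omega

namespace RealRAM

open _root_.RealRAM.Expr (reg load floor)
open _root_.RealRAM.Prog (store)

/-- The same configuration with other random numbers. -/
def State.withTape (s : State) (ω : ℕ → unitInterval) : State := { s with tape := ω }

theorem Expr.eval_withTape (s : State) (ω : ℕ → unitInterval) (e : Expr) :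
    e.eval (s.withTape ω) = e.eval s := by
  induction e <;> simp_all [Expr.eval, State.withTape]

theorem Test.holds_withTape (s : State) (ω : ℕ → unitInterval) (b : Test) :
    b.holds (s.withTape ω) ↔ b.holds s := by
  induction b <;> simp_all [Test.holds, Expr.eval_withTape]

/-- The execution of a program that draws no random numbers does not depend on them. -/
theorem Exec.withTape {c : Prog} {s s' : State} {t : ℕ} (h : Exec c s t s') (hc : c.NoRand)
    (ω : ℕ → unitInterval) : Exec c (s.withTape ω) t (s'.withTape ω) := by
  induction h with
  | skip => exact .skip _
  | assign s x e =>
    have := Exec.assign (s.withTape ω) x e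
    rwa [Expr.eval_withTape] at this
  | store s a i e =>
    have := Exec.store (s.withTape ω) a i e
    rwa [Expr.eval_withTape, Expr.eval_withTape] at this
  | rand => exact hc.elim
  | seq _ _ ih₁ ih₂ => exact .seq (ih₁ hc.1) (ih₂ hc.2)
  | iteTrue hb _ ih => exact .iteTrue ((Test.holds_withTape _ _ _).2 hb) (ih hc.1)
  | iteFalse hb _ ih => exact .iteFalse (fun h => hb ((Test.holds_withTape _ _ _).1 h)) (ih hc.2)
  | whileTrue hb _ _ ih₁ ih₂ =>
    exact .whileTrue ((Test.holds_withTape _ _ _).2 hb) (ih₁ hc) (ih₂ hc)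
  | whileFalse hb => exact .whileFalse fun h => hb ((Test.holds_withTape _ _ _).1 h)

/-- Everything in the preprocessing before the choice of a hash function. -/
def prepare : Prog := setup ;; search ;; powerProg ;; 50 ≔ 1

/-- Writes the parameters of the query into the first cells of the data structure, and announces its
size. -/
def finish : Prog :=
  store 0 0 (reg 49) ;; store 0 1 (reg 41) ;; store 0 2 (reg 42) ;; store 0 3 (reg 43) ;;
  store 0 4 (reg 44) ;; store 0 5 (reg 10) ;; store 0 6 (reg 11) ;; store 0 7 (reg 5) ;;
  store 0 8 (reg 6) ;; 0 ≔ 10 + 2 * reg 44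

/-- The preprocessing algorithm. -/
def preprocess : Prog := prepare ;; attempts ;; finish

/-- The memory cells `A` hold a data structure for the entries `E`. -/
structure IsDictionary (n : ℕ) (off : ℤ) (g ρ : ℝ) (E : List ℤ) (A : ℕ → ℝ) : Prop where
  a0 : A 0 = n + 1
  table : ∃ W : ℤ, A 2 = W ∧
    IsTable (n + 1) (2 + E.sum) (4 * (E.length + 1)) (A 1) {e | e ∈ E} W False
  a3 : A 3 = (2 + E.sum : ℤ)
  a4 : A 4 = (4 * (E.length + 1) : ℕ)
  a5 : A 5 = off
  a6 : A 6 = (2 * off : ℤ)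
  a7 : A 7 = g
  a8 : A 8 = ρ
  powers : ∀ c < 4 * (E.length + 1), A (10 + c) = ((2 + E.sum : ℤ) : ℝ) ^ c ∧
    A (10 + 4 * (E.length + 1) + c) = ((2 + E.sum : ℤ) : ℝ) ^ (4 * (E.length + 1) * c)

theorem finish_runs {n : ℕ} {E : List ℤ} {off : ℤ} {g ρ a : ℝ} {s : State} (h : Ready n E s)
    (hB : Built n E a s) (h50 : s.reg 50 = 0) (h10 : s.reg 10 = off)
    (h11 : s.reg 11 = (2 * off : ℤ)) (h5 : s.reg 5 = g) (h6 : s.reg 6 = ρ) :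
    Runs finish s 60 fun s' => IsDictionary n off g ρ E (s'.arr 0) ∧
      s'.reg 0 = (10 + 2 * (4 * (E.length + 1)) : ℕ) := by
  obtain ⟨W, h41, h42, -, hT⟩ := hB
  refine Prog.LoopFree.runs (by simp [Prog.LoopFree, finish]) (by decide) ⟨⟨?_, ⟨W, ?_, ?_⟩, ?_,
    ?_, ?_, ?_, ?_, ?_, ?_⟩, ?_⟩
  · simp [finish, Prog.result, h.r49]
  · simp [finish, Prog.result, h42]
  · simpa [finish, Prog.result, h41, h50] using hT
  · simp [finish, Prog.result, h.entries.2.2]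
  · simp [finish, Prog.result, h.r44]
  · simp [finish, Prog.result, h10]
  · simp [finish, Prog.result, h11]
  · simp [finish, Prog.result, h5]
  · simp [finish, Prog.result, h6]
  · intro c hc
    have e : ∀ c ≥ 10, (finish.result s).arr 0 c = s.arr 0 c := by
      intro c hc
      simp only [finish, Prog.result, State.setReg_arr, State.setCell_arr, if_true, Expr.eval_ofNat,
        Expr.eval_zero, Expr.eval_one, Nat.floor_ofNat, Nat.floor_zero, Nat.floor_one]
      repeat rw [Function.update_of_ne (by omega)]
    rw [e _ (by omega), e _ (by omega)]
    exact h.tables c hc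
  · simp [finish, Prog.result, h.r44]

section Spec

variable {n m k : ℕ} {ε r δ : ℝ} {Y : ℕ → ℕ → ℝ} {s : State}

theorem prepare_runs (hm : 0 < m) (hε : 0 < ε) (hδ : δ ≤ 48 / ε + 6)
    (h0 : s.reg 0 = n) (h1 : s.reg 1 = m) (h2 : s.reg 2 = k) (h3 : s.reg 3 = ε) (h4 : s.reg 4 = r)
    (hY : ∀ i < n, ∀ p < m, s.arr 0 (i * m + p) = Y i p) :
    ∃ (off : ℤ) (E : List ℤ), IsEntryList (scaled m (ε * r / 16) Y) n m k (16 / ε + 2) δ (2 * off)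
        off E ∧
      E.length ≤ n * leafBound (2 * (2 * (⌊48 / ε⌋₊ + 8) + 1)) (m - 1) k ∧
      Runs prepare s (n * m * 40 + n * 140 +
          n * workBound 1000 (2 * (2 * (⌊48 / ε⌋₊ + 8) + 1)) (m - 1) k + 240 * E.length + 600)
        fun s' => Ready n E s' ∧ s'.reg 50 = 1 ∧ s'.reg 10 = off ∧ s'.reg 11 = (2 * off : ℤ) ∧
          s'.reg 5 = ε * r / 16 ∧ s'.reg 6 = 16 / ε + 2 := by
  have hX : ∀ i, scaled m (ε * r / 16) Y i m = scaled m (ε * r / 16) Y i (m - 1) := by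
    intro i
    rw [scaled, scaled, min_eq_right (by omega), min_self]
  obtain ⟨t₁, s₁, ht₁, he₁, off, hp, hE₀, hq, h14, h5, hB⟩ := setup_runs hm hε h0 h1 h2 h3 h4 hY
  have hfl := Nat.lt_floor_add_one (48 / ε)
  obtain ⟨t₂, s₂, ht₂, he₂, E, hE, hlist, hlen⟩ := search_runs (δ := δ) (by positivity) hm hX hB
    (by push_cast; linarith) hp hE₀ hq h14
  obtain ⟨t₃, s₃, ht₃, he₃, h44, hpow⟩ := powerProg_runs hE.2.1 hE.2.2
  obtain ⟨t₄, s₄, ht₄, he₄, h50⟩ : Runs (50 ≔ 1) s₃ 2 fun s' => s'.reg 50 = 1 :=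
    Prog.LoopFree.runs trivial (by decide) (by simp [Prog.result])
  refine ⟨off, E, hlist, hlen, _, s₄, ?_, .seq he₁ (.seq he₂ (.seq he₃ he₄)),
    ⟨(hE.of_frame he₃.frame (by decide)).of_frame he₄.frame (by decide), ?_, ?_,
      hpow.of_frame he₄.frame (by decide)⟩, h50, ?_, ?_, ?_, ?_⟩
  · omega
  · rw [he₄.frame.1 44 (by decide), h44]
  · rw [he₄.frame.1 49 (by decide), he₃.frame.1 49 (by decide), he₂.frame.1 49 (by decide), hp.r49]
  · rw [he₄.frame.1 10 (by decide), he₃.frame.1 10 (by decide), he₂.frame.1 10 (by decide), hp.r10]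
  · rw [he₄.frame.1 11 (by decide), he₃.frame.1 11 (by decide), he₂.frame.1 11 (by decide), hp.r11]
  · rw [he₄.frame.1 5 (by decide), he₃.frame.1 5 (by decide), he₂.frame.1 5 (by decide), h5]
  · rw [he₄.frame.1 6 (by decide), he₃.frame.1 6 (by decide), he₂.frame.1 6 (by decide), hp.r6]

instance : MeasureTheory.IsProbabilityMeasure tapeMeasure := by
  unfold tapeMeasure
  infer_instance

/-- What is built does not depend on the random numbers, except for the hash function. The expected
time is bounded by that of two attempts, and the result is correct for all random numbers with which
the program halts. -/
theorem preprocess_spec (hm : 0 < m) (hε : 0 < ε) (hδ : δ ≤ 48 / ε + 6)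
    (h0 : s.reg 0 = n) (h1 : s.reg 1 = m) (h2 : s.reg 2 = k) (h3 : s.reg 3 = ε) (h4 : s.reg 4 = r)
    (hY : ∀ i < n, ∀ p < m, s.arr 0 (i * m + p) = Y i p) :
    ∃ (off : ℤ) (E : List ℤ), IsEntryList (scaled m (ε * r / 16) Y) n m k (16 / ε + 2) δ (2 * off)
        off E ∧
      E.length ≤ n * leafBound (2 * (2 * (⌊48 / ε⌋₊ + 8) + 1)) (m - 1) k ∧
      expectedTime preprocess s.withTape ≤ (n * m * 40 + n * 140 +
        n * workBound 1000 (2 * (2 * (⌊48 / ε⌋₊ + 8) + 1)) (m - 1) k + 560 * E.length + 730 : ℕ) ∧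
      ∀ ω t s', Exec preprocess (s.withTape ω) t s' →
        IsDictionary n off (ε * r / 16) (16 / ε + 2) E (s'.arr 0) ∧
        s'.reg 0 = (10 + 2 * (4 * (E.length + 1)) : ℕ) := by
  obtain ⟨off, E, hlist, hlen, t₁, s₁, ht₁, he₁, hR, h50, h10, h11, h5, h6⟩ :=
    prepare_runs hm hε hδ h0 h1 h2 h3 h4 hY
  set W := workBound 1000 (2 * (2 * (⌊48 / ε⌋₊ + 8) + 1)) (m - 1) k
  have hpos := hlist.one_le
  have he₁' : ∀ ω, Exec prepare (s.withTape ω) t₁ (s₁.withTape ω) := he₁.withTape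
    (by simp [prepare, setup, search, powerProg, setParams, scaleBody, setBase, buildInit, push,
      pushFields, searchBody, loadFields, moveProg, acceptProg, buildAdvance, setMax, setMin,
      expandCands, candBody, candProg, buildEmit, Prog.NoRand])
  have hR' : ∀ ω, Ready n E (s₁.withTape ω) := fun ω => ⟨hR.entries, hR.r44, hR.r49, hR.tables⟩
  -- the last part of the program, after a successful attempt
  have hfin : ∀ ω t s', Exec attempts (s₁.withTape ω) t s' →
      Runs finish s' 60 fun s' => IsDictionary n off (ε * r / 16) (16 / ε + 2) E (s'.arr 0) ∧
        s'.reg 0 = (10 + 2 * (4 * (E.length + 1)) : ℕ) := by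
    intro ω t s' he
    obtain ⟨hR'', a, hB, h50'⟩ := he.attempts_built hpos (hR' ω) h50
    exact finish_runs hR'' hB h50' ((he.frame.1 10 (by decide)).trans h10)
      ((he.frame.1 11 (by decide)).trans h11) ((he.frame.1 5 (by decide)).trans h5)
      ((he.frame.1 6 (by decide)).trans h6)
  refine ⟨off, E, hlist, hlen, ?_, ?_⟩
  · set A := failSet n E with hA
    have hAm : MeasurableSet A := measurableSet_badSet _ _ _
    have hAv : MeasureTheory.volume A ≤ 2⁻¹ := volume_badSet_le _ _
    set T₀ : ℕ := n * m * 40 + n * 140 + n * W + 240 * E.length + 670 with hT₀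
    set T₁ : ℕ := E.length * 160 + 30 with hT₁
    -- the sum counts the attempts: its `j`-th term is `1` if the first `j` attempts may fail
    have hrun : ∀ ω, runTime preprocess (s.withTape ω) ≤
        T₀ + T₁ * ∑' j : ℕ, ((Finset.range j : Set ℕ).pi fun _ => A).indicator 1 ω := by
      intro ω
      by_cases hex : ∃ j, ω j ∉ A
      · classical
        set j := Nat.find hex with hj
        obtain ⟨t₂, s₂, ht₂, he₂, -⟩ := attempts_runs hpos j (hR' ω) (Nat.find_spec hex)
        obtain ⟨t₃, s₃, ht₃, he₃, -⟩ := hfin ω t₂ s₂ he₂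
        have hsum : ((j + 1 : ℕ) : ENNReal) ≤
            ∑' j : ℕ, ((Finset.range j : Set ℕ).pi fun _ => A).indicator 1 ω := by
          refine le_trans ?_ (ENNReal.sum_le_tsum (Finset.range (j + 1)))
          rw [Finset.sum_congr rfl (g := fun _ => (1 : ENNReal))]
          · simp
          · intro i hi
            refine Set.indicator_of_mem (fun i' hi' => ?_) _
            have h1 : i' < i := by simpa using hi'
            have h2 : i < j + 1 := by simpa using hi
            by_contra hne
            exact Nat.find_min hex (show i' < j by omega) hne
        refine (runTime_le (.seq (he₁' ω) (.seq he₂ he₃))).trans ?_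
        calc ((t₁ + (t₂ + t₃) : ℕ) : ENNReal) ≤ ((T₀ + T₁ * (j + 1) : ℕ) : ENNReal) := by
              refine Nat.cast_le.2 ?_
              rw [mul_comm T₁]
              have : t₂ ≤ (j + 1) * T₁ + 10 := ht₂
              omega
          _ ≤ _ := by
              push_cast
              push_cast at hsum
              gcongr
      · have htop : ∑' j : ℕ, ((Finset.range j : Set ℕ).pi fun _ => A).indicator
            (1 : (ℕ → unitInterval) → ENNReal) ω = ⊤ := by
          rw [tsum_congr (g := fun _ => (1 : ENNReal)), ENNReal.tsum_const_eq_top_of_ne_zero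
            one_ne_zero]
          intro j
          refine Set.indicator_of_mem (fun i _ => ?_) _
          by_contra hne
          exact hex ⟨i, hne⟩
        rw [htop, ENNReal.mul_top (Nat.cast_ne_zero.2 (by omega)), add_top]
        exact le_top
    calc expectedTime preprocess s.withTape
        ≤ ∫⁻ ω, (T₀ + T₁ * ∑' j : ℕ, ((Finset.range j : Set ℕ).pi fun _ => A).indicator 1 ω)
            ∂tapeMeasure := MeasureTheory.lintegral_mono hrun
      _ = T₀ + T₁ * ∫⁻ ω, ∑' j : ℕ, ((Finset.range j : Set ℕ).pi fun _ => A).indicator 1 ω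
            ∂tapeMeasure := by
          rw [MeasureTheory.lintegral_add_left measurable_const,
            MeasureTheory.lintegral_const_mul' _ _ (ENNReal.natCast_ne_top _),
            MeasureTheory.lintegral_const, MeasureTheory.measure_univ, mul_one]
      _ ≤ T₀ + T₁ * 2 := by
          gcongr
          exact lintegral_tsum_indicator_le hAm hAv
      _ = ((T₀ + T₁ * 2 : ℕ) : ENNReal) := by push_cast; rfl
      _ ≤ _ := Nat.cast_le.2 (by omega)
  · intro ω t s' he
    cases he with
    | seq x₁ x₂ =>
      obtain ⟨-, rfl⟩ := x₁.deterministic (he₁' ω)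
      cases x₂ with
      | seq y₁ y₂ =>
        obtain ⟨t', s'', -, he', hspec⟩ := hfin ω _ _ y₁
        obtain ⟨-, rfl⟩ := y₂.deterministic he'
        exact hspec

end Spec

end RealRAM

/-! ### Answering a query -/

/-- The binary digits of a number describe a set of vertices. The first and the last vertex of a
curve with `k` vertices always belong to it. -/
def maskSet (k M j : ℕ) : Prop := M / 2 ^ j % 2 = 1 ∨ j = 0 ∨ k < j + 2

theorem exists_mask (k : ℕ) (S : ℕ → Prop) :
    ∃ M < 2 ^ k, ∀ j < k, (M / 2 ^ j % 2 = 1 ↔ S j) := by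
  induction k generalizing S with
  | zero => exact ⟨0, by simp, fun j hj => by omega⟩
  | succ k ih =>
    obtain ⟨M, hM, h⟩ := ih fun j => S (j + 1)
    have key : ∀ c < 2, ∀ j, (2 * M + c) / 2 ^ (j + 1) = M / 2 ^ j := by
      intro c hc j
      rw [pow_succ', ← Nat.div_div_eq_div_mul]
      congr 1
      omega
    by_cases h0 : S 0
    · refine ⟨2 * M + 1, by rw [pow_succ]; omega, fun j hj => ?_⟩
      cases j with
      | zero => simp only [pow_zero, Nat.div_one, h0, iff_true]; omega
      | succ j =>
        rw [key 1 (by omega)]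
        exact h j (by omega)
    · refine ⟨2 * M + 0, by rw [pow_succ]; omega, fun j hj => ?_⟩
      cases j with
      | zero => simp only [pow_zero, Nat.div_one, h0, iff_false]; omega
      | succ j =>
        rw [key 0 (by omega)]
        exact h j (by omega)

theorem keptList_congr {S S' : ℕ → Prop} {k : ℕ} (h : ∀ j < k, (S j ↔ S' j)) :
    keptList S k = keptList S' k := by
  induction k with
  | zero => rfl
  | succ k ih =>
    rw [keptList, keptList, ih fun j hj => h j (by omega)]
    have hk := h k (by omega)
    by_cases hS : S k
    · rw [if_pos hS, if_pos (hk.1 hS)]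
    · rw [if_neg hS, if_neg fun h => hS (hk.2 h)]

theorem GapsOK.congr {ρ : ℝ} {Q : ℕ → ℝ} {S S' : ℕ → Prop} {k : ℕ} (h : ∀ j < k, (S j ↔ S' j))
    (H : GapsOK ρ Q S k) : GapsOK ρ Q S' k := fun a b hab hb ha hb' hc =>
  H a b hab hb ((h a (by omega)).2 ha) ((h b hb).2 hb') fun c h1 h2 hS =>
    hc c h1 h2 ((h c (by omega)).1 hS)

theorem gapsOK_succ_of_not {ρ : ℝ} {Q : ℕ → ℝ} {S : ℕ → Prop} {j : ℕ} (h : ¬ S j) :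
    GapsOK ρ Q S (j + 1) ↔ GapsOK ρ Q S j := by
  refine ⟨fun H a b hab hb => H a b hab (by omega), fun H a b hab hb ha hb' hc => ?_⟩
  have : b ≠ j := fun e => h (e ▸ hb')
  exact H a b hab (by omega) ha hb' hc

theorem gapsOK_succ {ρ : ℝ} {Q : ℕ → ℝ} {S : ℕ → Prop} {j a : ℕ} (h : S j) (haj : a < j)
    (ha : S a) (hc : ∀ c, a < c → c < j → ¬ S c) :
    GapsOK ρ Q S (j + 1) ↔ GapsOK ρ Q S j ∧ SegCond ρ (Q a) (Q j) Q a j := by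
  constructor
  · exact fun H => ⟨fun a b hab hb => H a b hab (by omega), H a j haj (by omega) ha h hc⟩
  · rintro ⟨H1, H2⟩ a' b hab hb ha' hb' hc'
    rcases Nat.lt_succ_iff_lt_or_eq.1 hb with hb | rfl
    · exact H1 a' b hab hb ha' hb' hc'
    · have : a' = a := by
        by_contra hne
        rcases lt_or_gt_of_ne hne with h' | h'
        · exact hc' a h' haj ha
        · exact hc a' h' hab ha'
      rw [this]
      exact H2

/-- The vertices of the curve that remain may occur in an entry. -/
def DigitsOK (B off : ℤ) (Q : ℕ → ℝ) (S : ℕ → Prop) (j : ℕ) : Prop :=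
  ∀ i ∈ keptList S j, 1 ≤ ⌊Q i⌋ + off ∧ ⌊Q i⌋ + off < B

/-- The code of the simplified and rounded curve. -/
noncomputable def queryKey (B off : ℤ) (Q : ℕ → ℝ) (S : ℕ → Prop) (j : ℕ) : ℤ :=
  encode B off ((keptList S j).map fun i => ⌊Q i⌋)

/-- The simplification `S` of `Q` is admissible, and `e` is an entry for it. -/
def IsHit (n k : ℕ) (ρ : ℝ) (B off : ℤ) (E : List ℤ) (Q : ℕ → ℝ) (S : ℕ → Prop) (e : ℤ) : Prop :=
  GapsOK ρ Q S k ∧ DigitsOK B off Q S k ∧ e ∈ E ∧ e / (n + 1) = queryKey B off Q S k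

namespace RealRAM

open _root_.RealRAM.Expr (reg load floor)
open _root_.RealRAM.Prog (store)

/-- Appends the vertex in register `32` to the simplified curve. Register `64` is cleared if this is
not admissible. -/
def keepProg : Prog :=
  .ite (segTest (reg 32)) .skip (64 ≔ 0) ;; 34 ≔ floor (reg 32) + reg 10 ;;
  .ite (.and (.le 1 (reg 34)) (.le (reg 34 + 1) (reg 11))) .skip (64 ≔ 0) ;;
  (40 ≔ reg 40 * reg 11 + reg 34 ;; 22 ≔ reg 32 ;; 24 ≔ reg 32 ;; 25 ≔ reg 32 ;; 26 ≔ 0 ;; 27 ≔ 0)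

/-- Loads the vertex `reg 51` of the query, and updates the statistics. -/
def statsProg : Prog :=
  32 ≔ load 1 (reg 51) / reg 5 ;; setMax 26 (reg 24 - reg 32) ;; setMax 27 (reg 32 - reg 25) ;;
  setMax 24 (reg 32) ;; setMin 25 (reg 32) ;;
  65 ≔ reg 63 - 2 * floor (reg 63 / 2) ;; 63 ≔ floor (reg 63 / 2)

/-- Processes the vertex `reg 51` of the query. -/
def vertexBody : Prog :=
  statsProg ;;
  .ite (.and (.le (reg 65) 0) (.and (.le 1 (reg 51)) (.le (reg 51 + 2) (reg 2)))) .skip keepProg ;;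
  51 ≔ reg 51 + 1

/-- Starts with an empty simplified curve. -/
def maskInit : Prog :=
  63 ≔ reg 62 ;; 51 ≔ 0 ;; 40 ≔ 0 ;; 64 ≔ 1 ;; 22 ≔ load 1 0 / reg 5 ;; 24 ≔ reg 22 ;;
  25 ≔ reg 22 ;; 26 ≔ 0 ;; 27 ≔ 0

/-- Looks up the simplified curve, and records the index of the time series if there is an entry. -/
def answerProg : Prog :=
  .ite (.le 1 (reg 64))
    (lookup ;; .ite (.and (.lt 0 (reg 45)) (.and (.le (floor (reg 45 / reg 49)) (reg 40))
        (.le (reg 40) (floor (reg 45 / reg 49)))))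
      (60 ≔ reg 45 - reg 40 * reg 49) .skip)
    .skip

/-- Processes the simplification with the number `reg 62`. -/
def maskBody : Prog :=
  maskInit ;; .while (.lt (reg 51) (reg 2)) vertexBody ;; answerProg ;; 62 ≔ reg 62 + 1

/-- Loads the parameters from the data structure. -/
def queryInit : Prog :=
  2 ≔ reg 0 ;; 49 ≔ load 0 0 ;; 41 ≔ load 0 1 ;; 42 ≔ load 0 2 ;; 43 ≔ load 0 3 ;; 44 ≔ load 0 4 ;;
  10 ≔ load 0 5 ;; 11 ≔ load 0 6 ;; 5 ≔ load 0 7 ;; 6 ≔ load 0 8 ;; 60 ≔ 0 ;; 61 ≔ 1 ;; 12 ≔ 0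

/-- The query algorithm. -/
def query : Prog :=
  queryInit ;; .while (.lt (reg 12) (reg 2)) (61 ≔ 2 * reg 61 ;; 12 ≔ reg 12 + 1) ;; 62 ≔ 0 ;;
  .while (.lt (reg 62) (reg 61)) maskBody ;; 0 ≔ reg 60

/-- The parameters of a query in the registers, with the query curve `Q` in units of `g`. -/
structure QueryRegs (n k : ℕ) (off B : ℤ) (g ρ : ℝ) (b : ℤ) (L : ℕ) (a : ℝ) (W : ℤ) (Q : ℕ → ℝ)
    (s : State) : Prop where
  r2 : s.reg 2 = k
  r5 : s.reg 5 = g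
  r6 : s.reg 6 = ρ
  r10 : s.reg 10 = off
  r11 : s.reg 11 = B
  r49 : s.reg 49 = n + 1
  dict : DictRegs b L a W s
  curve : ∀ j < k, s.arr 1 j / g = Q j

section Specs

variable {n k : ℕ} {off B : ℤ} {g ρ : ℝ} {b : ℤ} {L : ℕ} {a : ℝ} {W : ℤ} {Q : ℕ → ℝ} {s : State}

theorem QueryRegs.of_frame {c : Prog} {s' : State} (h : QueryRegs n k off B g ρ b L a W Q s)
    (hf : Frame c s s') (hc : (∀ x ∈ [2, 5, 6, 10, 11, 41, 42, 43, 44, 49], x ∉ c.writesReg) ∧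
      ∀ a ∈ [0, 1], a ∉ c.writesArr) : QueryRegs n k off B g ρ b L a W Q s' where
  r2 := by rw [hf.1 _ (hc.1 2 (by simp)), h.r2]
  r5 := by rw [hf.1 _ (hc.1 5 (by simp)), h.r5]
  r6 := by rw [hf.1 _ (hc.1 6 (by simp)), h.r6]
  r10 := by rw [hf.1 _ (hc.1 10 (by simp)), h.r10]
  r11 := by rw [hf.1 _ (hc.1 11 (by simp)), h.r11]
  r49 := by rw [hf.1 _ (hc.1 49 (by simp)), h.r49]
  dict :=
    { r41 := by rw [hf.1 _ (hc.1 41 (by simp)), h.dict.r41]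
      r42 := by rw [hf.1 _ (hc.1 42 (by simp)), h.dict.r42]
      r43 := by rw [hf.1 _ (hc.1 43 (by simp)), h.dict.r43]
      r44 := by rw [hf.1 _ (hc.1 44 (by simp)), h.dict.r44]
      tables := h.dict.tables.of_frame hf (hc.2 0 (by simp)) }
  curve j hj := by rw [hf.2 1 (hc.2 1 (by simp)), h.curve j hj]

/-- The contents of the registers after `j` vertices of the query have been processed. The last
vertex that remains is number `p`; before the first vertex, `p = 0`. -/
structure Scanned (ρ : ℝ) (B off : ℤ) (Q : ℕ → ℝ) (S : ℕ → Prop) (M j p : ℕ) (s : State) :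
    Prop where
  r51 : s.reg 51 = j
  r63 : s.reg 63 = (M / 2 ^ j : ℕ)
  r40 : s.reg 40 = queryKey B off Q S j
  r64 : s.reg 64 = 0 ∨ s.reg 64 = 1
  ok : s.reg 64 = 1 ↔ GapsOK ρ Q S j ∧ DigitsOK B off Q S j
  r22 : s.reg 22 = Q p
  last : (j = 0 ∧ p = 0) ∨ (p < j ∧ S p ∧ ∀ c, p < c → c < j → ¬ S c)
  stats : IsStats Q (Q p) p (j - 1) (s.reg 24) (s.reg 25) (s.reg 26) (s.reg 27)

theorem statsProg_runs {S : ℕ → Prop} {M j p : ℕ} (h : QueryRegs n k off B g ρ b L a W Q s)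
    (H : Scanned ρ B off Q S M j p s) (hj : j < k) :
    Runs statsProg s 80 fun s' => s'.reg 32 = Q j ∧ s'.reg 65 = (M / 2 ^ j % 2 : ℕ) ∧
      s'.reg 63 = (M / 2 ^ (j + 1) : ℕ) ∧
      IsStats Q (Q p) p j (s'.reg 24) (s'.reg 25) (s'.reg 26) (s'.reg 27) := by
  have hq := h.curve j hj
  have hhalf : ⌊((M / 2 ^ j : ℕ) : ℝ) / 2⌋ = (M / 2 ^ (j + 1) : ℕ) := by
    have := floor_intCast_div_intCast (M / 2 ^ j : ℕ) (show (0 : ℤ) < 2 by norm_num)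
    rw [Int.cast_natCast, Int.cast_ofNat] at this
    rw [this, pow_succ, ← Nat.div_div_eq_div_mul]
    rfl
  refine Prog.LoopFree.runs (by simp [Prog.LoopFree, statsProg, setMax, setMin])
    (by decide) ⟨?_, ?_, ?_, ?_⟩
  · simp [statsProg, Prog.result, result_setMax, result_setMin, H.r51, h.r5, hq]
  · simp only [statsProg, Prog.result, result_setMax, result_setMin, State.setReg_reg,
      Expr.eval_hsub, Expr.eval_hmul, Expr.eval_hdiv, Expr.eval_reg, Expr.eval_ofNat,
      Expr.eval_floor, H.r63]
    simp only [Nat.reduceEqDiff, if_false, if_true, hhalf]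
    rw [pow_succ, ← Nat.div_div_eq_div_mul]
    have := Nat.div_add_mod (M / 2 ^ j) 2
    rw [sub_eq_iff_eq_add, Int.cast_natCast]
    exact_mod_cast (by omega)
  · simp only [statsProg, Prog.result, result_setMax, result_setMin, State.setReg_reg,
      Expr.eval_hdiv, Expr.eval_reg, Expr.eval_ofNat, Expr.eval_floor, Nat.reduceEqDiff, if_false,
      if_true, H.r63, hhalf, Int.cast_natCast]
  · have e : ∀ x ∈ [24, 25, 26, 27], (statsProg.result s).reg x = if x = 24 then
        max (s.reg 24) (Q j) else if x = 25 then min (s.reg 25) (Q j) else if x = 26 then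
        max (s.reg 26) (s.reg 24 - Q j) else max (s.reg 27) (Q j - s.reg 25) := by
      intro x hx
      simp only [List.mem_cons, List.not_mem_nil, or_false] at hx
      rcases hx with rfl | rfl | rfl | rfl <;>
      simp [statsProg, Prog.result, result_setMax, result_setMin, H.r51, h.r5, hq]
    rw [e 24 (by simp), e 25 (by simp), e 26 (by simp), e 27 (by simp)]
    simp only [Nat.reduceEqDiff, if_false, if_true]
    rcases H.last with ⟨rfl, rfl⟩ | ⟨h1, -, -⟩
    · have H' := H.stats
      -- no vertex has been processed, so that the update changes nothing
      have i1 := (H'.mx_le_iff (s.reg 24)).1 le_rfl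
      have i2 := (H'.le_mn_iff (s.reg 25)).1 le_rfl
      have i3 := (H'.mx_le_iff (Q 0)).2 ⟨le_rfl, fun p _ _ => by omega⟩
      have i4 := (H'.le_mn_iff (Q 0)).2 ⟨le_rfl, fun p _ _ => by omega⟩
      have i5 := ((H'.drop_le_iff _).1 le_rfl).1
      have i6 := ((H'.rise_le_iff _).1 le_rfl).1
      rw [max_eq_left i1.1, min_eq_left i2.1, max_eq_left (by linarith), max_eq_left (by linarith)]
      exact H'
    · have := H.stats.succ (show p ≤ j - 1 by omega)
      rwa [show j - 1 + 1 = j by omega] at this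

theorem keepProg_runs (hρ : 0 ≤ ρ) {S : ℕ → Prop} {j p : ℕ} (hS : S j)
    (h : QueryRegs n k off B g ρ b L a W Q s)
    (h40 : s.reg 40 = queryKey B off Q S j) (h64 : s.reg 64 = 0 ∨ s.reg 64 = 1)
    (hok : s.reg 64 = 1 ↔ GapsOK ρ Q S j ∧ DigitsOK B off Q S j) (h22 : s.reg 22 = Q p)
    (hlast : (j = 0 ∧ p = 0) ∨ (p < j ∧ S p ∧ ∀ c, p < c → c < j → ¬ S c))
    (hstats : IsStats Q (Q p) p j (s.reg 24) (s.reg 25) (s.reg 26) (s.reg 27))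
    (h32 : s.reg 32 = Q j) :
    Runs keepProg s 120 fun s' => s'.reg 40 = queryKey B off Q S (j + 1) ∧
      (s'.reg 64 = 0 ∨ s'.reg 64 = 1) ∧
      (s'.reg 64 = 1 ↔ GapsOK ρ Q S (j + 1) ∧ DigitsOK B off Q S (j + 1)) ∧ s'.reg 22 = Q j ∧
      IsStats Q (Q j) j j (s'.reg 24) (s'.reg 25) (s'.reg 26) (s'.reg 27) := by
  classical
  have hkept : keptList S (j + 1) = j :: keptList S j := by rw [keptList, if_pos hS]
  have hgap : GapsOK ρ Q S (j + 1) ↔ GapsOK ρ Q S j ∧ SegCond ρ (Q p) (Q j) Q p j := by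
    rcases hlast with ⟨rfl, rfl⟩ | ⟨h1, h2, h3⟩
    · refine iff_of_true (fun a b hab hb => by omega) ⟨fun a b hab hb => by omega, Or.inl ⟨le_rfl,
        fun p _ _ => by omega, fun p p' _ _ _ => by omega⟩⟩
    · exact gapsOK_succ hS h1 h2 h3
  have hdig : DigitsOK B off Q S (j + 1) ↔
      (1 ≤ ⌊Q j⌋ + off ∧ ⌊Q j⌋ + off < B) ∧ DigitsOK B off Q S j := by
    unfold DigitsOK
    rw [hkept, List.forall_mem_cons]
  have hseg := (holds_segTest (e := reg 32) h.r6 h22 rfl rfl rfl rfl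
    (by simpa using h32)).trans (hstats.segTest_iff hρ)
  refine Runs.mono (T := (((segTest (reg 32)).cost + 3) + (5 + ((10 + 3) + 20)))) (Q := _) ?_
    (by decide +kernel) fun _ _ h => h
  refine Runs.seq (P := fun s' => (s'.reg 64 = 0 ∨ s'.reg 64 = 1) ∧
    (s'.reg 64 = 1 ↔ s.reg 64 = 1 ∧ SegCond ρ (Q p) (Q j) Q p j))
    (Runs.ite (fun hc => ?_) fun hc => ?_) fun s₁ f₁ ⟨a64, aok⟩ => ?_
  · exact Prog.LoopFree.runs trivial (by decide) ⟨h64, by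
      rw [Prog.result, and_iff_left (hseg.1 hc)]⟩
  · refine Prog.LoopFree.runs trivial (by decide) ⟨by simp [Prog.result], ?_⟩
    have hn : ¬ SegCond ρ (Q p) (Q j) Q p j := fun h => hc (hseg.2 h)
    simp [Prog.result, hn]
  refine Runs.seq (P := fun s' => s'.reg 34 = (⌊Q j⌋ + off : ℤ)) (Prog.LoopFree.runs trivial
    (by decide) ?_) fun s₂ f₂ a34 => ?_
  · simp [Prog.result, f₁.1 32 (by decide), h32, f₁.1 10 (by decide), h.r10]
  have b64 : s₂.reg 64 = s₁.reg 64 := f₂.1 64 (by decide)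
  have b11 : s₂.reg 11 = B := by rw [f₂.1 11 (by decide), f₁.1 11 (by decide), h.r11]
  have htest : (Test.and (.le 1 (reg 34)) (.le (reg 34 + 1) (reg 11))).holds s₂ ↔
      1 ≤ ⌊Q j⌋ + off ∧ ⌊Q j⌋ + off < B := by
    simp only [Test.holds_and, Test.holds_le, Expr.eval_one, Expr.eval_reg, Expr.eval_hadd, a34,
      b11]
    rw [← Int.add_one_le_iff]
    exact and_congr (by exact_mod_cast Iff.rfl) (by exact_mod_cast Iff.rfl)
  refine Runs.seq (P := fun s' => (s'.reg 64 = 0 ∨ s'.reg 64 = 1) ∧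
    (s'.reg 64 = 1 ↔ s₁.reg 64 = 1 ∧ (1 ≤ ⌊Q j⌋ + off ∧ ⌊Q j⌋ + off < B)))
    (Runs.mono (Runs.ite (T := 3) (fun hc => ?_) fun hc => ?_) (by decide) fun _ _ h => h)
    fun s₃ f₃ ⟨c64, cok⟩ => ?_
  · exact Prog.LoopFree.runs trivial (by decide) ⟨by rw [Prog.result, b64]; exact a64, by
      rw [Prog.result, and_iff_left (htest.1 hc), b64]⟩
  · refine Prog.LoopFree.runs trivial (by decide) ⟨by simp [Prog.result], ?_⟩
    simp only [Prog.result, State.setReg_reg, if_true, Expr.eval_zero, zero_ne_one, false_iff]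
    exact fun h => hc (htest.2 h.2)
  have d32 : s₃.reg 32 = Q j := by
    rw [f₃.1 32 (by decide), f₂.1 32 (by decide), f₁.1 32 (by decide), h32]
  have d34 := (f₃.1 34 (by decide)).trans a34
  have d11 := (f₃.1 11 (by decide)).trans b11
  have d40 : s₃.reg 40 = queryKey B off Q S j := by
    rw [f₃.1 40 (by decide), f₂.1 40 (by decide), f₁.1 40 (by decide), h40]
  refine Runs.mono (P := fun s' => s'.reg 40 = s₃.reg 40 * B + (⌊Q j⌋ + off : ℤ) ∧
    s'.reg 22 = Q j ∧ s'.reg 24 = Q j ∧ s'.reg 25 = Q j ∧ s'.reg 26 = 0 ∧ s'.reg 27 = 0)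
    (Prog.LoopFree.runs (by simp [Prog.LoopFree]) (by decide)
      (by simp [Prog.result, d32, d34, d11])) le_rfl
    fun s₄ f₄ ⟨e40, e22, e24, e25, e26, e27⟩ => ⟨?_, ?_, ?_, e22, ?_⟩
  · rw [queryKey, hkept, List.map_cons, encode.eq_2, e40, d40, queryKey]
    push_cast
    rfl
  · rw [f₄.1 64 (by decide)]
    exact c64
  · rw [f₄.1 64 (by decide), hgap, hdig, cok, aok, hok]
    exact ⟨fun ⟨⟨⟨i₁, i₂⟩, i₃⟩, i₄⟩ => ⟨⟨i₁, i₃⟩, i₄, i₂⟩,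
      fun ⟨⟨i₁, i₃⟩, i₄, i₂⟩ => ⟨⟨⟨i₁, i₂⟩, i₃⟩, i₄⟩⟩
  · rw [e24, e25, e26, e27]
    exact IsStats.refl Q (Q j) le_rfl

theorem vertexBody_runs (hρ : 0 ≤ ρ) {M j p : ℕ} (h : QueryRegs n k off B g ρ b L a W Q s)
    (H : Scanned ρ B off Q (maskSet k M) M j p s) (hj : j < k) :
    Runs vertexBody s 250 fun s' => ∃ p, Scanned ρ B off Q (maskSet k M) M (j + 1) p s' := by
  set S := maskSet k M with hS
  refine Runs.mono (T := 80 + ((20 + 120) + 4)) (Q := _) ?_ (by decide) fun _ _ h => h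
  refine Runs.seq (statsProg_runs h H hj) fun s₁ f₁ ⟨a32, a65, a63, astats⟩ => ?_
  replace h := h.of_frame f₁ (by decide)
  have a51 := (f₁.1 51 (by decide)).trans H.r51
  have a40 := (f₁.1 40 (by decide)).trans H.r40
  have a22 := (f₁.1 22 (by decide)).trans H.r22
  have e64 : s₁.reg 64 = s.reg 64 := f₁.1 64 (by decide)
  have a64 := H.r64
  have aok := H.ok
  rw [← e64] at a64 aok
  refine Runs.seq (P := fun s' => s'.reg 63 = (M / 2 ^ (j + 1) : ℕ) ∧ s'.reg 51 = j ∧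
    s'.reg 40 = queryKey B off Q S (j + 1) ∧ (s'.reg 64 = 0 ∨ s'.reg 64 = 1) ∧
    (s'.reg 64 = 1 ↔ GapsOK ρ Q S (j + 1) ∧ DigitsOK B off Q S (j + 1)) ∧
    ∃ p, s'.reg 22 = Q p ∧ (p < j + 1 ∧ S p ∧ ∀ c, p < c → c < j + 1 → ¬ S c) ∧
      IsStats Q (Q p) p j (s'.reg 24) (s'.reg 25) (s'.reg 26) (s'.reg 27))
    (Runs.mono (Runs.ite (T := 120) (fun hc => ?_) fun hc => ?_) (by decide) fun _ _ h => h)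
    fun s₂ f₂ ⟨b63, b51, b40, b64, bok, p', b22, blast, bstats⟩ => ?_
  · have hc' : (M / 2 ^ j % 2 ≤ 0 ∧ 1 ≤ j ∧ j + 2 ≤ k) := by
      simp only [Test.holds_and, Test.holds_le, Expr.eval_one, Expr.eval_zero, Expr.eval_ofNat,
        Expr.eval_reg, Expr.eval_hadd, a65, a51, h.r2] at hc
      exact_mod_cast hc
    have hSj : ¬ S j := by
      rw [hS, maskSet]
      omega
    have hkept : keptList S (j + 1) = keptList S j := by rw [keptList, if_neg hSj]
    have hlast := H.last.resolve_left fun h => by omega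
    refine Prog.LoopFree.runs trivial (by decide) ⟨a63, a51, ?_, a64, ?_, p, a22,
      ⟨by omega, hlast.2.1, fun c h1 h2 => ?_⟩, astats⟩
    · rw [queryKey, hkept]
      exact a40
    · rw [gapsOK_succ_of_not hSj, DigitsOK, hkept]
      exact aok
    · rcases Nat.lt_succ_iff_lt_or_eq.1 h2 with h2 | rfl
      · exact hlast.2.2 c h1 h2
      · exact hSj
  · have hSj : S j := by
      simp only [Test.holds_and, Test.holds_le, Expr.eval_one, Expr.eval_zero, Expr.eval_ofNat,
        Expr.eval_reg, Expr.eval_hadd, a65, a51, h.r2] at hc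
      have hc' : ¬ (M / 2 ^ j % 2 ≤ 0 ∧ 1 ≤ j ∧ j + 2 ≤ k) := fun h => hc (by exact_mod_cast h)
      rw [hS, maskSet]
      omega
    refine (keepProg_runs hρ hSj h a40 a64 aok a22 H.last astats a32).mono le_rfl
      fun s₂ f₂ ⟨b40, b64, bok, b22, bstats⟩ => ⟨(f₂.1 63 (by decide)).trans a63,
        (f₂.1 51 (by decide)).trans a51, b40, b64, bok, j, b22, ⟨by omega, hSj, fun c _ _ => by omega⟩,
        bstats⟩
  · refine Runs.mono (P := fun s' => s'.reg 51 = (j + 1 : ℕ))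
      (Prog.LoopFree.runs trivial (by decide) (by simp [Prog.result, b51])) le_rfl fun s₃ f₃ e₃ =>
      ⟨p', e₃, ?_, ?_, ?_, ?_, ?_, Or.inr blast,
        ?_⟩
    · rw [f₃.1 63 (by decide), b63]
    · rw [f₃.1 40 (by decide), b40]
    · rw [f₃.1 64 (by decide)]; exact b64
    · rw [f₃.1 64 (by decide)]; exact bok
    · rw [f₃.1 22 (by decide), b22]
    · rw [f₃.1 24 (by decide), f₃.1 25 (by decide), f₃.1 26 (by decide), f₃.1 27 (by decide)]
      exact bstats

theorem scan_runs (hρ : 0 ≤ ρ) (hk : 0 < k) {M : ℕ} (h : QueryRegs n k off B g ρ b L a W Q s)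
    (h62 : s.reg 62 = M) :
    Runs (maskInit ;; .while (.lt (reg 51) (reg 2)) vertexBody) s (k * 254 + 60) fun s' =>
      s'.reg 40 = queryKey B off Q (maskSet k M) k ∧
      (1 ≤ s'.reg 64 ↔ GapsOK ρ Q (maskSet k M) k ∧ DigitsOK B off Q (maskSet k M) k) := by
  refine Runs.mono (T := 50 + (k * (250 + 4) + 4)) (Q := _) ?_ (by omega) fun _ _ h => h
  refine Runs.seq (P := fun s' => Scanned ρ B off Q (maskSet k M) M 0 0 s')
    (Prog.LoopFree.runs (by simp [Prog.LoopFree, maskInit]) (by decide) ?_) fun s₁ f₁ e₁ => ?_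
  · have hq := h.curve 0 hk
    refine ⟨?_, ?_, ?_, ?_, ?_, ?_, Or.inl ⟨rfl, rfl⟩, ?_⟩
    · simp [maskInit, Prog.result]
    · simp [maskInit, Prog.result, h62]
    · simp [maskInit, Prog.result, queryKey, keptList, encode]
    · simp [maskInit, Prog.result]
    · simp [maskInit, Prog.result, GapsOK, DigitsOK, keptList]
    · simp [maskInit, Prog.result, h.r5, hq]
    · simpa [maskInit, Prog.result, h.r5, hq] using IsStats.refl Q (Q 0) (le_refl 0)
  · replace h := h.of_frame f₁ (by decide)
    refine Runs.mono (Runs.for (T := 250) k (fun j s' => ∃ p, Scanned ρ B off Q (maskSet k M) M j p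
      s') ⟨0, e₁⟩ ?_ ?_) (by rw [cost_lt_reg]) fun s₂ f₂ ⟨p, H⟩ => ⟨H.r40, ?_⟩
    · rintro j s' _ ⟨p, H⟩ f
      simp only [Test.holds_lt, Expr.eval_reg, H.r51, f.1 2 (by decide), h.r2]
      exact Nat.cast_lt
    · rintro j s' hj ⟨p, H⟩ f
      exact vertexBody_runs hρ (h.of_frame f (by decide)) H hj
    · rw [← H.ok]
      rcases H.r64 with h | h <;> rw [h] <;> norm_num

variable {E : List ℤ}

theorem answerProg_runs (hb : 0 < b) (hL : 0 < L) (h : QueryRegs n k off B g ρ b L a W Q s)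
    (hT : IsTable (n + 1) b L a {e | e ∈ E} W False) {S : ℕ → Prop}
    (h40 : s.reg 40 = queryKey B off Q S k)
    (h64 : 1 ≤ s.reg 64 ↔ GapsOK ρ Q S k ∧ DigitsOK B off Q S k) :
    Runs answerProg s 140 fun s' =>
      (s'.reg 60 = s.reg 60 ∧ ∀ e, ¬ IsHit n k ρ B off E Q S e) ∨
      ∃ e, IsHit n k ρ B off E Q S e ∧ s'.reg 60 = (e % (n + 1) : ℤ) := by
  refine Runs.mono (Runs.ite (T := 80 + 50) (fun hc => ?_) fun hc => ?_) (by decide)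
    fun _ _ h => h
  · obtain ⟨hgap, hdig⟩ := h64.1 (by simpa using hc)
    refine Runs.seq (lookup_runs hb hL h.dict h40) fun s₁ f₁ ⟨_, a45⟩ => ?_
    set x := queryKey B off Q S k with hx
    set d := digit b W (bucket L a x) with hd
    have a40 := (f₁.1 40 (by decide)).trans h40
    have a49 := (f₁.1 49 (by decide)).trans h.r49
    have a60 : s₁.reg 60 = s.reg 60 := f₁.1 60 (by decide)
    have htest : (Test.and (.lt 0 (reg 45)) (.and (.le (floor (reg 45 / reg 49)) (reg 40))
        (.le (reg 40) (floor (reg 45 / reg 49))))).holds s₁ ↔ 0 < d ∧ d / (n + 1) = x := by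
      simp only [Test.holds_and, Test.holds_lt, Test.holds_le, Expr.eval_zero, Expr.eval_reg,
        Expr.eval_floor, Expr.eval_hdiv, a45, a40, a49, floor_natCast_succ_div, Int.cast_le,
        Int.cast_pos]
      rw [← le_antisymm_iff]
    refine Runs.mono (Runs.ite (T := 10) (fun hc => ?_) fun hc => ?_) (by decide) fun _ _ h => h
    · obtain ⟨hd0, hdx⟩ := htest.1 hc
      refine Prog.LoopFree.runs trivial (by decide) (Or.inr ⟨d, ⟨hgap, hdig,
        ((hT.digit_mem _).resolve_left (by omega)).1, hdx⟩, ?_⟩)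
      simp [Prog.result, a45, a40, a49, Int.emod_def, hdx, mul_comm]
    · refine Prog.LoopFree.runs trivial (by decide) (Or.inl ⟨a60, ?_⟩)
      rintro e ⟨-, -, he, hex⟩
      obtain ⟨h1, h2⟩ := hT.exists_digit not_false e he
      rw [hex] at h1 h2
      have := digit_nonneg hb W (bucket L a x)
      exact hc (htest.2 ⟨lt_of_le_of_ne this (Ne.symm h1), h2⟩)
  · refine Prog.LoopFree.runs trivial (by decide) (Or.inl ⟨rfl, ?_⟩)
    rintro e ⟨h1, h2, -, -⟩
    exact hc (by simpa using h64.2 ⟨h1, h2⟩)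

/-- The query answers "no" if there is no hit at all, and otherwise reports a hit. -/
theorem query_runs (hρ : 0 ≤ ρ) (hk : 0 < k) (hB : B = 2 * off) (hsum : 0 ≤ E.sum)
    (hD : IsDictionary n off g ρ E (s.arr 0)) (h0 : s.reg 0 = k)
    (hQ : ∀ j < k, s.arr 1 j / g = Q j) :
    Runs query s (2000 * (k * 2 ^ k)) fun s' =>
      (s'.reg 0 = 0 ∧ ∀ M < 2 ^ k, ∀ e, ¬ IsHit n k ρ B off E Q (maskSet k M) e) ∨
      ∃ M e, IsHit n k ρ B off E Q (maskSet k M) e ∧ s'.reg 0 = (e % (n + 1) : ℤ) := by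
  subst hB
  obtain ⟨W, hW, hT⟩ := hD.table
  have hpow : k ≤ k * 2 ^ k := Nat.le_mul_of_pos_right _ (by positivity)
  have hpow' : 2 ^ k ≤ k * 2 ^ k := Nat.le_mul_of_pos_left _ hk
  refine Runs.mono (T := 60 + ((k * (10 + 4) + 4) +
    (2 + ((2 ^ k * ((k * 254 + 60) + (140 + 4) + 4) + 4) + 2)))) (Q := _) ?_ (by
      rw [show 2 ^ k * ((k * 254 + 60) + (140 + 4) + 4) = 254 * (k * 2 ^ k) + 208 * 2 ^ k by ring]
      omega) fun _ _ h => h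
  refine Runs.seq (P := fun s' => QueryRegs n k off (2 * off) g ρ (2 + E.sum) (4 * (E.length + 1))
      (s.arr 0 1) W Q s' ∧ s'.reg 60 = 0 ∧ s'.reg 61 = 1 ∧ s'.reg 12 = 0)
    (Prog.LoopFree.runs (by simp [Prog.LoopFree, queryInit]) (by decide)
      ⟨⟨?_, ?_, ?_, ?_, ?_, ?_, ⟨?_, ?_, ?_, ?_, ?_⟩, ?_⟩, ?_, ?_, ?_⟩)
    fun s₁ f₁ ⟨h, a60, a61, a12⟩ => ?_
  · simp [queryInit, Prog.result, h0]
  · simp [queryInit, Prog.result, hD.a7]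
  · simp [queryInit, Prog.result, hD.a8]
  · simp [queryInit, Prog.result, hD.a5]
  · simp [queryInit, Prog.result, hD.a6]
  · simp [queryInit, Prog.result, hD.a0]
  · simp [queryInit, Prog.result]
  · simp [queryInit, Prog.result, hW]
  · simp [queryInit, Prog.result, hD.a3]
  · simp [queryInit, Prog.result, hD.a4]
  · exact hD.powers
  · exact hQ
  · simp [queryInit, Prog.result]
  · simp [queryInit, Prog.result]
  · simp [queryInit, Prog.result]
  refine Runs.seq (Runs.for (T := 10) k (fun i s' => s'.reg 12 = i ∧ s'.reg 61 = (2 ^ i : ℕ)) ?_ ?_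
    ?_) fun s₂ f₂ ⟨_, b61⟩ => ?_
  · exact ⟨by simpa using a12, by simpa using a61⟩
  · intro i s' _ hi f
    simp only [Test.holds_lt, Expr.eval_reg, hi.1, f.1 2 (by decide), h.r2]
    exact Nat.cast_lt
  · rintro i s' hi ⟨c12, c61⟩ f
    refine Prog.LoopFree.runs (by simp [Prog.LoopFree]) (by decide) ⟨?_, ?_⟩
    · simp [Prog.result, c12]
    · simp [Prog.result, c61, pow_succ, mul_comm]
  replace h := h.of_frame f₂ (by decide)
  have b60 := (f₂.1 60 (by decide)).trans a60
  refine Runs.seq (P := fun s' => s'.reg 62 = 0) (Prog.LoopFree.runs trivial (by decide)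
    (by simp [Prog.result])) fun s₃ f₃ c62 => ?_
  replace h := h.of_frame f₃ (by decide)
  have c60 := (f₃.1 60 (by decide)).trans b60
  have c61 := (f₃.1 61 (by decide)).trans b61
  refine Runs.seq (Runs.for (T := (k * 254 + 60) + (140 + 4)) (2 ^ k) (fun M s' => s'.reg 62 = M ∧
    ((s'.reg 60 = 0 ∧ ∀ M' < M, ∀ e, ¬ IsHit n k ρ (2 * off) off E Q (maskSet k M') e) ∨
      ∃ M' e, IsHit n k ρ (2 * off) off E Q (maskSet k M') e ∧ s'.reg 60 = (e % (n + 1) : ℤ)))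
    ?_ ?_ ?_) fun s₄ f₄ ⟨_, d60⟩ => ?_
  · exact ⟨by simpa using c62, Or.inl ⟨c60, fun M' hM' => by omega⟩⟩
  · intro M s' _ hM f
    simp only [Test.holds_lt, Expr.eval_reg, hM.1, f.1 61 (by decide), c61]
    exact Nat.cast_lt
  · rintro M s' hM ⟨d62, d60⟩ f
    replace h := h.of_frame f (by decide)
    obtain ⟨t₁, s₁, ht₁, he₁, e40, e64⟩ := scan_runs hρ hk h d62
    have e60 : s₁.reg 60 = s'.reg 60 := he₁.frame.1 60 (by decide)
    have e62 := (he₁.frame.1 62 (by decide)).trans d62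
    obtain ⟨t₂, s₂, ht₂, he₂, hans⟩ := answerProg_runs (by omega) (by omega)
      (h.of_frame he₁.frame (by decide)) hT e40 e64
    have g62 := (he₂.frame.1 62 (by decide)).trans e62
    obtain ⟨t₃, s₃, ht₃, he₃, i62⟩ : Runs (62 ≔ reg 62 + 1) s₂ 4 fun s' => s'.reg 62 = (M + 1 : ℕ) :=
      Prog.LoopFree.runs trivial (by decide) (by simp [Prog.result, g62])
    have i60 : s₃.reg 60 = s₂.reg 60 := he₃.frame.1 60 (by decide)
    cases he₁ with
    | seq x₁ x₂ =>
    refine ⟨_, s₃, ?_, .seq x₁ (.seq x₂ (.seq he₂ he₃)), i62, ?_⟩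
    · omega
    rw [i60]
    rcases hans with ⟨h1, h2⟩ | ⟨e, h1, h2⟩
    · rw [h1, e60]
      rcases d60 with ⟨h3, h4⟩ | h3
      · refine Or.inl ⟨h3, fun M' hM' => ?_⟩
        rcases Nat.lt_succ_iff_lt_or_eq.1 hM' with h | rfl
        · exact h4 M' h
        · exact h2
      · exact Or.inr h3
    · exact Or.inr ⟨M, e, h1, h2⟩
  · exact Prog.LoopFree.runs trivial (by decide) (by simpa [Prog.result] using d60)

end Specs

end RealRAM

/-! ### The data structure for near neighbours -/

section

open RealRAM

theorem curve_scaled (m : ℕ) (g : ℝ) (Y : ℕ → ℕ → ℝ) (i : ℕ) :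
    curve m (scaled m g Y i) = g⁻¹ • curve m (Y i) := by
  rw [← curve_smul]
  refine curve_congr fun p hp => ?_
  rw [scaled, min_eq_left (by omega)]
  ring

theorem frechetDist_scaled {m k : ℕ} {g : ℝ} (hg : 0 < g) (Y Z : ℕ → ℕ → ℝ) (i j : ℕ) :
    frechetDist (curve m (scaled m g Y i)) (curve k (scaled k g Z j)) =
      g⁻¹ * frechetDist (curve m (Y i)) (curve k (Z j)) := by
  rw [curve_scaled, curve_scaled, frechetDist_smul (inv_nonneg.2 hg.le)]

theorem scaled_last {m : ℕ} (g : ℝ) (Y : ℕ → ℕ → ℝ) (i : ℕ) :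
    scaled m g Y i m = scaled m g Y i (m - 1) := by
  rw [scaled, scaled, min_eq_right (by omega), min_self]

section Correctness

variable {X : ℕ → ℕ → ℝ} {n m k : ℕ} {ρ δ : ℝ} {B off : ℤ} {E : List ℤ} {Q : ℕ → ℝ}

/-- Every hit is an entry for a time series that is close to the query. -/
theorem IsEntryList.of_isHit (H : IsEntryList X n m k ρ δ B off E) (hρ : 0 ≤ ρ) (hm : 0 < m)
    (hk : 0 < k) (hX : ∀ i, X i m = X i (m - 1)) (hQ : Q k = Q (k - 1)) {M : ℕ} {e : ℤ}
    (he : IsHit n k ρ B off E Q (maskSet k M) e) :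
    ∃ i < n, e % (n + 1) = i + 1 ∧ frechetDist (curve m (X i)) (curve k Q) ≤ 2 * ρ + 1 := by
  obtain ⟨hgap, hdig, hE, hkey⟩ := he
  obtain ⟨i, hi, a, l, f, h, rfl, hv, hlast⟩ := H.sound e hE
  have hi1 : (0 : ℤ) ≤ i + 1 := by omega
  have hi2 : (i : ℤ) + 1 < n + 1 := by omega
  have hn : (n : ℤ) + 1 ≠ 0 := by omega
  rw [add_assoc, Int.add_comm, Int.add_mul_ediv_right _ _ hn, Int.ediv_eq_zero_of_lt hi1 hi2,
    zero_add] at hkey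
  refine ⟨i, hi, ?_, ?_⟩
  · rw [add_assoc, Int.add_comm, Int.add_mul_emod_self_right, Int.emod_eq_of_lt hi1 hi2]
  · have hl : (keptList (maskSet k M) k).map (fun j => ⌊Q j⌋) = a :: l := by
      refine (encode_injective ?_ ?_ hkey).symm
      · intro b hb
        obtain ⟨f, hf⟩ := hv.exists_of_mem b hb
        exact hf.2
      · intro b hb
        obtain ⟨j, hj, rfl⟩ := List.mem_map.1 hb
        exact hdig j hj
    exact frechetDist_le_of_vreach_floor hρ hm hk (hX i) hQ (Or.inr (Or.inl rfl))
      (Or.inr (Or.inr (by omega))) hgap (fun f a h => h.1) hl hv hlast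

/-- If a time series is close to the query, then there is a hit. -/
theorem IsEntryList.exists_isHit {ρ₀ : ℝ} (hρ : ρ = ρ₀ + 1) (hδ : δ = 3 * ρ₀ + 1)
    (H : IsEntryList X n m k ρ δ B off E) (hρ₀ : 0 ≤ ρ₀) (hm : 0 < m) (hk : 0 < k)
    (hX : ∀ i, X i m = X i (m - 1)) {i : ℕ} (hi : i < n)
    (hlt : frechetDist (curve m (X i)) (curve k Q) < ρ₀) :
    ∃ M < 2 ^ k, ∃ e, IsHit n k ρ B off E Q (maskSet k M) e := by
  subst hρ hδ
  obtain ⟨S, h0, h1, hgap, a, l, f, h, hl, hv, hlast⟩ :=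
    exists_vreach_of_frechetDist_lt hρ₀ hm hk (hX i) hlt
  obtain ⟨M, hM, hMS⟩ := exists_mask k S
  have hS : ∀ j < k, (S j ↔ maskSet k M j) := by
    intro j hj
    rw [maskSet, hMS j hj]
    refine ⟨Or.inl, fun h => ?_⟩
    rcases h with h | rfl | h
    · exact h
    · exact h0
    · rwa [show j = k - 1 by omega]
  have hkept := keptList_congr hS
  have hlen : (a :: l).length ≤ k := by
    rw [← hl, List.length_map]
    exact length_keptList_le S k
  refine ⟨M, hM, _, (hgap.mono (by linarith)).congr hS, ?_, H.complete i hi a l f h hlen hv hlast,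
    ?_⟩
  · intro j hj
    rw [← hkept] at hj
    have : ⌊Q j⌋ ∈ a :: l := by
      rw [← hl]
      exact List.mem_map.2 ⟨j, hj, rfl⟩
    obtain ⟨f, hf⟩ := hv.exists_of_mem _ this
    exact H.range i hi f _ hf
  · rw [queryKey, ← hkept, hl, add_assoc, Int.add_comm, Int.add_mul_ediv_right _ _ (by omega),
      Int.ediv_eq_zero_of_lt (by omega) (by omega), zero_add]

end Correctness

theorem RealRAM.IsDictionary.congr {n : ℕ} {off : ℤ} {g ρ : ℝ} {E : List ℤ} {A A' : ℕ → ℝ}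
    (h : IsDictionary n off g ρ E A)
    (hA : ∀ l < 10 + 2 * (4 * (E.length + 1)), A' l = A l) : IsDictionary n off g ρ E A' where
  a0 := by rw [hA 0 (by omega), h.a0]
  table := by rw [hA 1 (by omega), hA 2 (by omega)]; exact h.table
  a3 := by rw [hA 3 (by omega), h.a3]
  a4 := by rw [hA 4 (by omega), h.a4]
  a5 := by rw [hA 5 (by omega), h.a5]
  a6 := by rw [hA 6 (by omega), h.a6]
  a7 := by rw [hA 7 (by omega), h.a7]
  a8 := by rw [hA 8 (by omega), h.a8]
  powers c hc := by
    rw [hA (10 + c) (by omega), hA (10 + 4 * (E.length + 1) + c) (by omega)]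
    exact h.powers c hc

/-- The vertices of finitely many time series as a function on pairs of natural numbers. -/
noncomputable def vertexFun {n m : ℕ} (P : Fin n → Fin m → ℝ) (i p : ℕ) : ℝ :=
  if h : i < n ∧ p < m then P ⟨i, h.1⟩ ⟨p, h.2⟩ else 0

theorem curve_vertexFun {n m : ℕ} (P : Fin n → Fin m → ℝ) (i : Fin n) :
    curve m (vertexFun P i) = polyline (P i) := by
  rw [curve]
  congr 1
  funext p
  rw [vertexFun, dif_pos ⟨i.2, p.2⟩]

theorem preprocessInput_arr {n m : ℕ} (k : ℕ) (ε r : ℝ) (P : Fin n → Fin m → ℝ)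
    (ω : ℕ → unitInterval) {i p : ℕ} (hi : i < n) (hp : p < m) :
    (preprocessInput k ε r P ω).arr 0 (i * m + p) = vertexFun P i p := by
  rw [vertexFun, dif_pos ⟨hi, hp⟩, preprocessInput]
  simp only [true_and]
  rw [dif_pos (natCast_mul_add_lt hi hp)]
  congr 1
  · congr 1
    rw [mul_comm, Nat.mul_add_div (by omega), Nat.div_eq_of_lt hp, add_zero]
  · refine Fin.ext ?_
    change (i * m + p) % m = p
    rw [mul_comm, Nat.mul_add_mod, Nat.mod_eq_of_lt hp]

section Bounds

variable {n m k : ℕ} {ε : ℝ} {N : ℕ}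

theorem one_le_ratio (hk : 1 ≤ k) (hkm : k ≤ m) (hε : 0 < ε) (hε1 : ε ≤ 1) :
    1 ≤ (m : ℝ) / (k * ε) := by
  have hk0 : (0 : ℝ) < k := by exact_mod_cast hk
  rw [le_div_iff₀ (by positivity), one_mul]
  have : (k : ℝ) ≤ m := by exact_mod_cast hkm
  nlinarith

theorem time_bound (hn : 1 ≤ n) (hk : 1 ≤ k) (hkm : k ≤ m) (hε : 0 < ε) (hε1 : ε ≤ 1)
    (hN : N ≤ n * leafBound (2 * (2 * (⌊48 / ε⌋₊ + 8) + 1)) (m - 1) k) :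
    ((n * m * 40 + n * 140 + n * workBound 1000 (2 * (2 * (⌊48 / ε⌋₊ + 8) + 1)) (m - 1) k +
      560 * N + 730 : ℕ) : ℝ) ≤ 40000 * (n * m) * (40000 * (m / (k * ε))) ^ k := by
  have hL := leafBound_le hk hkm hε hε1
  have hW := workBound_le 1000 hk hkm hε hε1
  have hY := one_le_ratio hk hkm hε hε1
  set y := (m : ℝ) / (k * ε)
  have hn1 : (1 : ℝ) ≤ n := by exact_mod_cast hn
  have hm1 : (1 : ℝ) ≤ m := by exact_mod_cast hk.trans hkm
  set Z := (2724 * y) ^ k with hZ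
  have hZ1 : 1 ≤ Z := one_le_pow₀ (by linarith)
  have hZ2 : (1362 * y) ^ k ≤ Z := pow_le_pow_left₀ (by linarith) (by linarith) k
  have hZ3 : Z ≤ (40000 * y) ^ k := pow_le_pow_left₀ (by linarith) (by linarith) k
  have hN' : (N : ℝ) ≤ n * Z := by
    refine (Nat.cast_le.2 hN).trans ?_
    rw [Nat.cast_mul]
    gcongr
    exact hL.trans hZ2
  have hnm : (1 : ℝ) ≤ n * m := one_le_mul_of_one_le_of_one_le hn1 hm1
  have e1 : (n : ℝ) ≤ n * m := le_mul_of_one_le_right (by linarith) hm1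
  have e2 : (n : ℝ) * m ≤ n * m * Z := le_mul_of_one_le_right (by linarith) hZ1
  have e3 : (n : ℝ) * Z ≤ n * m * Z := by gcongr
  have e4 : (n : ℝ) * workBound 1000 (2 * (2 * (⌊48 / ε⌋₊ + 8) + 1)) (m - 1) k ≤
      1000 * (n * m * Z) :=
    calc _ ≤ (n : ℝ) * ((1000 : ℕ) * (m * Z)) := by gcongr
      _ = _ := by push_cast; ring
  calc _ ≤ 40000 * (n * m * Z) := by
        push_cast
        linarith
    _ ≤ 40000 * (n * m * (40000 * y) ^ k) := by gcongr
    _ = _ := by ring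

theorem space_bound (hn : 1 ≤ n) (hk : 1 ≤ k) (hkm : k ≤ m) (hε : 0 < ε) (hε1 : ε ≤ 1)
    (hN : N ≤ n * leafBound (2 * (2 * (⌊48 / ε⌋₊ + 8) + 1)) (m - 1) k) :
    ((10 + 2 * (4 * (N + 1)) : ℕ) : ℝ) ≤ n * (40000 * (m / (k * ε))) ^ k := by
  have hL := leafBound_le hk hkm hε hε1
  have hY := one_le_ratio hk hkm hε hε1
  set y := (m : ℝ) / (k * ε)
  have hn1 : (1 : ℝ) ≤ n := by exact_mod_cast hn
  set Z := (1362 * y) ^ k with hZ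
  have hZ1 : 1 ≤ Z := one_le_pow₀ (by linarith)
  have hN' : (N : ℝ) ≤ n * Z := by
    refine (Nat.cast_le.2 hN).trans ?_
    rw [Nat.cast_mul]
    gcongr
  have hnZ : 1 ≤ n * Z := one_le_mul_of_one_le_of_one_le hn1 hZ1
  have h26 : (26 : ℝ) ≤ 26 ^ k := le_self_pow₀ (by norm_num) (by omega)
  calc ((10 + 2 * (4 * (N + 1)) : ℕ) : ℝ) ≤ 26 * (n * Z) := by push_cast; linarith
    _ ≤ 26 ^ k * (n * Z) := by gcongr
    _ = n * (26 * (1362 * y)) ^ k := by rw [mul_pow]; ring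
    _ ≤ n * (40000 * y) ^ k :=
        mul_le_mul_of_nonneg_left (pow_le_pow_left₀ (by linarith) (by linarith) k) (by linarith)

end Bounds

end

open RealRAM in
theorem mainTheorem1 :
    ∃ (pre qry : Prog) (C : ℝ), 0 < C ∧
      ∀ (n m k : ℕ) (ε r : ℝ) (P : Fin n → Fin m → ℝ),
        1 ≤ n → 1 ≤ k → k ≤ m → 0 < ε → ε ≤ 1 → 0 < r →
        expectedTime pre (preprocessInput k ε r P) ≤
            ENNReal.ofReal (C * (n * m) * (C * (m / (k * ε))) ^ k) ∧
        ∀ (ω : ℕ → unitInterval) (t : ℕ) (s : State),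
          Exec pre (preprocessInput k ε r P ω) t s →
            (structureSize s : ℝ) ≤ n * (C * (m / (k * ε))) ^ k ∧
            ∀ (q : Fin k → ℝ) (ω' : ℕ → unitInterval),
              ∃ (t' : ℕ) (s' : State) (a : Option (Fin n)),
                Exec qry (queryInput s q ω') t' s' ∧
                (t' : ℝ) ≤ C * (k * 2 ^ k) ∧
                Reports s' a ∧
                IsANNAnswer (2 + ε) r (fun i => polyline (P i)) (polyline q) a := by
  refine ⟨preprocess, query, 40000, by norm_num, fun n m k ε r P hn hk hkm hε hε1 hr => ?_⟩
  have hm : 0 < m := hk.trans hkm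
  set g := ε * r / 16 with hg
  have hg0 : 0 < g := by positivity
  set ρ := 16 / ε + 2 with hρ
  have hρ0 : 0 ≤ ρ := by positivity
  -- rounding turns the distance `3 * (16 / ε + 1)` of the kept vertices from those of the series
  -- into this `δ`; the random numbers in the state below are irrelevant
  obtain ⟨off, E, hlist, hlen, htime, hpre⟩ := preprocess_spec (δ := 3 * (16 / ε + 1) + 1) (k := k)
    (s := preprocessInput k ε r P 0) (n := n) (r := r) (Y := vertexFun P) hm hε
    (by rw [show 48 / ε = 3 * (16 / ε) by ring]; linarith) rfl rfl rfl rfl rfl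
    fun i hi p hp => preprocessInput_arr k ε r P 0 hi hp
  refine ⟨?_, fun ω t s he => ?_⟩
  · refine le_trans (b := _) htime ?_
    rw [← ENNReal.ofReal_natCast]
    exact ENNReal.ofReal_le_ofReal (time_bound hn hk hkm hε hε1 hlen)
  obtain ⟨hD, hreg⟩ := hpre ω t s he
  have hsize : structureSize s = 10 + 2 * (4 * (E.length + 1)) := by
    rw [structureSize, hreg, Nat.floor_natCast]
  refine ⟨by rw [hsize]; exact space_bound hn hk hkm hε hε1 hlen, fun q ω' => ?_⟩
  set Z : ℕ → ℕ → ℝ := vertexFun fun _ : Fin 1 => q with hZ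
  set Q := scaled k g Z 0 with hQ
  have hdist : ∀ i : Fin n, frechetDist (curve m (scaled m g (vertexFun P) i)) (curve k Q) =
      g⁻¹ * frechetDist (polyline (P i)) (polyline q) := by
    intro i
    rw [hQ, frechetDist_scaled hg0, curve_vertexFun]
    exact congrArg (fun c => g⁻¹ * frechetDist (polyline (P i)) c)
      (curve_vertexFun (fun _ : Fin 1 => q) 0)
  have hD' : IsDictionary n off g ρ E ((queryInput s q ω').arr 0) := hD.congr fun l hl => by
    rw [queryInput]
    simp only [if_true, hsize, if_pos hl]
  obtain ⟨t', s', ht', he', hres⟩ := query_runs (Q := Q) (s := queryInput s q ω') hρ0 hk rfl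
    (List.sum_nonneg fun e he => by have := hlist.one_le e he; omega) hD' rfl (by
      intro j hj
      rw [hQ, scaled, min_eq_left (by omega), hZ, vertexFun, dif_pos ⟨Nat.zero_lt_one, hj⟩]
      simp [queryInput, hj])
  have ht : (t' : ℝ) ≤ 40000 * (k * 2 ^ k) := by
    have : (t' : ℝ) ≤ 2000 * (k * 2 ^ k) := by exact_mod_cast ht'
    have : (0 : ℝ) ≤ k * 2 ^ k := by positivity
    linarith
  rcases hres with ⟨h0, hno⟩ | ⟨M, e, hhit, hrep⟩
  · refine ⟨t', s', none, he', ht, h0, ?_, fun _ => rfl, Or.inl rfl⟩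
    rintro ⟨i, hi⟩
    -- the distance is at most `16 / ε` in units of `g`, and the extra `1` makes this strict
    obtain ⟨M, hM, e, hhit⟩ := hlist.exists_isHit (ρ₀ := 16 / ε + 1) (Q := Q)
      (by ring) rfl (by positivity) hm hk (scaled_last g (vertexFun P)) i.2 (by
        rw [hdist]
        have : g⁻¹ * r = 16 / ε := by
          rw [hg]
          field_simp
        have := mul_le_mul_of_nonneg_left hi (inv_nonneg.2 hg0.le)
        linarith)
    exact absurd hhit (hno M hM e)
  · obtain ⟨i, hi, hmod, hle⟩ := hlist.of_isHit hρ0 hm hk (scaled_last g (vertexFun P))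
      (scaled_last g Z 0) hhit
    have hlt : frechetDist (polyline (P ⟨i, hi⟩)) (polyline q) < (2 + ε) * r := by
      rw [hdist ⟨i, hi⟩, inv_mul_le_iff₀ hg0] at hle
      refine hle.trans_lt ?_
      have : g * (2 * ρ + 1) = 2 * r + 5 / 16 * (ε * r) := by
        rw [hg, hρ]
        field_simp
        ring
      have : 0 < ε * r := by positivity
      nlinarith
    refine ⟨t', s', some ⟨i, hi⟩, he', ht, ?_, fun _ => ⟨_, rfl, hlt.le⟩,
      fun h => absurd hlt (not_lt.2 (h _)), Or.inr ⟨_, rfl, hlt.le⟩⟩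
    rw [Reports, hrep, hmod]
    push_cast
    rfl
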